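/- Let $n\ge 1$, equip $\mathbb{R}^n$ with the $\ell^\infty$ metric $|x-y|$, and let $\mu$ be a Borel measure on $\mathbb{R}^n$. Assume that there are $\lambda\colon\mathbb{R}^n\times(0,\infty)\to(0,\infty)$ and a constant $C_\lambda$ such that, for all $x\in\mathbb{R}^n$ and $r>0$, $\mu(B(x,r))\le\lambda(x,r)$, the function $r\mapsto\lambda(x,r)$ is non-decreasing, and $\lambda(x,2r)\le C_\lambda\lambda(x,r)$. Let $\alpha>0$ and let $s_t(x,y)$, $t>0$, $x,y\in\mathbb{R}^n$, be a complex-valued kernel, jointly Borel measurable in $(t,x,y)$, such that for some constant $C_s$ $$|s_t(x,y)|\le C_s\,\frac{t^\alpha}{t^\alpha\lambda(x,t)+|x-y|^\alpha\lambda(x,|x-y|)}\quad\text{for all } t>0,\ x,y\in\mathbb{R}^n,$$ $$|s_t(x,y)-s_t(x,z)|\le C_s\,\frac{|y-z|^\alpha}{t^\alpha\lambda(x,t)+|x-y|^\alpha\lambda(x,|x-y|)}\quad\text{whenever } |y-z|<t/2,$$ where $|x-y|^\alpha\lambda(x,|x-y|)$ is read as $0$ if $x=y$. Put $$\theta_tf(x)=\int_{\mathbb{R}^n}s_t(x,y)f(y)\,d\mu(y).$$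 A cube is a set $Q=\prod_{i=1}^n[a_i,a_i+\ell(Q))$ with $\ell(Q)>0$; $3Q$ is the concentric cube with sidelength $3\ell(Q)$, and $\widehat Q=Q\times(0,\ell(Q))$. Assume that there are a function $b\in L^\infty(\mu)$, with $\|b\|_{L^\infty(\mu)}\le B$, and constants $c>0$ and $C_1$ such that for every cube $Q\subset\mathbb{R}^n$ $$\Big|\int_Qb\,d\mu\Big|\ge c\,\mu(Q)\qquad\text{and}\qquad\iint_{\widehat Q}|\theta_tb(x)|^2\,d\mu(x)\frac{dt}{t}\le C_1\,\mu(3Q).$$ Then for every $f\in L^2(\mu)$ the integral defining $\theta_tf(x)$ converges absolutely for all $x\in\mathbb{R}^n$ and $t>0$, and $$\iint_{\mathbb{R}^{n+1}_+}|\theta_tf(x)|^2\,d\mu(x)\frac{dt}{t}\le C\,\|f\|_{L^2(\mu)}^2,$$ where $C$ depends only on $n,\alpha,C_\lambda,C_s,B,c,C_1$. -/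

import Mathlib

open MeasureTheory Set
open scoped ENNReal

/-- The space `Fin n → ℝ` carries the `ℓ^∞` metric, so `Metric.ball` is an `ℓ^∞` ball.
`lam` is a positive, non-decreasing, doubling (with constant `Clam`) majorant of
`(x, r) ↦ μ (B(x, r))`. Only radii `r > 0` are constrained. -/
structure IsUpperDoubling {n : ℕ} (μ : Measure (Fin n → ℝ)) (lam : (Fin n → ℝ) → ℝ → ℝ)
    (Clam : ℝ) : Prop where
  pos : ∀ x r, 0 < r → 0 < lam x r
  mono : ∀ x, MonotoneOn (lam x) (Ioi 0)
  doubling : ∀ x r, 0 < r → lam x (2 * r) ≤ Clam * lam x r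
  measure_ball_le : ∀ x r, 0 < r → μ (Metric.ball x r) ≤ ENNReal.ofReal (lam x r)

/-- The common denominator `t^α lam(x,t) + |x-y|^α lam(x,|x-y|)` of the kernel estimates.
Since `α > 0`, the second summand is `0` when `x = y`, whatever `lam x 0` is. -/
noncomputable def kernelDenom {n : ℕ} (lam : (Fin n → ℝ) → ℝ → ℝ) (α t : ℝ)
    (x y : Fin n → ℝ) : ℝ :=
  t ^ α * lam x t + dist x y ^ α * lam x (dist x y)

/-- A family of kernels `s_t(x,y)`, `t > 0`, jointly measurable in `(t,x,y)`, with the size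
estimate and the Hölder estimate in the last variable, both with constant `Cs`. -/
structure IsSquareKernel {n : ℕ} (lam : (Fin n → ℝ) → ℝ → ℝ) (α Cs : ℝ)
    (s : ℝ → (Fin n → ℝ) → (Fin n → ℝ) → ℂ) : Prop where
  measurable : Measurable
    (fun p : Ioi (0 : ℝ) × (Fin n → ℝ) × (Fin n → ℝ) => s (p.1 : ℝ) p.2.1 p.2.2)
  size : ∀ t, 0 < t → ∀ x y, ‖s t x y‖ ≤ Cs * (t ^ α / kernelDenom lam α t x y)
  holder : ∀ t, 0 < t → ∀ x y z, dist y z < t / 2 →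
    ‖s t x y - s t x z‖ ≤ Cs * (dist y z ^ α / kernelDenom lam α t x y)

/-- `θ_t f(x) = ∫ s_t(x,y) f(y) dμ(y)`. -/
noncomputable def theta {n : ℕ} (μ : Measure (Fin n → ℝ))
    (s : ℝ → (Fin n → ℝ) → (Fin n → ℝ) → ℂ) (f : (Fin n → ℝ) → ℂ) (t : ℝ)
    (x : Fin n → ℝ) : ℂ :=
  ∫ y, s t x y * f y ∂μ

/-- The (half-open) cube with lower corner `a` and sidelength `l`. Its concentric dilate by
the factor `3` is `cube (fun i => a i - l) (3 * l)`. -/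
def cube {n : ℕ} (a : Fin n → ℝ) (l : ℝ) : Set (Fin n → ℝ) :=
  {x | ∀ i, x i ∈ Ico (a i) (a i + l)}

/-! Fix L > 0 and a grid of cubes of sidelength L/2^k, k ≥ 0, shifted by τ. On the cells of level k
let a_k be the average of f divided by the average of b; accretivity makes this legitimate. For t
between L/2^(j+1) and L/2^j the claim is that θ_t f(x) is a_j(x) θ_t b(x) up to an error summable
over all scales.

For the error, f - a_j(x) b is split into a remainder f - b a_{j+N}, the fine pieces b(a_{k+1} -
a_k) with k ≥ j, and the coarse piece b(a_j - a_j(x)). The fine pieces have mean zero on the cells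
of level k, so the Hölder estimate gains a power of 2^(-(k-j)); the remainder tends to 0 for the
same reason, and no convergence theorem for the martingale is needed. In the coarse piece the
difference d_k = a_k - a_{k-1} (with d_0 = a_0) is constant on the level-k cell of x, so only points
outside that cell contribute. This is small if x is good, that is, at distance at least η(3/4)^(j-k)
L/2^k = η(3/2)^(j-k) L/2^j from the hyperplanes of each level k ≤ j. The result is
`HasTailBound.enorm_theta_sub_le`, with geometric decay in |j - k|; it is summed by the bound of
Σ‖d_k‖² by ‖f‖² (`tsum_lintegral_adaptedDiff_sq_le`), which comes from orthogonality of martingale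
differences and Carleson embedding.

The main term a_j θ_t b is also handled by Carleson embedding, but that needs μ(Q) in the packing
condition where the hypothesis has μ(3Q), and μ need not be doubling. Goodness helps again: for t
much smaller than the side of Q, a good x in Q satisfies t < dist(x, Qᶜ)/8, and on this region a
Whitney decomposition with bounded overlap turns μ(3Q) into μ(Q) (`setLIntegral_whitney_le`). The
boundedly many remaining scales are covered by the uniform bound of θ_t b.

Good points suffice, since each point is good for at least half of the shifts τ in [0, L): averaging
over τ costs a factor 2 (`tsum_lintegral_le_of_goodSet`). All constants are independent of L, so L →
∞ gives every t.

The majorant `lam` may vary wildly with the centre. It is replaced by the smallest doubling majorant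
of the ball measures, which is comparable at nearby centres; Fubini then bounds the resulting
averaging operators on L². -/

open scoped NNReal

/-! ### Averages over countable partitions and Carleson embedding -/

section Partition

variable {X ι : Type*} [MeasurableSpace X]

/-- The average of `f` over the fibre of `π` through `x`. -/
noncomputable def fiberAverage (μ : Measure X) (π : X → ι) (f : X → ℂ) (x : X) : ℂ :=
  ⨍ y in π ⁻¹' {π x}, f y ∂μ

/-- The average of the nonnegative function `g` over the fibre of `π` through `x`. -/
noncomputable def fiberLAverage (μ : Measure X) (π : X → ι) (g : X → ℝ≥0∞) (x : X) : ℝ≥0∞ :=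
  ⨍⁻ y in π ⁻¹' {π x}, g y ∂μ

theorem fiberLAverage_congr_fiber {μ : Measure X} {π : X → ι} (g : X → ℝ≥0∞) {x y : X}
    (h : π x = π y) : fiberLAverage μ π g x = fiberLAverage μ π g y := by
  simp only [fiberLAverage, h]

theorem fiberAverage_congr_fiber {μ : Measure X} {π : X → ι} (f : X → ℂ) {x y : X}
    (h : π x = π y) : fiberAverage μ π f x = fiberAverage μ π f y := by
  simp only [fiberAverage, h]

theorem enorm_fiberAverage_le {μ : Measure X} {π : X → ι} (f : X → ℂ) (x : X) :
    ‖fiberAverage μ π f x‖ₑ ≤ fiberLAverage μ π (fun y => ‖f y‖ₑ) x := by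
  rw [fiberAverage, fiberLAverage, average, laverage]
  exact enorm_integral_le_lintegral_enorm _

/-- The Cauchy-Schwarz inequality with a weight, for Lebesgue integrals. -/
theorem sq_lintegral_mul_le {μ : Measure X} {c F : X → ℝ≥0∞} (hc : AEMeasurable c μ)
    (hF : AEMeasurable F μ) :
    (∫⁻ x, c x * F x ∂μ) ^ 2 ≤ (∫⁻ x, c x ∂μ) * ∫⁻ x, c x * F x ^ 2 ∂μ := by
  have h := ENNReal.lintegral_mul_le_Lp_mul_Lq μ Real.HolderConjugate.two_two
    (f := fun x => c x ^ (1 / 2 : ℝ)) (g := fun x => c x ^ (1 / 2 : ℝ) * F x)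
    (hc.pow_const _) ((hc.pow_const _).mul hF)
  have e1 : ∀ x, c x ^ (1 / 2 : ℝ) * c x ^ (1 / 2 : ℝ) = c x := fun x => by
    rw [← ENNReal.rpow_add_of_nonneg _ _ (by norm_num) (by norm_num)]; norm_num
  have e2 : ∀ a : ℝ≥0∞, (a ^ (1 / 2 : ℝ)) ^ 2 = a := fun a => by
    rw [← ENNReal.rpow_natCast, ← ENNReal.rpow_mul]; norm_num
  have e3 : ∀ a : ℝ≥0∞, a ^ (2 : ℝ) = a ^ 2 := fun a => by
    rw [← ENNReal.rpow_natCast]; norm_num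
  simp only [Pi.mul_apply, ← mul_assoc, e1, e3, mul_pow, e2] at h
  calc _ ≤ _ := pow_le_pow_left' h 2
    _ = _ := by rw [mul_pow, e2, e2]

theorem sq_tsum_mul_le (c F : ℕ → ℝ≥0∞) :
    (∑' k, c k * F k) ^ 2 ≤ (∑' k, c k) * ∑' k, c k * F k ^ 2 := by
  have := sq_lintegral_mul_le (μ := Measure.count) (c := c) (F := F)
    (measurable_of_countable _).aemeasurable (measurable_of_countable _).aemeasurable
  simpa only [lintegral_count] using this

theorem sq_fiberLAverage_le {μ : Measure X} {π : X → ι}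
    (hfin : ∀ i, μ (π ⁻¹' {i}) ≠ ∞) {g : X → ℝ≥0∞} (hg : AEMeasurable g μ) (x : X) :
    fiberLAverage μ π g x ^ 2 ≤ fiberLAverage μ π (fun x => g x ^ 2) x := by
  simp only [fiberLAverage, setLAverage_eq]
  by_cases h0 : μ (π ⁻¹' {π x}) = 0
  · rw [setLIntegral_measure_zero _ _ h0]; simp
  have h := sq_lintegral_mul_le (μ := μ.restrict (π ⁻¹' {π x})) (c := 1) (F := g)
    aemeasurable_const hg.restrict
  simp only [Pi.one_apply, one_mul, lintegral_one, Measure.restrict_apply_univ] at h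
  rw [ENNReal.div_eq_inv_mul, mul_pow, ENNReal.div_eq_inv_mul]
  set m := μ (π ⁻¹' {π x})
  calc _ ≤ _ := mul_le_mul_right h _
    _ = (m⁻¹ * m) * (m⁻¹ * ∫⁻ y in π ⁻¹' {π x}, g y ^ 2 ∂μ) := by ring
    _ = _ := by rw [ENNReal.inv_mul_cancel h0 (hfin _), one_mul]

variable [MeasurableSpace ι] [Countable ι] [MeasurableSingletonClass ι]

theorem measurable_of_fiber_const {Y : Type*} [MeasurableSpace Y] [Nonempty Y] {π : X → ι}
    (hπ : Measurable π) {s : X → Y} (hs : ∀ x y, π x = π y → s x = s y) : Measurable s := by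
  obtain ⟨g, rfl⟩ := (Function.factorsThrough_iff s).1 (fun x y h => hs x y h)
  exact (measurable_of_countable g).comp hπ

theorem lintegral_eq_tsum_fiber (μ : Measure X) {π : X → ι} (hπ : Measurable π)
    (F : X → ℝ≥0∞) : ∫⁻ x, F x ∂μ = ∑' i, ∫⁻ x in π ⁻¹' {i}, F x ∂μ := by
  rw [← lintegral_iUnion (fun i => hπ (measurableSet_singleton i))]
  · rw [← preimage_iUnion, iUnion_of_singleton, preimage_univ, Measure.restrict_univ]
  · exact fun i j h => Disjoint.preimage _ (by simpa using h)

/-- Averaging is a conditional expectation: it can be removed under the integral against a weight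
that is constant on the fibres. -/
theorem lintegral_mul_fiberLAverage {μ : Measure X} {π : X → ι} (hπ : Measurable π)
    (hfin : ∀ i, μ (π ⁻¹' {i}) ≠ ∞) {s g : X → ℝ≥0∞} (hs : ∀ x y, π x = π y → s x = s y)
    (hg : AEMeasurable g μ) :
    ∫⁻ x, s x * fiberLAverage μ π g x ∂μ = ∫⁻ x, s x * g x ∂μ := by
  rw [lintegral_eq_tsum_fiber μ hπ, lintegral_eq_tsum_fiber μ hπ]
  congr 1
  ext i
  have hm : MeasurableSet (π ⁻¹' {i}) := hπ (measurableSet_singleton i)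
  by_cases h : ∃ x, π x = i
  · obtain ⟨x₀, rfl⟩ := h
    have h1 : ∫⁻ x in π ⁻¹' {π x₀}, s x * fiberLAverage μ π g x ∂μ
        = ∫⁻ x in π ⁻¹' {π x₀}, s x₀ * fiberLAverage μ π g x₀ ∂μ :=
      setLIntegral_congr_fun hm fun x hx => by
        rw [hs x x₀ hx, fiberLAverage_congr_fiber g hx]
    have h2 : ∫⁻ x in π ⁻¹' {π x₀}, s x * g x ∂μ = ∫⁻ x in π ⁻¹' {π x₀}, s x₀ * g x ∂μ :=
      setLIntegral_congr_fun hm fun x hx => by simp only [hs x x₀ hx]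
    rw [h1, h2, lintegral_const_mul'' _ hg.restrict, setLIntegral_const, mul_assoc]
    congr 1
    rw [fiberLAverage, setLAverage_eq]
    by_cases h0 : μ (π ⁻¹' {π x₀}) = 0
    · rw [h0, mul_zero, setLIntegral_measure_zero _ _ h0]
    · rw [ENNReal.div_mul_cancel h0 (hfin _)]
  · have : π ⁻¹' {i} = ∅ := by
      ext x; simp; exact fun hx => h ⟨x, hx⟩
    simp [this]

theorem lintegral_sq_fiberLAverage_le {μ : Measure X} {π : X → ι} (hπ : Measurable π)
    (hfin : ∀ i, μ (π ⁻¹' {i}) ≠ ∞) {g : X → ℝ≥0∞} (hg : AEMeasurable g μ) :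
    ∫⁻ x, fiberLAverage μ π g x ^ 2 ∂μ ≤ ∫⁻ x, g x ^ 2 ∂μ := by
  calc _ ≤ ∫⁻ x, 1 * fiberLAverage μ π (fun x => g x ^ 2) x ∂μ :=
        lintegral_mono fun x => by rw [one_mul]; exact sq_fiberLAverage_le hfin hg x
    _ = _ := by rw [lintegral_mul_fiberLAverage hπ hfin (fun _ _ _ => rfl) (hg.pow_const 2)]; simp

/-- This is (u - sp)²/p ≥ 0, the tangent-plane inequality for the convex function u²/p. -/
theorem ENNReal.two_mul_le_div_add (u s p : ℝ≥0∞) (h0 : p ≠ 0) (h : p ≠ ∞) :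
    2 * s * u ≤ u ^ 2 / p + s ^ 2 * p := by
  by_cases hu : u = ∞
  · simp [hu, ENNReal.top_div, h]
  by_cases hs : s = ∞
  · simp [hs, h0]
  lift u to NNReal using hu
  lift s to NNReal using hs
  lift p to NNReal using h
  have hp : p ≠ 0 := by simpa using h0
  rw [← ENNReal.coe_pow, ← ENNReal.coe_pow, ← ENNReal.coe_div hp]
  norm_cast
  rw [← NNReal.coe_le_coe]
  have hp' : (0 : ℝ) < p := by positivity
  push_cast
  have : (u : ℝ) ^ 2 / p + s ^ 2 * p - 2 * s * u = (u - s * p) ^ 2 / p := by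
    field_simp; ring
  have : 0 ≤ ((u : ℝ) - s * p) ^ 2 / p := by positivity
  linarith

/-- Carleson's embedding theorem for a refining sequence of countable partitions. -/
theorem carleson_embedding_one {μ : Measure X} {π : ℕ → X → ι} (hπ : ∀ k, Measurable (π k))
    (hfin : ∀ k i, μ (π k ⁻¹' {i}) ≠ ∞)
    (href : ∀ k x y, π (k + 1) x = π (k + 1) y → π k x = π k y)
    {w : ℕ → X → ℝ≥0∞} (hw : ∀ k, Measurable (w k))
    (hcar : ∀ k i, ∑' l, ∫⁻ x in π k ⁻¹' {i}, w (k + l) x ∂μ ≤ μ (π k ⁻¹' {i}))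
    {g : X → ℝ≥0∞} (hg : AEMeasurable g μ) :
    ∑' k, ∫⁻ x, fiberLAverage μ (π k) g x ^ 2 * w k x ∂μ ≤ 4 * ∫⁻ x, g x ^ 2 ∂μ := by
  by_cases hgfin : ∫⁻ x, g x ^ 2 ∂μ = ∞
  · simp [hgfin]
  set u : ℕ → X → ℝ≥0∞ := fun k => fiberLAverage μ (π k) g with hu
  set W : ℕ → X → ℝ≥0∞ := fun k x => ∑' l, fiberLAverage μ (π k) (w (k + l)) x with hW
  have hWle : ∀ k x, W k x ≤ 1 := by
    intro k x
    simp only [hW, fiberLAverage, setLAverage_eq, ENNReal.div_eq_inv_mul]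
    rw [ENNReal.tsum_mul_left]
    calc _ ≤ _ := mul_le_mul_right (hcar k (π k x)) _
      _ ≤ 1 := ENNReal.inv_mul_le_one _
  have hWc : ∀ k x y, π k x = π k y → W k x = W k y := fun k x y h => by
    simp only [hW, fiberLAverage_congr_fiber _ h]
  have huc : ∀ k x y, π k x = π k y → u k x = u k y := fun k x y h =>
    fiberLAverage_congr_fiber _ h
  have hp0 : ∀ k x, 1 + W k x ≠ 0 := fun k x => by simp
  have hpt : ∀ k x, 1 + W k x ≠ ∞ := fun k x =>
    ENNReal.add_ne_top.2 ⟨by simp, ne_top_of_le_ne_top (by simp) (hWle k x)⟩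
  have hWm : ∀ k, Measurable (W k) := fun k => measurable_of_fiber_const (hπ k) (hWc k)
  have hum : ∀ k, Measurable (u k) := fun k => measurable_of_fiber_const (hπ k) (huc k)
  -- The Bellman function u²/(1 + W), where W ≤ 1 is the normalized Carleson mass from level k on.
  -- Its integral never exceeds ∫ g², and from level k to k + 1 it grows by at least a quarter of
  -- the k-th term of the sum.
  set A : ℕ → ℝ≥0∞ := fun k => ∫⁻ x, u k x ^ 2 / (1 + W k x) ∂μ with hA
  have hAle : ∀ k, A k ≤ ∫⁻ x, g x ^ 2 ∂μ := fun k =>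
    (lintegral_mono fun x => ENNReal.div_le_of_le_mul (by
      exact le_mul_of_one_le_right' (by simp))).trans
      (lintegral_sq_fiberLAverage_le (hπ k) (hfin k) hg)
  -- The tangent plane of u²/p at (u_k, 1 + W_k) lies below the value at level k + 1. Averaged over
  -- a cell of level k, u_{k+1} gives back u_k, while W_{k+1} falls short of W_k by the average of
  -- w_k; this deficit is the gain.
  have key : ∀ k, ∫⁻ x, u k x ^ 2 * w k x ∂μ + 4 * A k ≤ 4 * A (k + 1) := by
    intro k
    set s : X → ℝ≥0∞ := fun x => u k x / (1 + W k x) with hs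
    have hsc : ∀ x y, π k x = π k y → s x = s y := fun x y h => by
      simp only [hs, huc k x y h, hWc k x y h]
    have hsm : Measurable s := (hum k).div ((hWm k).const_add 1)
    have hs2c : ∀ x y, π k x = π k y → s x ^ 2 = s y ^ 2 := fun x y h => by rw [hsc x y h]
    have i1 : 2 * ∫⁻ x, s x * g x ∂μ ≤ A (k + 1) + ∫⁻ x, s x ^ 2 * (1 + W (k + 1) x) ∂μ := by
      rw [← lintegral_mul_fiberLAverage (hπ (k + 1)) (hfin (k + 1))
        (fun x y h => hsc x y (href k x y h)) hg,
        ← lintegral_const_mul 2 (show Measurable fun x => s x * u (k + 1) x from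
          hsm.mul (hum _))]
      simp only [hA]
      rw [← lintegral_add_right _ (show Measurable fun x => s x ^ 2 * (1 + W (k + 1) x) from
          (hsm.pow_const 2).mul ((hWm _).const_add 1))]
      refine lintegral_mono fun x => ?_
      have := ENNReal.two_mul_le_div_add (u (k + 1) x) (s x) _ (hp0 (k + 1) x) (hpt (k + 1) x)
      rwa [mul_assoc] at this
    have i2 : ∫⁻ x, s x * g x ∂μ = A k := by
      rw [← lintegral_mul_fiberLAverage (hπ k) (hfin k) hsc hg]
      refine lintegral_congr fun x => ?_
      simp only [hs, sq, ENNReal.div_eq_inv_mul]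
      ring
    have i3 : ∀ m, ∀ hc : (∀ x y, π m x = π m y → s x ^ 2 = s y ^ 2),
        ∫⁻ x, s x ^ 2 * W m x ∂μ = ∑' l, ∫⁻ x, s x ^ 2 * w (m + l) x ∂μ := by
      intro m hc
      simp only [hW, ← ENNReal.tsum_mul_left]
      rw [lintegral_tsum]
      · congr 1
        ext l
        exact lintegral_mul_fiberLAverage (hπ m) (hfin m) hc (hw _).aemeasurable
      · exact fun l => ((hsm.pow_const 2).mul (measurable_of_fiber_const (hπ m)
          fun x y h => fiberLAverage_congr_fiber _ h)).aemeasurable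
    have i4 : ∫⁻ x, s x ^ 2 * W k x ∂μ
        = ∫⁻ x, s x ^ 2 * w k x ∂μ + ∫⁻ x, s x ^ 2 * W (k + 1) x ∂μ := by
      rw [i3 k hs2c, i3 (k + 1) (fun x y h => hs2c x y (href k x y h)),
        tsum_eq_zero_add' ENNReal.summable]
      congr 1
      exact tsum_congr fun l => by rw [add_right_comm, add_assoc]
    have i5 : ∫⁻ x, s x ^ 2 * (1 + W k x) ∂μ = A k := by
      refine lintegral_congr fun x => ?_
      simp only [hs, ENNReal.div_eq_inv_mul]
      calc _ = ((1 + W k x)⁻¹ * (1 + W k x)) * ((1 + W k x)⁻¹ * u k x ^ 2) := by ring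
        _ = _ := by rw [ENNReal.inv_mul_cancel (hp0 k x) (hpt k x), one_mul]
    have i6 : ∫⁻ x, s x ^ 2 * (1 + W (k + 1) x) ∂μ + ∫⁻ x, s x ^ 2 * w k x ∂μ = A k := by
      rw [← i5]
      simp only [mul_add, mul_one]
      rw [lintegral_add_left (hsm.pow_const 2), lintegral_add_left (hsm.pow_const 2), i4]
      ring
    have i7 : A k + ∫⁻ x, s x ^ 2 * w k x ∂μ ≤ A (k + 1) := by
      -- Finiteness permits cancellation; it comes from having set aside the case ∫ g² = ∞.
      have hAf : A k ≠ ∞ := ne_top_of_le_ne_top hgfin (hAle k)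
      refine (ENNReal.add_le_add_iff_left hAf).1 ?_
      calc A k + (A k + ∫⁻ x, s x ^ 2 * w k x ∂μ)
          = 2 * ∫⁻ x, s x * g x ∂μ + ∫⁻ x, s x ^ 2 * w k x ∂μ := by rw [i2]; ring
        _ ≤ A (k + 1) + ∫⁻ x, s x ^ 2 * (1 + W (k + 1) x) ∂μ
            + ∫⁻ x, s x ^ 2 * w k x ∂μ := by gcongr
        _ = A k + A (k + 1) := by rw [add_assoc, i6, add_comm]
    -- The factor 4 is (1 + W)² ≤ 4.
    have i8 : ∫⁻ x, u k x ^ 2 * w k x ∂μ ≤ 4 * ∫⁻ x, s x ^ 2 * w k x ∂μ := by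
      rw [← lintegral_const_mul' _ _ (by norm_num)]
      refine lintegral_mono fun x => ?_
      have : u k x ≤ 2 * s x := by
        have h1 : u k x = s x * (1 + W k x) := by
          simp only [hs]; rw [ENNReal.div_mul_cancel (hp0 k x) (hpt k x)]
        have h2 : 1 + W k x ≤ 2 := by
          calc 1 + W k x ≤ 1 + 1 := by gcongr; exact hWle k x
            _ = 2 := by norm_num
        calc u k x = s x * (1 + W k x) := h1
          _ ≤ s x * 2 := by gcongr
          _ = _ := mul_comm _ _
      calc u k x ^ 2 * w k x ≤ (2 * s x) ^ 2 * w k x := by gcongr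
        _ = _ := by ring
    calc _ ≤ 4 * ∫⁻ x, s x ^ 2 * w k x ∂μ + 4 * A k := by gcongr
      _ = 4 * (A k + ∫⁻ x, s x ^ 2 * w k x ∂μ) := by ring
      _ ≤ _ := by gcongr
  refine ENNReal.tsum_le_of_sum_range_le fun K => ?_
  have : ∑ k ∈ Finset.range K, ∫⁻ x, u k x ^ 2 * w k x ∂μ ≤ 4 * A K := by
    induction K with
    | zero => simp
    | succ K ih =>
      rw [Finset.sum_range_succ, add_comm]
      exact (by gcongr : _ ≤ _ + 4 * A K).trans (key K)
  exact this.trans (by gcongr; exact hAle K)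

theorem carleson_embedding {μ : Measure X} {π : ℕ → X → ι} (hπ : ∀ k, Measurable (π k))
    (hfin : ∀ k i, μ (π k ⁻¹' {i}) ≠ ∞)
    (href : ∀ k x y, π (k + 1) x = π (k + 1) y → π k x = π k y)
    {w : ℕ → X → ℝ≥0∞} (hw : ∀ k, Measurable (w k)) {C : ℝ≥0∞} (hC0 : C ≠ 0) (hC : C ≠ ∞)
    (hcar : ∀ k i, ∑' l, ∫⁻ x in π k ⁻¹' {i}, w (k + l) x ∂μ ≤ C * μ (π k ⁻¹' {i}))
    {g : X → ℝ≥0∞} (hg : AEMeasurable g μ) :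
    ∑' k, ∫⁻ x, fiberLAverage μ (π k) g x ^ 2 * w k x ∂μ ≤ 4 * C * ∫⁻ x, g x ^ 2 ∂μ := by
  have h := carleson_embedding_one hπ hfin href (w := fun k x => C⁻¹ * w k x)
    (fun k => (hw k).const_mul _) (fun k i => by
      simp_rw [lintegral_const_mul _ (hw _)]
      rw [ENNReal.tsum_mul_left]
      calc _ ≤ C⁻¹ * (C * μ (π k ⁻¹' {i})) := by gcongr; exact hcar k i
        _ = _ := by rw [← mul_assoc, ENNReal.inv_mul_cancel hC0 hC, one_mul]) hg
  have e : ∀ k, ∫⁻ x, fiberLAverage μ (π k) g x ^ 2 * w k x ∂μ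
      = C * ∫⁻ x, fiberLAverage μ (π k) g x ^ 2 * (C⁻¹ * w k x) ∂μ := fun k => by
    rw [← lintegral_const_mul' _ _ hC]
    refine lintegral_congr fun x => ?_
    calc _ = (C * C⁻¹) * (fiberLAverage μ (π k) g x ^ 2 * w k x) := by
          rw [ENNReal.mul_inv_cancel hC0 hC, one_mul]
      _ = _ := by ring
  simp_rw [e]
  rw [ENNReal.tsum_mul_left]
  calc _ ≤ C * (4 * ∫⁻ x, g x ^ 2 ∂μ) := by gcongr
    _ = _ := by ring

end Partition

theorem fiber_eq_of_le {X ι : Type*} {π : ℕ → X → ι}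
    (href : ∀ k x y, π (k + 1) x = π (k + 1) y → π k x = π k y) {k m : ℕ} (hkm : k ≤ m) {x y : X} (h : π m x = π m y) :
    π k x = π k y := by
  induction m, hkm using Nat.le_induction with
  | base => exact h
  | succ m _ ih => exact ih (href m x y h)

/-! ### Orthogonality of martingale differences -/

section AdaptedDifferences

variable {X ι : Type*} [MeasurableSpace X]

theorem memLp_two_iff_lintegral {μ : Measure X} {f : X → ℂ} (hf : AEStronglyMeasurable f μ) :
    MemLp f 2 μ ↔ ∫⁻ x, ‖f x‖ₑ ^ 2 ∂μ < ∞ := by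
  have h := eLpNorm_lt_top_iff_lintegral_rpow_enorm_lt_top (μ := μ) (f := f)
    (p := 2) (by norm_num) (by norm_num)
  simp only [ENNReal.toReal_ofNat, ENNReal.rpow_ofNat] at h
  exact ⟨fun hm => h.1 hm.2, fun hl => ⟨hf, h.2 hl⟩⟩

theorem eLpNorm_two_sq {μ : Measure X} (f : X → ℂ) :
    eLpNorm f 2 μ ^ 2 = ∫⁻ x, ‖f x‖ₑ ^ 2 ∂μ := by
  rw [eLpNorm_eq_lintegral_rpow_enorm_toReal (by norm_num) (by norm_num)]
  simp only [ENNReal.toReal_ofNat, ENNReal.rpow_ofNat]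
  rw [← ENNReal.rpow_natCast, ← ENNReal.rpow_mul]
  norm_num

/-- Pythagoras: the cross term is the integral of f - m against a constant, which vanishes. -/
theorem lintegral_enorm_sub_average_sq {μ : Measure X} [IsFiniteMeasure μ] {f : X → ℂ}
    (hf : MemLp f 2 μ) :
    ∫⁻ x, ‖f x - ⨍ y, f y ∂μ‖ₑ ^ 2 ∂μ + ∫⁻ _, ‖⨍ y, f y ∂μ‖ₑ ^ 2 ∂μ
      = ∫⁻ x, ‖f x‖ₑ ^ 2 ∂μ := by
  set m := ⨍ y, f y ∂μ with hm
  have hfi : Integrable f μ := hf.integrable (by norm_num)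
  have hg : MemLp (fun x => f x - m) 2 μ := hf.sub (memLp_const m)
  have hgi : Integrable (fun x => f x - m) μ := hg.integrable (by norm_num)
  have hg2 : Integrable (fun x => ‖f x - m‖ ^ 2) μ := hg.integrable_norm_pow (by norm_num)
  have hf2 : Integrable (fun x => ‖f x‖ ^ 2) μ := hf.integrable_norm_pow (by norm_num)
  have e : ∀ h : X → ℂ, Integrable (fun x => ‖h x‖ ^ 2) μ →
      ∫⁻ x, ‖h x‖ₑ ^ 2 ∂μ = ENNReal.ofReal (∫ x, ‖h x‖ ^ 2 ∂μ) := fun h hh => by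
    rw [ofReal_integral_eq_lintegral_ofReal hh (Filter.Eventually.of_forall fun x => by positivity)]
    simp only [ENNReal.ofReal_pow (norm_nonneg _), ofReal_norm]
  have hc2 : Integrable (fun _ : X => ‖m‖ ^ 2) μ := integrable_const _
  rw [e _ hg2, e (fun _ => m) hc2, e _ hf2, ← ENNReal.ofReal_add (by positivity) (by positivity)]
  congr 1
  have h0 : ∫ x, (f x - m) ∂μ = 0 := integral_sub_average μ f
  have h1 : ∫ x, RCLike.re ((f x - m) * (starRingEnd ℂ) m) ∂μ = 0 := by
    rw [integral_re (hgi.mul_const _), integral_mul_const, h0]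
    simp
  have hi : Integrable (fun x => RCLike.re ((f x - m) * (starRingEnd ℂ) m)) μ :=
    (hgi.mul_const _).re
  have h2 : ∀ x, ‖f x‖ ^ 2
      = (‖f x - m‖ ^ 2 + ‖m‖ ^ 2) + 2 * RCLike.re ((f x - m) * (starRingEnd ℂ) m) := fun x => by
    have := @norm_add_sq ℂ ℂ _ _ _ m (f x - m)
    rw [RCLike.inner_apply] at this
    rw [add_sub_cancel] at this
    rw [this]; ring
  simp_rw [h2]
  rw [integral_add (show Integrable (fun x => ‖f x - m‖ ^ 2 + ‖m‖ ^ 2) μ from hg2.add hc2)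
    (hi.const_mul 2), integral_const_mul, h1, integral_add hg2 hc2]
  simp

theorem setIntegral_fiberAverage {μ : Measure X} {π : X → ι} {x₀ : X}
    (hm : MeasurableSet (π ⁻¹' {π x₀})) (hfin : μ (π ⁻¹' {π x₀}) ≠ ∞) (f : X → ℂ) :
    ∫ x in π ⁻¹' {π x₀}, fiberAverage μ π f x ∂μ = ∫ x in π ⁻¹' {π x₀}, f x ∂μ := by
  have : Fact (μ (π ⁻¹' {π x₀}) < ∞) := ⟨hfin.lt_top⟩
  rw [← integral_average (μ.restrict (π ⁻¹' {π x₀})) f]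
  exact setIntegral_congr_fun hm fun x hx => by
    simp only [fiberAverage]
    rw [show π x = π x₀ from hx]

variable [MeasurableSpace ι] [Countable ι] [MeasurableSingletonClass ι]

theorem measurable_fiberAverage {μ : Measure X} {π : X → ι} (hπ : Measurable π) (f : X → ℂ) :
    Measurable (fiberAverage μ π f) :=
  measurable_of_fiber_const hπ fun _ _ h => fiberAverage_congr_fiber f h

theorem lintegral_enorm_fiberAverage_sq_le {μ : Measure X} {π : X → ι} (hπ : Measurable π)
    (hfin : ∀ i, μ (π ⁻¹' {i}) ≠ ∞) {f : X → ℂ} (hf : AEMeasurable f μ) :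
    ∫⁻ x, ‖fiberAverage μ π f x‖ₑ ^ 2 ∂μ ≤ ∫⁻ x, ‖f x‖ₑ ^ 2 ∂μ :=
  (lintegral_mono fun x => by gcongr; exact enorm_fiberAverage_le f x).trans
    (lintegral_sq_fiberLAverage_le hπ hfin hf.enorm)

theorem lintegral_enorm_sub_fiberAverage_sq {μ : Measure X} {π : X → ι} (hπ : Measurable π)
    (hfin : ∀ i, μ (π ⁻¹' {i}) ≠ ∞) {f : X → ℂ} (hf : MemLp f 2 μ) :
    ∫⁻ x, ‖f x - fiberAverage μ π f x‖ₑ ^ 2 ∂μ + ∫⁻ x, ‖fiberAverage μ π f x‖ₑ ^ 2 ∂μ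
      = ∫⁻ x, ‖f x‖ₑ ^ 2 ∂μ := by
  rw [lintegral_eq_tsum_fiber μ hπ, lintegral_eq_tsum_fiber μ hπ, lintegral_eq_tsum_fiber μ hπ,
    ← ENNReal.tsum_add]
  congr 1
  ext i
  have hm : MeasurableSet (π ⁻¹' {i}) := hπ (measurableSet_singleton i)
  have : Fact (μ (π ⁻¹' {i}) < ∞) := ⟨(hfin i).lt_top⟩
  rw [← lintegral_enorm_sub_average_sq (hf.restrict (π ⁻¹' {i}))]
  congr 1
  · exact setLIntegral_congr_fun hm fun x hx => by
      simp only [fiberAverage]; rw [show π x = i from hx]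
  · exact setLIntegral_congr_fun hm fun x hx => by
      simp only [fiberAverage]; rw [show π x = i from hx]

/-- A coarse cell is a countable disjoint union of fine cells, so equality of integrals passes
upwards. -/
theorem setIntegral_fiber_congr {μ : Measure X} {π π' : X → ι} (hπ : Measurable π)
    (hπ' : Measurable π') (href : ∀ x y, π' x = π' y → π x = π y) {h₁ h₂ : X → ℂ} {i : ι}
    (hi₁ : IntegrableOn h₁ (π ⁻¹' {i}) μ) (hi₂ : IntegrableOn h₂ (π ⁻¹' {i}) μ)
    (heq : ∀ j, ∫ x in π' ⁻¹' {j}, h₁ x ∂μ = ∫ x in π' ⁻¹' {j}, h₂ x ∂μ) :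
    ∫ x in π ⁻¹' {i}, h₁ x ∂μ = ∫ x in π ⁻¹' {i}, h₂ x ∂μ := by
  have hU : π ⁻¹' {i} = ⋃ j, π ⁻¹' {i} ∩ π' ⁻¹' {j} := by
    rw [← inter_iUnion, ← preimage_iUnion, iUnion_of_singleton, preimage_univ, inter_univ]
  have hm : ∀ j, MeasurableSet (π ⁻¹' {i} ∩ π' ⁻¹' {j}) := fun j =>
    (hπ (measurableSet_singleton i)).inter (hπ' (measurableSet_singleton j))
  have hd : Pairwise (Function.onFun Disjoint fun j => π ⁻¹' {i} ∩ π' ⁻¹' {j}) := fun j k h =>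
    (Disjoint.preimage π' (by simpa using h : Disjoint {j} {k})).mono inter_subset_right
      inter_subset_right
  rw [hU] at hi₁ hi₂ ⊢
  rw [integral_iUnion hm hd hi₁, integral_iUnion hm hd hi₂]
  congr 1
  ext j
  by_cases hj : ∃ x, π x = i ∧ π' x = j
  · obtain ⟨x, rfl, rfl⟩ := hj
    have : π ⁻¹' {π x} ∩ π' ⁻¹' {π' x} = π' ⁻¹' {π' x} :=
      inter_eq_right.2 fun y hy => href y x hy
    rw [this, heq]
  · have : π ⁻¹' {i} ∩ π' ⁻¹' {j} = ∅ := by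
      ext x; simp; exact fun h1 h2 => hj ⟨x, h1, h2⟩
    simp [this]

theorem MeasureTheory.MemLp.integrableOn_two {μ : Measure X} {f : X → ℂ} (hf : MemLp f 2 μ) {s : Set X}
    (hs : μ s ≠ ∞) : IntegrableOn f s μ := by
  have : Fact (μ s < ∞) := ⟨hs.lt_top⟩
  exact (hf.restrict s).integrable (by norm_num)

theorem memLp_fiberAverage {μ : Measure X} {π : X → ι} (hπ : Measurable π)
    (hfin : ∀ i, μ (π ⁻¹' {i}) ≠ ∞) {f : X → ℂ} (hf : MemLp f 2 μ) :
    MemLp (fiberAverage μ π f) 2 μ := by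
  rw [memLp_two_iff_lintegral (measurable_fiberAverage hπ f).aestronglyMeasurable]
  exact (lintegral_enorm_fiberAverage_sq_le hπ hfin hf.1.aemeasurable).trans_lt
    ((memLp_two_iff_lintegral hf.1).1 hf)

theorem fiberAverage_fiberAverage {μ : Measure X} {π π' : X → ι} (hπ : Measurable π)
    (hπ' : Measurable π') (hfin : ∀ i, μ (π ⁻¹' {i}) ≠ ∞) (hfin' : ∀ i, μ (π' ⁻¹' {i}) ≠ ∞)
    (href : ∀ x y, π' x = π' y → π x = π y) {f : X → ℂ} (hf : MemLp f 2 μ) (x : X) :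
    fiberAverage μ π (fiberAverage μ π' f) x = fiberAverage μ π f x := by
  rw [fiberAverage, fiberAverage, setAverage_eq, setAverage_eq]
  congr 1
  refine setIntegral_fiber_congr hπ hπ' href
    ((memLp_fiberAverage hπ' hfin' hf).integrableOn_two (hfin _))
    (hf.integrableOn_two (hfin _)) fun j => ?_
  by_cases hj : ∃ y, π' y = j
  · obtain ⟨y, rfl⟩ := hj
    simpa only [fiberAverage, setAverage_eq] using
      setIntegral_fiberAverage (hπ' (measurableSet_singleton _)) (hfin' _) f
  · have : π' ⁻¹' {j} = ∅ := by
      ext x; simp; exact fun h => hj ⟨x, h⟩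
    simp [this]

/-- The martingale differences of a refining sequence of partitions are orthogonal. -/
theorem tsum_lintegral_martingaleDiff_sq_le {μ : Measure X} {π : ℕ → X → ι} (hπ : ∀ k, Measurable (π k))
    (hfin : ∀ k i, μ (π k ⁻¹' {i}) ≠ ∞) (href : ∀ k x y, π (k + 1) x = π (k + 1) y → π k x = π k y)
    {f : X → ℂ} (hf : MemLp f 2 μ) :
    ∑' k, ∫⁻ x, ‖fiberAverage μ (π (k + 1)) f x - fiberAverage μ (π k) f x‖ₑ ^ 2 ∂μ
      ≤ ∫⁻ x, ‖f x‖ₑ ^ 2 ∂μ := by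
  refine ENNReal.tsum_le_of_sum_range_le fun K => ?_
  have h : ∀ k, ∫⁻ x, ‖fiberAverage μ (π (k + 1)) f x - fiberAverage μ (π k) f x‖ₑ ^ 2 ∂μ
      + ∫⁻ x, ‖fiberAverage μ (π k) f x‖ₑ ^ 2 ∂μ
      = ∫⁻ x, ‖fiberAverage μ (π (k + 1)) f x‖ₑ ^ 2 ∂μ := fun k => by
    have := lintegral_enorm_sub_fiberAverage_sq (hπ k) (hfin k)
      (memLp_fiberAverage (hπ (k + 1)) (hfin (k + 1)) hf)
    simpa only [fiberAverage_fiberAverage (hπ k) (hπ (k + 1)) (hfin k) (hfin (k + 1))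
      (href k) hf] using this
  have h2 : ∑ k ∈ Finset.range K,
      ∫⁻ x, ‖fiberAverage μ (π (k + 1)) f x - fiberAverage μ (π k) f x‖ₑ ^ 2 ∂μ
      ≤ ∫⁻ x, ‖fiberAverage μ (π K) f x‖ₑ ^ 2 ∂μ := by
    induction K with
    | zero => simp
    | succ K ih =>
      rw [Finset.sum_range_succ, ← h K, add_comm]
      gcongr
  exact h2.trans (lintegral_enorm_fiberAverage_sq_le (hπ K) (hfin K) hf.1.aemeasurable)

/-- From level k on, the averages over cells inside a level-k cell Q see only the restriction of b
to Q. Orthogonality for that restriction, whose squared norm is at most B² μ(Q), gives the packing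
condition that Carleson embedding needs. -/
theorem tsum_setLIntegral_martingaleDiff_sq_le {μ : Measure X} {π : ℕ → X → ι} (hπ : ∀ k, Measurable (π k))
    (hfin : ∀ k i, μ (π k ⁻¹' {i}) ≠ ∞) (href : ∀ k x y, π (k + 1) x = π (k + 1) y → π k x = π k y)
    {b : X → ℂ} (hb : Measurable b) {B : ℝ≥0}
    (hB : ∀ x, ‖b x‖ₑ ≤ B) (k : ℕ) (i : ι) :
    ∑' l, ∫⁻ x in π k ⁻¹' {i},
        ‖fiberAverage μ (π (k + l + 1)) b x - fiberAverage μ (π (k + l)) b x‖ₑ ^ 2 ∂μ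
      ≤ B ^ 2 * μ (π k ⁻¹' {i}) := by
  have hm : MeasurableSet (π k ⁻¹' {i}) := hπ k (measurableSet_singleton i)
  set f := (π k ⁻¹' {i}).indicator b with hf
  have hfb : ∫⁻ x, ‖f x‖ₑ ^ 2 ∂μ ≤ B ^ 2 * μ (π k ⁻¹' {i}) := by
    rw [← setLIntegral_const, ← lintegral_indicator hm]
    refine lintegral_mono fun x => ?_
    by_cases hx : x ∈ π k ⁻¹' {i}
    · simp only [hf, indicator_of_mem hx]
      gcongr
      exact hB x
    · simp [hf, indicator_of_notMem hx]
  have hfm : Measurable f := hb.indicator hm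
  have hf2 : MemLp f 2 μ := (memLp_two_iff_lintegral hfm.aestronglyMeasurable).2
    (hfb.trans_lt (ENNReal.mul_lt_top (by finiteness) (hfin k i).lt_top))
  have hav : ∀ m, k ≤ m → ∀ x ∈ π k ⁻¹' {i},
      fiberAverage μ (π m) b x = fiberAverage μ (π m) f x := fun m hkm x hx => by
    simp only [fiberAverage, setAverage_eq]
    congr 1
    refine setIntegral_congr_fun (hπ m (measurableSet_singleton _)) fun y hy => ?_
    have : y ∈ π k ⁻¹' {i} := (fiber_eq_of_le href hkm hy).trans hx
    simp only [hf, indicator_of_mem this]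
  refine le_trans ?_ ((tsum_lintegral_martingaleDiff_sq_le (π := fun l => π (k + l))
    (fun l => hπ _) (fun l => hfin _) (fun l => href (k + l)) hf2).trans hfb)
  refine ENNReal.tsum_le_tsum fun l => ?_
  refine le_trans (le_of_eq ?_) (setLIntegral_le_lintegral (π k ⁻¹' {i}) _)
  refine setLIntegral_congr_fun hm fun x hx => ?_
  rw [hav _ (by omega) x hx, hav _ (by omega) x hx, add_assoc]

end AdaptedDifferences

/-! ### Martingale differences adapted to the accretive function -/

section AdaptedCoefficients

variable {X ι : Type*} [MeasurableSpace X] {μ : Measure X} {π : ℕ → X → ι}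

/-- The coefficient `⟨f⟩ / ⟨b⟩` of the `b`-adapted averaging operator `f ↦ b ⟨f⟩ / ⟨b⟩`. -/
noncomputable def adaptedCoeff (μ : Measure X) (π : X → ι) (b f : X → ℂ) (x : X) : ℂ :=
  fiberAverage μ π f x / fiberAverage μ π b x

/-- The differences of the adapted coefficients; the first one is the coarsest coefficient. -/
noncomputable def adaptedDiff (μ : Measure X) (π : ℕ → X → ι) (b f : X → ℂ) : ℕ → X → ℂ
  | 0, x => adaptedCoeff μ (π 0) b f x
  | k + 1, x => adaptedCoeff μ (π (k + 1)) b f x - adaptedCoeff μ (π k) b f x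

theorem adaptedCoeff_congr_fiber {π : X → ι} (b f : X → ℂ) {x y : X} (h : π x = π y) :
    adaptedCoeff μ π b f x = adaptedCoeff μ π b f y := by
  simp only [adaptedCoeff, fiberAverage_congr_fiber _ h]

theorem sum_adaptedDiff (b f : X → ℂ) (j : ℕ) (x : X) :
    ∑ k ∈ Finset.range (j + 1), adaptedDiff μ π b f k x = adaptedCoeff μ (π j) b f x := by
  induction j with
  | zero => simp [adaptedDiff]
  | succ j ih => rw [Finset.sum_range_succ, ih]; simp [adaptedDiff]

/-- Accretivity says nothing on null cells. There averages are 0 by convention, hence so are the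
adapted coefficients, and the bounds below hold at every point. -/
theorem fiberAverage_eq_zero {π : X → ι} {x : X} (h : μ (π ⁻¹' {π x}) = 0) (f : X → ℂ) :
    fiberAverage μ π f x = 0 := by
  rw [fiberAverage, Measure.restrict_eq_zero.2 h, average_zero_measure]

/-- `b` is accretive on the fibres of `π`, with constant `c`. -/
def IsAccretiveOn (μ : Measure X) (π : X → ι) (b : X → ℂ) (c : ℝ≥0) : Prop :=
  ∀ i, c * μ (π ⁻¹' {i}) ≤ ‖∫ x in π ⁻¹' {i}, b x ∂μ‖ₑ

theorem IsAccretiveOn.le_norm_fiberAverage {π : X → ι} {b : X → ℂ} {c : ℝ≥0}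
    (hacc : IsAccretiveOn μ π b c) (hfin : ∀ i, μ (π ⁻¹' {i}) ≠ ∞) {x : X}
    (h0 : μ (π ⁻¹' {π x}) ≠ 0) : c ≤ ‖fiberAverage μ π b x‖ := by
  have h := hacc (π x)
  have hpos : 0 < μ.real (π ⁻¹' {π x}) := ENNReal.toReal_pos h0 (hfin _)
  rw [fiberAverage, setAverage_eq, norm_smul, norm_inv, Real.norm_of_nonneg hpos.le,
    inv_mul_eq_div, le_div_iff₀ hpos]
  have := (ENNReal.toReal_le_toReal (ENNReal.mul_ne_top (by simp) (hfin _)) (by simp)).2 h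
  simpa [Measure.real] using this

theorem IsAccretiveOn.norm_adaptedCoeff_le {π : X → ι} {b : X → ℂ} {c : ℝ≥0}
    (hacc : IsAccretiveOn μ π b c) (hc : 0 < c) (hfin : ∀ i, μ (π ⁻¹' {i}) ≠ ∞) (f : X → ℂ)
    (x : X) : ‖adaptedCoeff μ π b f x‖ ≤ (c : ℝ)⁻¹ * ‖fiberAverage μ π f x‖ := by
  by_cases h0 : μ (π ⁻¹' {π x}) = 0
  · simp [adaptedCoeff, fiberAverage_eq_zero h0]
  have h := hacc.le_norm_fiberAverage hfin h0
  have hc' : (0 : ℝ) < c := hc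
  rw [adaptedCoeff, norm_div, div_eq_inv_mul]
  gcongr

theorem IsAccretiveOn.enorm_adaptedCoeff_le {π : X → ι} {b : X → ℂ} {c : ℝ≥0}
    (hacc : IsAccretiveOn μ π b c) (hc : 0 < c) (hfin : ∀ i, μ (π ⁻¹' {i}) ≠ ∞) (f : X → ℂ)
    (x : X) : ‖adaptedCoeff μ π b f x‖ₑ ≤ (c⁻¹ : ℝ≥0) * ‖fiberAverage μ π f x‖ₑ := by
  have h := hacc.norm_adaptedCoeff_le hc hfin f x
  rw [← coe_nnnorm, ← coe_nnnorm] at h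
  rw [enorm_eq_nnnorm, enorm_eq_nnnorm]
  exact_mod_cast h

/-- The quotient rule p/u - q/v = (p - q)/u - q(u - v)/(uv), with both denominators bounded below by
c. The second term is what Carleson embedding controls. -/
theorem norm_adaptedDiff_succ_le {b : X → ℂ} {c : ℝ≥0} (hacc : ∀ k, IsAccretiveOn μ (π k) b c)
    (hc : 0 < c) (hfin : ∀ k i, μ (π k ⁻¹' {i}) ≠ ∞)
    (href : ∀ k x y, π (k + 1) x = π (k + 1) y → π k x = π k y) (f : X → ℂ) (k : ℕ) (x : X) :
    ‖adaptedDiff μ π b f (k + 1) x‖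
      ≤ (c : ℝ)⁻¹ * ‖fiberAverage μ (π (k + 1)) f x - fiberAverage μ (π k) f x‖
        + (c : ℝ)⁻¹ ^ 2 * (‖fiberAverage μ (π k) f x‖
          * ‖fiberAverage μ (π (k + 1)) b x - fiberAverage μ (π k) b x‖) := by
  have hc' : (0 : ℝ) < c := hc
  simp only [adaptedDiff]
  by_cases h1 : μ (π (k + 1) ⁻¹' {π (k + 1) x}) = 0
  -- On a null fine cell the new coefficient and the new average of f are both 0, so the first term
  -- alone bounds the old coefficient.
  · have e : adaptedCoeff μ (π (k + 1)) b f x = 0 := by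
      simp [adaptedCoeff, fiberAverage_eq_zero h1]
    rw [e, fiberAverage_eq_zero h1, zero_sub, zero_sub, norm_neg, norm_neg]
    have := (hacc k).norm_adaptedCoeff_le hc (hfin k) f x
    have : 0 ≤ (c : ℝ)⁻¹ ^ 2 * (‖fiberAverage μ (π k) f x‖
          * ‖fiberAverage μ (π (k + 1)) b x - fiberAverage μ (π k) b x‖) := by positivity
    linarith
  have h0 : μ (π k ⁻¹' {π k x}) ≠ 0 := fun h => h1 (measure_mono_null
    (fun y hy => href k y x hy) h)
  have hb1 := (hacc (k + 1)).le_norm_fiberAverage (hfin (k + 1)) h1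
  have hb0 := (hacc k).le_norm_fiberAverage (hfin k) h0
  simp only [adaptedCoeff]
  set p := fiberAverage μ (π (k + 1)) f x
  set q := fiberAverage μ (π k) f x
  set u := fiberAverage μ (π (k + 1)) b x
  set v := fiberAverage μ (π k) b x
  have hu : u ≠ 0 := norm_pos_iff.1 (hc'.trans_le hb1)
  have hv : v ≠ 0 := norm_pos_iff.1 (hc'.trans_le hb0)
  have e : p / u - q / v = u⁻¹ * (p - q) - (u⁻¹ * v⁻¹) * (q * (u - v)) := by
    field_simp; ring
  have hiu : ‖u⁻¹‖ ≤ (c : ℝ)⁻¹ := by rw [norm_inv]; gcongr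
  have hiv : ‖v⁻¹‖ ≤ (c : ℝ)⁻¹ := by rw [norm_inv]; gcongr
  rw [e]
  refine (norm_sub_le _ _).trans ?_
  simp only [norm_mul]
  rw [sq]
  gcongr

variable [MeasurableSpace ι] [Countable ι] [MeasurableSingletonClass ι]

theorem measurable_adaptedCoeff {π : X → ι} (hπ : Measurable π) (b f : X → ℂ) :
    Measurable (adaptedCoeff μ π b f) :=
  (measurable_fiberAverage hπ f).div (measurable_fiberAverage hπ b)

theorem measurable_adaptedDiff (hπ : ∀ k, Measurable (π k)) (b f : X → ℂ) (k : ℕ) :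
    Measurable (adaptedDiff μ π b f k) := by
  cases k with
  | zero => exact measurable_adaptedCoeff (hπ 0) b f
  | succ k => exact (measurable_adaptedCoeff (hπ _) b f).sub (measurable_adaptedCoeff (hπ _) b f)

theorem IsAccretiveOn.lintegral_adaptedCoeff_sq_le {π : X → ι} {b : X → ℂ} {c : ℝ≥0}
    (hacc : IsAccretiveOn μ π b c) (hc : 0 < c) (hπ : Measurable π)
    (hfin : ∀ i, μ (π ⁻¹' {i}) ≠ ∞) {f : X → ℂ} (hf : AEMeasurable f μ) :
    ∫⁻ x, ‖adaptedCoeff μ π b f x‖ₑ ^ 2 ∂μ ≤ (c⁻¹ ^ 2 : ℝ≥0) * ∫⁻ x, ‖f x‖ₑ ^ 2 ∂μ := by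
  calc _ ≤ ∫⁻ x, (c⁻¹ ^ 2 : ℝ≥0) * ‖fiberAverage μ π f x‖ₑ ^ 2 ∂μ := by
        refine lintegral_mono fun x => ?_
        rw [ENNReal.coe_pow, ← mul_pow]
        gcongr
        exact hacc.enorm_adaptedCoeff_le hc hfin f x
    _ = (c⁻¹ ^ 2 : ℝ≥0) * ∫⁻ x, ‖fiberAverage μ π f x‖ₑ ^ 2 ∂μ :=
        lintegral_const_mul' _ _ (by simp)
    _ ≤ _ := mul_le_mul_right (lintegral_enorm_fiberAverage_sq_le hπ hfin hf) _

theorem ENNReal.add_sq_le (a b : ℝ≥0∞) : (a + b) ^ 2 ≤ 2 * a ^ 2 + 2 * b ^ 2 := by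
  by_cases ha : a = ∞
  · simp [ha]
  by_cases hb : b = ∞
  · simp [hb]
  lift a to ℝ≥0 using ha
  lift b to ℝ≥0 using hb
  norm_cast
  rw [← NNReal.coe_le_coe]
  push_cast
  nlinarith [sq_nonneg ((a : ℝ) - b)]

theorem memLp_mul_adaptedCoeff {π : X → ι} (hπ : Measurable π)
    (hfin : ∀ i, μ (π ⁻¹' {i}) ≠ ∞) {b : X → ℂ} (hb : Measurable b) {B : ℝ≥0}
    (hB : ∀ x, ‖b x‖ₑ ≤ B) {c : ℝ≥0} (hacc : IsAccretiveOn μ π b c) (hc : 0 < c)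
    {f : X → ℂ} (hf : MemLp f 2 μ) :
    MemLp (fun x => b x * adaptedCoeff μ π b f x) 2 μ ∧
      ∫⁻ x, ‖b x * adaptedCoeff μ π b f x‖ₑ ^ 2 ∂μ
        ≤ (B ^ 2 * c⁻¹ ^ 2 : ℝ≥0) * ∫⁻ x, ‖f x‖ₑ ^ 2 ∂μ := by
  have h : ∫⁻ x, ‖b x * adaptedCoeff μ π b f x‖ₑ ^ 2 ∂μ
        ≤ (B ^ 2 * c⁻¹ ^ 2 : ℝ≥0) * ∫⁻ x, ‖f x‖ₑ ^ 2 ∂μ := by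
    calc _ ≤ ∫⁻ x, (B ^ 2 : ℝ≥0) * ‖adaptedCoeff μ π b f x‖ₑ ^ 2 ∂μ := by
          refine lintegral_mono fun x => ?_
          rw [enorm_mul, mul_pow, ENNReal.coe_pow]
          gcongr
          exact hB x
      _ = (B ^ 2 : ℝ≥0) * ∫⁻ x, ‖adaptedCoeff μ π b f x‖ₑ ^ 2 ∂μ :=
          lintegral_const_mul' _ _ ENNReal.coe_ne_top
      _ ≤ _ := by
          rw [ENNReal.coe_mul, mul_assoc]
          exact mul_le_mul_right
            (hacc.lintegral_adaptedCoeff_sq_le hc hπ hfin hf.1.aemeasurable) _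
  refine ⟨(memLp_two_iff_lintegral
    (hb.mul (measurable_adaptedCoeff hπ b f)).aestronglyMeasurable).2 (h.trans_lt ?_), h⟩
  exact ENNReal.mul_lt_top ENNReal.coe_lt_top ((memLp_two_iff_lintegral hf.1).1 hf)

/-- On a cell of `π'` the coefficient is the constant ∫f/∫b, which restores ∫f; coarser cells follow
by summation. This is the source of all cancellation: f - b a_k has mean zero on cells of level k,
and so has b(a_{k+1} - a_k). -/
theorem setIntegral_mul_adaptedCoeff {π π' : X → ι} (hπ : Measurable π) (hπ' : Measurable π')
    (hfin : ∀ i, μ (π ⁻¹' {i}) ≠ ∞) (hfin' : ∀ i, μ (π' ⁻¹' {i}) ≠ ∞)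
    (href : ∀ x y, π' x = π' y → π x = π y) {b : X → ℂ} (hb : Measurable b) {B : ℝ≥0}
    (hB : ∀ x, ‖b x‖ₑ ≤ B) {c : ℝ≥0} (hacc : IsAccretiveOn μ π' b c) (hc : 0 < c)
    {f : X → ℂ} (hf : MemLp f 2 μ) (i : ι) :
    ∫ x in π ⁻¹' {i}, b x * adaptedCoeff μ π' b f x ∂μ = ∫ x in π ⁻¹' {i}, f x ∂μ := by
  refine setIntegral_fiber_congr hπ hπ' href
    ((memLp_mul_adaptedCoeff hπ' hfin' hb hB hacc hc hf).1.integrableOn_two (hfin _))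
    (hf.integrableOn_two (hfin _)) fun j => ?_
  have hm := hπ' (measurableSet_singleton j)
  by_cases h0 : μ (π' ⁻¹' {j}) = 0
  · rw [setIntegral_measure_zero _ h0, setIntegral_measure_zero _ h0]
  obtain ⟨x₀, rfl⟩ : ∃ x, π' x = j := by
    by_contra hne
    refine h0 (measure_mono_null (fun x hx => (hne ⟨x, hx⟩).elim) (measure_empty (μ := μ)))
  have e : ∫ x in π' ⁻¹' {π' x₀}, b x * adaptedCoeff μ π' b f x ∂μ
      = ∫ x in π' ⁻¹' {π' x₀}, b x * adaptedCoeff μ π' b f x₀ ∂μ :=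
    setIntegral_congr_fun hm fun x hx => by
      simp only [adaptedCoeff_congr_fiber b f (show π' x = π' x₀ from hx)]
  have hpos : μ.real (π' ⁻¹' {π' x₀}) ≠ 0 := (ENNReal.toReal_pos h0 (hfin' _)).ne'
  have hne : fiberAverage μ π' b x₀ ≠ 0 := norm_pos_iff.1
    (lt_of_lt_of_le (by exact_mod_cast hc) (hacc.le_norm_fiberAverage hfin' h0))
  have hmul : ∀ h : X → ℂ, ∫ x in π' ⁻¹' {π' x₀}, h x ∂μ
      = μ.real (π' ⁻¹' {π' x₀}) * fiberAverage μ π' h x₀ := fun h => by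
    rw [fiberAverage, setAverage_eq, Complex.real_smul, Complex.ofReal_inv, ← mul_assoc,
      mul_inv_cancel₀ (by exact_mod_cast hpos), one_mul]
  rw [e, integral_mul_const, hmul b, hmul f, adaptedCoeff]
  field_simp

/-- The square function estimate for the `b`-adapted martingale differences. -/
theorem tsum_lintegral_adaptedDiff_sq_le (hπ : ∀ k, Measurable (π k))
    (hfin : ∀ k i, μ (π k ⁻¹' {i}) ≠ ∞)
    (href : ∀ k x y, π (k + 1) x = π (k + 1) y → π k x = π k y)
    {b : X → ℂ} (hb : Measurable b) {B : ℝ≥0} (hB0 : 0 < B) (hB : ∀ x, ‖b x‖ₑ ≤ B)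
    {c : ℝ≥0} (hacc : ∀ k, IsAccretiveOn μ (π k) b c) (hc : 0 < c)
    {f : X → ℂ} (hf : MemLp f 2 μ) :
    ∑' k, ∫⁻ x, ‖adaptedDiff μ π b f k x‖ₑ ^ 2 ∂μ
      ≤ (3 * c⁻¹ ^ 2 + 8 * c⁻¹ ^ 4 * B ^ 2 : ℝ≥0) * ∫⁻ x, ‖f x‖ₑ ^ 2 ∂μ := by
  rw [tsum_eq_zero_add' ENNReal.summable]
  have h0 : ∫⁻ x, ‖adaptedDiff μ π b f 0 x‖ₑ ^ 2 ∂μ ≤ (c⁻¹ ^ 2 : ℝ≥0) * ∫⁻ x, ‖f x‖ₑ ^ 2 ∂μ :=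
    (hacc 0).lintegral_adaptedCoeff_sq_le hc (hπ 0) (hfin 0) hf.1.aemeasurable
  set d : (X → ℂ) → ℕ → X → ℂ := fun h k x =>
    fiberAverage μ (π (k + 1)) h x - fiberAverage μ (π k) h x with hd
  have hdm : ∀ h k, Measurable (d h k) := fun h k =>
    (measurable_fiberAverage (hπ _) h).sub (measurable_fiberAverage (hπ _) h)
  -- Carleson embedding with the squared martingale differences of b as weights.
  have hcar : ∑' k, ∫⁻ x, ‖fiberAverage μ (π k) f x‖ₑ ^ 2 * ‖d b k x‖ₑ ^ 2 ∂μ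
      ≤ 4 * B ^ 2 * ∫⁻ x, ‖f x‖ₑ ^ 2 ∂μ := by
    refine le_trans (ENNReal.tsum_le_tsum fun k => lintegral_mono fun x => ?_)
      (carleson_embedding hπ hfin href (w := fun k x => ‖d b k x‖ₑ ^ 2)
        (fun k => (hdm b k).enorm.pow_const 2) (by simpa using hB0.ne') (by finiteness)
        (tsum_setLIntegral_martingaleDiff_sq_le hπ hfin href hb hB) hf.1.aemeasurable.enorm)
    dsimp only
    gcongr
    exact enorm_fiberAverage_le f x
  have hstep : ∀ k, ∫⁻ x, ‖adaptedDiff μ π b f (k + 1) x‖ₑ ^ 2 ∂μ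
      ≤ (2 * c⁻¹ ^ 2 : ℝ≥0) * ∫⁻ x, ‖d f k x‖ₑ ^ 2 ∂μ + (2 * c⁻¹ ^ 4 : ℝ≥0)
        * ∫⁻ x, ‖fiberAverage μ (π k) f x‖ₑ ^ 2 * ‖d b k x‖ₑ ^ 2 ∂μ := by
    intro k
    rw [← lintegral_const_mul' _ _ ENNReal.coe_ne_top,
      ← lintegral_const_mul' _ _ ENNReal.coe_ne_top,
      ← lintegral_add_left (((hdm f k).enorm.pow_const 2).const_mul _)]
    refine lintegral_mono fun x => ?_
    have h := norm_adaptedDiff_succ_le hacc hc hfin href f k x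
    have h' : ‖adaptedDiff μ π b f (k + 1) x‖ₑ ≤ (c⁻¹ : ℝ≥0) * ‖d f k x‖ₑ
        + (c⁻¹ ^ 2 : ℝ≥0) * (‖fiberAverage μ (π k) f x‖ₑ * ‖d b k x‖ₑ) := by
      simp only [enorm_eq_nnnorm]
      simp only [← coe_nnnorm] at h
      exact_mod_cast h
    calc _ ≤ _ := pow_le_pow_left' h' 2
      _ ≤ _ := ENNReal.add_sq_le _ _
      _ = _ := by push_cast; ring
  -- The 3 is 1 from the coarsest coefficient plus 2 from the differences of f; the 8 is 2 times the
  -- 4 of Carleson embedding.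
  calc _ ≤ (c⁻¹ ^ 2 : ℝ≥0) * ∫⁻ x, ‖f x‖ₑ ^ 2 ∂μ
      + ∑' k, ((2 * c⁻¹ ^ 2 : ℝ≥0) * ∫⁻ x, ‖d f k x‖ₑ ^ 2 ∂μ + (2 * c⁻¹ ^ 4 : ℝ≥0)
        * ∫⁻ x, ‖fiberAverage μ (π k) f x‖ₑ ^ 2 * ‖d b k x‖ₑ ^ 2 ∂μ) := by
        gcongr with k
        exact hstep k
    _ ≤ (c⁻¹ ^ 2 : ℝ≥0) * ∫⁻ x, ‖f x‖ₑ ^ 2 ∂μ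
      + ((2 * c⁻¹ ^ 2 : ℝ≥0) * ∫⁻ x, ‖f x‖ₑ ^ 2 ∂μ + (2 * c⁻¹ ^ 4 : ℝ≥0)
        * (4 * B ^ 2 * ∫⁻ x, ‖f x‖ₑ ^ 2 ∂μ)) := by
        rw [ENNReal.tsum_add, ENNReal.tsum_mul_left, ENNReal.tsum_mul_left]
        gcongr
        exact tsum_lintegral_martingaleDiff_sq_le hπ hfin href hf
    _ = _ := by push_cast; ring

end AdaptedCoefficients

/-! ### The smallest doubling majorant and its averaging operators -/

section Majorant

variable {n : ℕ}

/-- The smallest majorant of `μ (B(x, r))` that is doubling in `r` with constant `D`. Unlike a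
general majorant it is comparable at points of distance at most `r`. -/
noncomputable def dyadicMajorant (μ : Measure (Fin n → ℝ)) (D : ℝ≥0) (x : Fin n → ℝ) (r : ℝ) :
    ℝ≥0∞ :=
  ⨆ k : ℕ, μ (Metric.ball x (2 ^ k * r)) / (D : ℝ≥0∞) ^ k

/-- The average over a ball, normalized by `dyadicMajorant`. -/
noncomputable def ballAverage (μ : Measure (Fin n → ℝ)) (D : ℝ≥0) (r : ℝ)
    (g : (Fin n → ℝ) → ℝ≥0∞) (x : Fin n → ℝ) : ℝ≥0∞ :=
  (∫⁻ y in Metric.ball x r, g y ∂μ) / dyadicMajorant μ D x r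

/-- A superposition of ball averages at the scales `2 ^ k * t`, with geometric weights. -/
noncomputable def tailOp (μ : Measure (Fin n → ℝ)) (D q : ℝ≥0) (t : ℝ)
    (g : (Fin n → ℝ) → ℝ≥0∞) (x : Fin n → ℝ) : ℝ≥0∞ :=
  ∑' k : ℕ, (q : ℝ≥0∞) ^ k * ballAverage μ D (2 ^ k * t) g x

/-- The kernel of `tailOp`. -/
noncomputable def tailKernel (μ : Measure (Fin n → ℝ)) (D q : ℝ≥0) (t : ℝ)
    (x y : Fin n → ℝ) : ℝ≥0∞ :=
  ∑' k : ℕ, (q : ℝ≥0∞) ^ k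
    * (Metric.ball x (2 ^ k * t)).indicator (fun _ => (dyadicMajorant μ D x (2 ^ k * t))⁻¹) y

variable {μ : Measure (Fin n → ℝ)} {D q : ℝ≥0}

theorem measure_ball_le_dyadicMajorant (x : Fin n → ℝ) (r : ℝ) :
    μ (Metric.ball x r) ≤ dyadicMajorant μ D x r :=
  le_trans (by simp) (le_iSup (fun k : ℕ => μ (Metric.ball x (2 ^ k * r)) / (D : ℝ≥0∞) ^ k) 0)

theorem dyadicMajorant_mono (x : Fin n → ℝ) : Monotone (dyadicMajorant μ D x) := by
  intro r r' h
  unfold dyadicMajorant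
  gcongr

/-- The ball B(x, 2^k r) lies in B(y, 2^(k+1) r), and shifting the index of the supremum by one
costs one factor D. This comparison makes the kernel of the averages nearly symmetric. -/
theorem dyadicMajorant_le_mul (hD : D ≠ 0) {x y : Fin n → ℝ} {r : ℝ} (hr : 0 < r)
    (h : dist x y ≤ r) : dyadicMajorant μ D x r ≤ D * dyadicMajorant μ D y r := by
  refine iSup_le fun k => ?_
  have hD' : (D : ℝ≥0∞) ≠ 0 := by simpa using hD
  have hsub : Metric.ball x (2 ^ k * r) ⊆ Metric.ball y (2 ^ (k + 1) * r) :=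
    Metric.ball_subset_ball' (by
      have : (1 : ℝ) ≤ 2 ^ k := one_le_pow₀ (by norm_num)
      rw [pow_succ]; nlinarith)
  calc μ (Metric.ball x (2 ^ k * r)) / (D : ℝ≥0∞) ^ k
      ≤ μ (Metric.ball y (2 ^ (k + 1) * r)) / (D : ℝ≥0∞) ^ k := by gcongr
    _ = D * (μ (Metric.ball y (2 ^ (k + 1) * r)) / (D : ℝ≥0∞) ^ (k + 1)) := by
        rw [ENNReal.div_eq_inv_mul, ENNReal.div_eq_inv_mul, pow_succ' (D : ℝ≥0∞),
          ENNReal.mul_inv (Or.inl hD') (Or.inl ENNReal.coe_ne_top), ← mul_assoc, ← mul_assoc,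
          ENNReal.mul_inv_cancel hD' ENNReal.coe_ne_top, one_mul]
    _ ≤ _ := by
        gcongr
        exact le_iSup (fun k : ℕ => μ (Metric.ball y (2 ^ k * r)) / (D : ℝ≥0∞) ^ k) (k + 1)

/-- If all the balls B(x, 2^k r) were null, so would be the space that they exhaust. -/
theorem dyadicMajorant_ne_zero (hμ : μ ≠ 0) (x : Fin n → ℝ) {r : ℝ} (hr : 0 < r) :
    dyadicMajorant μ D x r ≠ 0 := by
  intro h
  refine hμ (Measure.measure_univ_eq_zero.1 ?_)
  have hU : (univ : Set (Fin n → ℝ)) = ⋃ k : ℕ, Metric.ball x (2 ^ k * r) := by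
    refine (eq_univ_of_forall fun y => mem_iUnion.2 ?_).symm
    obtain ⟨k, hk⟩ := pow_unbounded_of_one_lt (dist y x / r) (by norm_num : (1 : ℝ) < 2)
    exact ⟨k, by rw [Metric.mem_ball]; rwa [div_lt_iff₀ hr] at hk⟩
  rw [hU]
  refine measure_iUnion_null fun k => ?_
  have := ENNReal.iSup_eq_zero.1 h k
  rw [ENNReal.div_eq_zero_iff] at this
  exact this.resolve_right (by finiteness)

theorem measurable_measure_ball [SFinite μ] (r : ℝ) :
    Measurable fun x : Fin n → ℝ => μ (Metric.ball x r) := by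
  have : MeasurableSet {p : (Fin n → ℝ) × (Fin n → ℝ) | dist p.2 p.1 < r} :=
    measurableSet_lt (by fun_prop) (by fun_prop)
  exact measurable_measure_prodMk_left this

theorem measurable_dyadicMajorant [SFinite μ] (r : ℝ) :
    Measurable fun x => dyadicMajorant μ D x r :=
  Measurable.iSup fun _ => (measurable_measure_ball _).div_const _

theorem measurable_ballAverage [SFinite μ] {g : (Fin n → ℝ) → ℝ≥0∞} (hg : Measurable g) (r : ℝ) :
    Measurable (ballAverage μ D r g) := by
  refine Measurable.div ?_ (measurable_dyadicMajorant r)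
  have hm : MeasurableSet {p : (Fin n → ℝ) × (Fin n → ℝ) | dist p.2 p.1 < r} :=
    measurableSet_lt (by fun_prop) (by fun_prop)
  have : Measurable fun p : (Fin n → ℝ) × (Fin n → ℝ) =>
      {p : (Fin n → ℝ) × (Fin n → ℝ) | dist p.2 p.1 < r}.indicator (fun p => g p.2) p :=
    (hg.comp measurable_snd).indicator hm
  convert this.lintegral_prod_right' (ν := μ) using 2 with x
  rw [← lintegral_indicator Metric.isOpen_ball.measurableSet]
  rfl

theorem measurable_tailOp [SFinite μ] {g : (Fin n → ℝ) → ℝ≥0∞} (hg : Measurable g) (t : ℝ) :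
    Measurable (tailOp μ D q t g) :=
  Measurable.tsum fun _ => (measurable_ballAverage hg _).const_mul _

theorem sq_ballAverage_le (x : Fin n → ℝ) (r : ℝ) {g : (Fin n → ℝ) → ℝ≥0∞} (hg : AEMeasurable g μ) :
    ballAverage μ D r g x ^ 2
      ≤ (∫⁻ y in Metric.ball x r, g y ^ 2 ∂μ) / dyadicMajorant μ D x r := by
  have h := sq_lintegral_mul_le (μ := μ.restrict (Metric.ball x r)) (c := 1) (F := g)
    aemeasurable_const hg.restrict
  simp only [Pi.one_apply, one_mul, lintegral_one, Measure.restrict_apply_univ] at h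
  set m := dyadicMajorant μ D x r with hm
  rw [ballAverage, ← hm, ENNReal.div_eq_inv_mul, mul_pow, ENNReal.div_eq_inv_mul]
  have h1 : m⁻¹ * μ (Metric.ball x r) ≤ 1 :=
    (mul_le_mul_right (measure_ball_le_dyadicMajorant x r) _).trans (ENNReal.inv_mul_le_one _)
  calc m⁻¹ ^ 2 * (∫⁻ y in Metric.ball x r, g y ∂μ) ^ 2
      ≤ m⁻¹ ^ 2 * (μ (Metric.ball x r) * ∫⁻ y in Metric.ball x r, g y ^ 2 ∂μ) := by gcongr
    _ = (m⁻¹ * μ (Metric.ball x r)) * (m⁻¹ * ∫⁻ y in Metric.ball x r, g y ^ 2 ∂μ) := by ring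
    _ ≤ 1 * (m⁻¹ * ∫⁻ y in Metric.ball x r, g y ^ 2 ∂μ) := by gcongr
    _ = _ := one_mul _

/-- After Cauchy–Schwarz and Tonelli the inner integral runs over x in B(y, r). There the majorant
at x may be replaced by that at y at the cost of D, and it dominates the measure of this ball. -/
theorem lintegral_sq_ballAverage_le [SFinite μ] (hD : D ≠ 0) {r : ℝ} (hr : 0 < r)
    {g : (Fin n → ℝ) → ℝ≥0∞} (hg : Measurable g) :
    ∫⁻ x, ballAverage μ D r g x ^ 2 ∂μ ≤ D * ∫⁻ x, g x ^ 2 ∂μ := by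
  have hm : MeasurableSet {p : (Fin n → ℝ) × (Fin n → ℝ) | dist p.2 p.1 < r} :=
    measurableSet_lt (by fun_prop) (by fun_prop)
  set F : (Fin n → ℝ) → (Fin n → ℝ) → ℝ≥0∞ := fun x y =>
    {p : (Fin n → ℝ) × (Fin n → ℝ) | dist p.2 p.1 < r}.indicator
      (fun p => g p.2 ^ 2 * (dyadicMajorant μ D p.1 r)⁻¹) (x, y) with hF
  have hFm : Measurable (Function.uncurry F) :=
    (((hg.comp measurable_snd).pow_const 2).mul
      ((measurable_dyadicMajorant r).comp measurable_fst).inv).indicator hm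
  have hle : ∀ x, ballAverage μ D r g x ^ 2 ≤ ∫⁻ y, F x y ∂μ := fun x => by
    refine (sq_ballAverage_le x r hg.aemeasurable).trans (le_of_eq ?_)
    rw [div_eq_mul_inv, ← lintegral_mul_const _ (hg.pow_const 2),
      ← lintegral_indicator Metric.isOpen_ball.measurableSet]
    rfl
  calc _ ≤ ∫⁻ x, ∫⁻ y, F x y ∂μ ∂μ := lintegral_mono hle
    _ = ∫⁻ y, ∫⁻ x, F x y ∂μ ∂μ := lintegral_lintegral_swap hFm.aemeasurable
    _ ≤ ∫⁻ y, D * g y ^ 2 ∂μ := by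
        refine lintegral_mono fun y => ?_
        have h1 : ∀ x, F x y ≤ (Metric.ball y r).indicator
            (fun _ => g y ^ 2 * (D * (dyadicMajorant μ D y r)⁻¹)) x := fun x => by
          by_cases hxy : dist y x < r
          · have hx : x ∈ Metric.ball y r := by rwa [Metric.mem_ball, dist_comm]
            rw [indicator_of_mem hx]
            simp only [hF]
            rw [indicator_of_mem (by exact hxy)]
            gcongr
            have := dyadicMajorant_le_mul (μ := μ) hD hr hxy.le
            have hD' : (D : ℝ≥0∞) ≠ 0 := by simpa using hD
            calc (dyadicMajorant μ D x r)⁻¹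
                = D * (D * dyadicMajorant μ D x r)⁻¹ := by
                  rw [ENNReal.mul_inv (Or.inl hD') (Or.inl ENNReal.coe_ne_top), ← mul_assoc,
                    ENNReal.mul_inv_cancel hD' ENNReal.coe_ne_top, one_mul]
              _ ≤ _ := by gcongr
          · simp only [hF]
            rw [indicator_of_notMem (by exact hxy)]
            exact zero_le
        calc _ ≤ _ := lintegral_mono h1
          _ = g y ^ 2 * (D * (dyadicMajorant μ D y r)⁻¹) * μ (Metric.ball y r) := by
              rw [lintegral_indicator Metric.isOpen_ball.measurableSet, setLIntegral_const]
          _ = (D * g y ^ 2) * ((dyadicMajorant μ D y r)⁻¹ * μ (Metric.ball y r)) := by ring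
          _ ≤ (D * g y ^ 2) * 1 := by
              gcongr
              exact (mul_le_mul_right (measure_ball_le_dyadicMajorant y r) _).trans
                (ENNReal.inv_mul_le_one _)
          _ = _ := mul_one _
    _ = _ := lintegral_const_mul _ (hg.pow_const 2)

theorem tsum_pow_coe_eq (q : ℝ≥0) (hq : q < 1) :
    ∑' k : ℕ, (q : ℝ≥0∞) ^ k = ((1 - q)⁻¹ : ℝ≥0) := by
  rw [ENNReal.tsum_geometric, ENNReal.coe_inv (tsub_pos_of_lt hq).ne']
  simp

theorem lintegral_sq_tailOp_le [SFinite μ] (hD : D ≠ 0) (hq : q < 1) {t : ℝ} (ht : 0 < t)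
    {g : (Fin n → ℝ) → ℝ≥0∞}
    (hg : Measurable g) :
    ∫⁻ x, tailOp μ D q t g x ^ 2 ∂μ ≤ ((1 - q)⁻¹ ^ 2 * D : ℝ≥0) * ∫⁻ x, g x ^ 2 ∂μ := by
  set S := ∑' k : ℕ, (q : ℝ≥0∞) ^ k with hS
  have hSt : S ≠ ∞ := by rw [hS, tsum_pow_coe_eq q hq]; simp
  calc _ ≤ ∫⁻ x, S * ∑' k : ℕ, (q : ℝ≥0∞) ^ k * ballAverage μ D (2 ^ k * t) g x ^ 2 ∂μ :=
        lintegral_mono fun x => sq_tsum_mul_le _ _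
    _ = S * ∑' k : ℕ, (q : ℝ≥0∞) ^ k * ∫⁻ x, ballAverage μ D (2 ^ k * t) g x ^ 2 ∂μ := by
        rw [lintegral_const_mul' _ _ hSt, lintegral_tsum fun k =>
          (((measurable_ballAverage hg _).pow_const 2).const_mul _).aemeasurable]
        congr 2
        ext k
        rw [lintegral_const_mul _ ((measurable_ballAverage hg _).pow_const 2)]
    _ ≤ S * ∑' k : ℕ, (q : ℝ≥0∞) ^ k * (D * ∫⁻ x, g x ^ 2 ∂μ) := by
        gcongr with k
        exact lintegral_sq_ballAverage_le hD (by positivity) hg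
    _ = _ := by
        rw [ENNReal.tsum_mul_right, ← hS, hS, tsum_pow_coe_eq q hq]
        push_cast
        ring

theorem tailOp_one_le (hq : q < 1) (t : ℝ) (x : Fin n → ℝ) :
    tailOp μ D q t (fun _ => 1) x ≤ ((1 - q)⁻¹ : ℝ≥0) := by
  rw [← tsum_pow_coe_eq q hq]
  refine ENNReal.tsum_le_tsum fun k => mul_le_of_le_one_right' ?_
  rw [ballAverage, lintegral_one, Measure.restrict_apply_univ, ENNReal.div_eq_inv_mul]
  exact (mul_le_mul_right (measure_ball_le_dyadicMajorant x _) _).trans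
                (ENNReal.inv_mul_le_one _)

theorem tailOp_mono {t : ℝ} {g g' : (Fin n → ℝ) → ℝ≥0∞} (h : ∀ x, g x ≤ g' x)
    (x : Fin n → ℝ) : tailOp μ D q t g x ≤ tailOp μ D q t g' x := by
  unfold tailOp ballAverage
  gcongr with k y
  exact h y

theorem tailOp_const_mul {C : ℝ≥0} {t : ℝ} (g : (Fin n → ℝ) → ℝ≥0∞)
    (x : Fin n → ℝ) : tailOp μ D q t (fun y => C * g y) x = C * tailOp μ D q t g x := by
  unfold tailOp ballAverage
  rw [← ENNReal.tsum_mul_left]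
  refine tsum_congr fun k => ?_
  rw [lintegral_const_mul' _ _ ENNReal.coe_ne_top, mul_div_assoc]
  ring

/-- By a ≤ 1 + a² and Cauchy–Schwarz on each ball; the majorant at scale 2^k t is at least that at
scale t. This gives the pointwise finiteness behind absolute convergence. -/
theorem tailOp_le_of_sq_integrable (hq : q < 1) {t : ℝ} (ht : 0 < t)
    {g : (Fin n → ℝ) → ℝ≥0∞}
    (hg : AEMeasurable g μ) (x : Fin n → ℝ) :
    tailOp μ D q t g x
      ≤ ((1 - q)⁻¹ : ℝ≥0) * (1 + (∫⁻ y, g y ^ 2 ∂μ) / dyadicMajorant μ D x t) := by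
  rw [← tsum_pow_coe_eq q hq, ← ENNReal.tsum_mul_right]
  refine ENNReal.tsum_le_tsum fun k => mul_le_mul_right ?_ _
  have h1 : ∀ a : ℝ≥0∞, a ≤ 1 + a ^ 2 := fun a => by
    rcases le_total a 1 with h | h
    · exact h.trans (by simp)
    · exact (le_self_pow₀ h (by norm_num : 2 ≠ 0)).trans (by simp)
  refine (h1 _).trans (add_le_add_right ?_ 1)
  refine (sq_ballAverage_le x _ hg).trans ?_
  gcongr
  · exact Measure.restrict_le_self
  · refine dyadicMajorant_mono x ?_
    have : (1 : ℝ) ≤ 2 ^ k := one_le_pow₀ (by norm_num)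
    nlinarith

theorem lintegral_tailKernel_mul {t : ℝ} {g : (Fin n → ℝ) → ℝ≥0∞} (hg : Measurable g)
    (x : Fin n → ℝ) :
    ∫⁻ y, tailKernel μ D q t x y * g y ∂μ = tailOp μ D q t g x := by
  unfold tailKernel tailOp
  simp_rw [← ENNReal.tsum_mul_right]
  rw [lintegral_tsum fun k => ?_]
  · refine tsum_congr fun k => ?_
    simp_rw [mul_assoc]
    rw [lintegral_const_mul' _ _ (by finiteness)]
    congr 1
    rw [ballAverage, ENNReal.div_eq_inv_mul, ← lintegral_const_mul _ hg,
      ← lintegral_indicator Metric.isOpen_ball.measurableSet]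
    refine lintegral_congr fun y => ?_
    by_cases hy : y ∈ Metric.ball x (2 ^ k * t)
    · simp [hy]
    · simp [hy]
  · exact (((measurable_const.indicator Metric.isOpen_ball.measurableSet).const_mul _).mul
      hg).aemeasurable

/-- Off a ball the kernel with parameter `q ^ 2` gains a factor over the one with parameter `q`. -/
theorem tailKernel_sq_le {t ρ : ℝ} {x y : Fin n → ℝ} (hρ : ρ ≤ dist y x) {κ : ℝ≥0∞}
    (hκ : ∀ k : ℕ, ρ < 2 ^ k * t → (q : ℝ≥0∞) ^ k ≤ κ) :
    tailKernel μ D (q ^ 2) t x y ≤ κ * tailKernel μ D q t x y := by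
  unfold tailKernel
  rw [← ENNReal.tsum_mul_left]
  refine ENNReal.tsum_le_tsum fun k => ?_
  by_cases hy : y ∈ Metric.ball x (2 ^ k * t)
  · rw [ENNReal.coe_pow, ← pow_mul, mul_comm 2 k, pow_mul, sq, mul_assoc]
    gcongr
    exact hκ k (hρ.trans_lt hy)
  · simp [hy]

end Majorant

/-! ### From the kernel hypotheses to tail bounds -/

section KernelBounds

variable {n : ℕ} {μ : Measure (Fin n → ℝ)} {lam : (Fin n → ℝ) → ℝ → ℝ} {Clam : ℝ}

theorem IsUpperDoubling.one_le (h : IsUpperDoubling μ lam Clam) : 1 ≤ Clam := by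
  have h0 := h.pos 0 1 one_pos
  have h1 := h.doubling 0 1 one_pos
  have h2 := h.mono 0 (show (1 : ℝ) ∈ Ioi 0 by simp) (show (2 * 1 : ℝ) ∈ Ioi 0 by simp)
    (by norm_num)
  by_contra hlt
  nlinarith

theorem IsUpperDoubling.isLocallyFiniteMeasure (h : IsUpperDoubling μ lam Clam) :
    IsLocallyFiniteMeasure μ :=
  ⟨fun x => ⟨Metric.ball x 1, Metric.ball_mem_nhds x one_pos,
    (h.measure_ball_le x 1 one_pos).trans_lt ENNReal.ofReal_lt_top⟩⟩

theorem IsUpperDoubling.pow_doubling (h : IsUpperDoubling μ lam Clam) (x : Fin n → ℝ) {r : ℝ}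
    (hr : 0 < r) (k : ℕ) : lam x (2 ^ k * r) ≤ Clam ^ k * lam x r := by
  have hC := h.one_le
  induction k with
  | zero => simp
  | succ k ih =>
    calc lam x (2 ^ (k + 1) * r) = lam x (2 * (2 ^ k * r)) := by ring_nf
      _ ≤ Clam * lam x (2 ^ k * r) := h.doubling x _ (by positivity)
      _ ≤ Clam * (Clam ^ k * lam x r) := by gcongr
      _ = _ := by ring

/-- Iterated doubling of `lam` absorbs the powers of `Clam`. Hence the kernel bounds with `lam`
imply those with the dyadic majorant. -/
theorem IsUpperDoubling.dyadicMajorant_le (h : IsUpperDoubling μ lam Clam) (x : Fin n → ℝ) {r : ℝ}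
    (hr : 0 < r) : dyadicMajorant μ Clam.toNNReal x r ≤ ENNReal.ofReal (lam x r) := by
  refine iSup_le fun k => ?_
  refine ENNReal.div_le_of_le_mul ?_
  have hC : 0 ≤ Clam := zero_le_one.trans h.one_le
  calc _ ≤ ENNReal.ofReal (lam x (2 ^ k * r)) := h.measure_ball_le x _ (by positivity)
    _ ≤ ENNReal.ofReal (lam x r * Clam ^ k) := by
        rw [mul_comm (lam x r)]; exact ENNReal.ofReal_le_ofReal (h.pow_doubling x hr k)
    _ = _ := by rw [ENNReal.ofReal_mul (h.pos x r hr).le, ENNReal.ofReal_pow hC]; rfl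

theorem IsUpperDoubling.le_kernelDenom (h : IsUpperDoubling μ lam Clam) {α : ℝ}
    (hα : 0 < α) (t : ℝ) (x y : Fin n → ℝ) : t ^ α * lam x t ≤ kernelDenom lam α t x y := by
  refine le_add_of_nonneg_right ?_
  rcases (dist_nonneg : 0 ≤ dist x y).eq_or_lt with h0 | h0
  · rw [← h0, Real.zero_rpow hα.ne', zero_mul]
  · exact (mul_pos (Real.rpow_pos_of_pos h0 α) (h.pos x _ h0)).le

theorem IsUpperDoubling.div_kernelDenom_nonneg (h : IsUpperDoubling μ lam Clam) {α : ℝ}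
    (hα : 0 < α) {t : ℝ} (ht : 0 < t) (x y : Fin n → ℝ) :
    0 ≤ t ^ α / kernelDenom lam α t x y :=
  div_nonneg (Real.rpow_nonneg ht.le α) ((mul_nonneg (Real.rpow_nonneg ht.le α)
    (h.pos x t ht).le).trans (h.le_kernelDenom hα t x y))

/-- Take the least k with |x - y| < 2^k t. For k = 0 the first summand of the denominator suffices.
Otherwise |x - y| ≥ 2^(k-1) t by minimality and the second summand does; going from k - 1 to k costs
one doubling and 2^α. -/
theorem IsUpperDoubling.exists_div_kernelDenom_le (h : IsUpperDoubling μ lam Clam) {α : ℝ}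
    (hα : 0 < α) {t : ℝ} (ht : 0 < t) (x y : Fin n → ℝ) :
    ∃ k : ℕ, dist x y < 2 ^ k * t ∧
      t ^ α / kernelDenom lam α t x y
        ≤ (Clam * 2 ^ α) * ((1 / 2 : ℝ) ^ α) ^ k * (lam x (2 ^ k * t))⁻¹ := by
  have hC := h.one_le
  have hex : ∃ k : ℕ, dist x y < 2 ^ k * t := by
    obtain ⟨k, hk⟩ := pow_unbounded_of_one_lt (dist x y / t) (by norm_num : (1 : ℝ) < 2)
    exact ⟨k, by rwa [div_lt_iff₀ ht] at hk⟩
  classical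
  refine ⟨Nat.find hex, Nat.find_spec hex, ?_⟩
  have hmin := fun m => Nat.find_min hex (m := m)
  have h1 : 0 < t ^ α * lam x t := mul_pos (Real.rpow_pos_of_pos ht α) (h.pos x t ht)
  have h2 := h.le_kernelDenom hα t x y
  have h2α : (1 : ℝ) ≤ 2 ^ α := Real.one_le_rpow (by norm_num) hα.le
  have htα := Real.rpow_pos_of_pos ht α
  rcases hk : Nat.find hex with _ | m
  · have hl := h.pos x t ht
    rw [pow_zero, pow_zero, one_mul, mul_one]
    calc t ^ α / kernelDenom lam α t x y ≤ t ^ α / (t ^ α * lam x t) := by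
          gcongr
      _ = 1 * (lam x t)⁻¹ := by field_simp
      _ ≤ _ := by gcongr; nlinarith
  · have hm := hmin m (by omega)
    rw [not_lt] at hm
    have hr : 0 < 2 ^ m * t := by positivity
    have hl := h.pos x _ hr
    have hl2 := h.pos x (2 ^ (m + 1) * t) (by positivity)
    have hd : lam x (2 ^ (m + 1) * t) ≤ Clam * lam x (2 ^ m * t) := by
      have := h.doubling x _ hr
      rwa [← mul_assoc, ← pow_succ'] at this
    have hmono := h.mono x (show 2 ^ m * t ∈ Ioi (0 : ℝ) from hr) (lt_of_lt_of_le hr hm) hm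
    have hpw : (2 ^ m * t) ^ α = (2 ^ α) ^ m * t ^ α := by
      rw [Real.mul_rpow (by positivity) ht.le, ← Real.rpow_natCast, ← Real.rpow_mul (by norm_num),
        ← Real.rpow_natCast, ← Real.rpow_mul (by norm_num), mul_comm α]
    have h2pos : (0 : ℝ) < 2 ^ α := by positivity
    calc t ^ α / kernelDenom lam α t x y
        ≤ t ^ α / ((2 ^ m * t) ^ α * lam x (2 ^ m * t)) := by
          gcongr
          unfold kernelDenom
          have : (2 ^ m * t) ^ α * lam x (2 ^ m * t) ≤ dist x y ^ α * lam x (dist x y) := by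
            gcongr
          linarith
      _ = ((2 ^ α) ^ m)⁻¹ * (lam x (2 ^ m * t))⁻¹ := by
          rw [hpw]; field_simp
      _ ≤ ((2 ^ α) ^ m)⁻¹ * (Clam * (lam x (2 ^ (m + 1) * t))⁻¹) := by
          gcongr
          rw [inv_le_iff_one_le_mul₀ hl]
          rw [mul_assoc, mul_comm, mul_assoc, inv_mul_eq_div, one_le_div hl2, mul_comm _ Clam]
          exact hd
      _ = _ := by
          rw [one_div, Real.inv_rpow (by norm_num), pow_succ (((2 : ℝ) ^ α)⁻¹), inv_pow]
          field_simp

/-- One term of the series already dominates. The rate (1/2)^α is written as a square because one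
factor will keep the series summable and the other will be spent on decay, in `tailKernel_sq_le`. -/
theorem IsUpperDoubling.div_kernelDenom_le_tailKernel (h : IsUpperDoubling μ lam Clam) {α : ℝ}
    (hα : 0 < α) {t : ℝ} (ht : 0 < t) (x y : Fin n → ℝ) :
    ENNReal.ofReal (t ^ α / kernelDenom lam α t x y)
      ≤ (Clam.toNNReal * 2 ^ α : ℝ≥0)
        * tailKernel μ Clam.toNNReal (((1 / 2 : ℝ≥0) ^ (α / 2)) ^ 2) t x y := by
  obtain ⟨k, hk, hle⟩ := h.exists_div_kernelDenom_le hα ht x y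
  have hC : 0 ≤ Clam := zero_le_one.trans h.one_le
  have hr : 0 < 2 ^ k * t := by positivity
  have hq : ((1 / 2 : ℝ≥0) ^ (α / 2)) ^ 2 = (1 / 2 : ℝ≥0) ^ α := by
    rw [← NNReal.rpow_natCast, ← NNReal.rpow_mul]; congr 1; push_cast; ring
  refine (ENNReal.ofReal_le_ofReal hle).trans ?_
  have hy : y ∈ Metric.ball x (2 ^ k * t) := by rwa [Metric.mem_ball, dist_comm]
  rw [ENNReal.ofReal_mul (by positivity), ENNReal.ofReal_mul (by positivity), mul_assoc,
    ENNReal.ofReal_inv_of_pos (h.pos x _ hr)]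
  have e1 : ENNReal.ofReal (Clam * 2 ^ α) = (Clam.toNNReal * 2 ^ α : ℝ≥0) := by
    rw [ENNReal.ofReal, Real.toNNReal_mul hC, Real.toNNReal_rpow_of_nonneg (by norm_num)]
    norm_num
  have e2 : ENNReal.ofReal (((1 / 2 : ℝ) ^ α) ^ k) = ((1 / 2 : ℝ≥0) ^ α : ℝ≥0) ^ k := by
    rw [ENNReal.ofReal_pow (by positivity), ENNReal.ofReal, Real.toNNReal_rpow_of_nonneg
      (by norm_num)]
    congr 4
    rw [one_div, Real.toNNReal_inv]; norm_num
  rw [e1, e2, hq]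
  gcongr
  refine le_trans ?_ (ENNReal.le_tsum k)
  rw [indicator_of_mem hy]
  gcongr
  exact h.dyadicMajorant_le x hr

/-- Kernel bounds in terms of `tailKernel`. -/
structure HasTailBound (μ : Measure (Fin n → ℝ)) (D q A : ℝ≥0) (α : ℝ)
    (s : ℝ → (Fin n → ℝ) → (Fin n → ℝ) → ℂ) : Prop where
  measurable : Measurable fun p : ℝ × (Fin n → ℝ) × (Fin n → ℝ) => s p.1 p.2.1 p.2.2
  size : ∀ t, 0 < t → ∀ x y, ‖s t x y‖ₑ ≤ A * tailKernel μ D (q ^ 2) t x y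
  holder : ∀ t, 0 < t → ∀ x y z, dist y z < t / 2 →
    ‖s t x y - s t x z‖ₑ
      ≤ A * (ENNReal.ofReal ((dist y z / t) ^ α) * tailKernel μ D (q ^ 2) t x y)

/-- Extension by zero to t ≤ 0 turns measurability over (0, ∞) into measurability over the whole
line; the estimates concern only t > 0. -/
theorem IsSquareKernel.hasTailBound (h : IsUpperDoubling μ lam Clam) {α Cs : ℝ} (hα : 0 < α)
    {s : ℝ → (Fin n → ℝ) → (Fin n → ℝ) → ℂ} (hs : IsSquareKernel lam α Cs s) :
    HasTailBound μ Clam.toNNReal ((1 / 2 : ℝ≥0) ^ (α / 2)) (Cs.toNNReal * (Clam.toNNReal * 2 ^ α)) α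
      fun t x y => if 0 < t then s t x y else 0 where
  measurable := by
    have hm : MeasurableSet {p : ℝ × (Fin n → ℝ) × (Fin n → ℝ) | 0 < p.1} :=
      measurableSet_lt measurable_const measurable_fst
    refine measurable_of_restrict_of_restrict_compl hm ?_ ?_
    · have : Measurable fun p : {p : ℝ × (Fin n → ℝ) × (Fin n → ℝ) | 0 < p.1} =>
          ((⟨p.1.1, p.2⟩ : Ioi (0 : ℝ)), p.1.2) := by
        refine Measurable.prodMk (Measurable.subtype_mk ?_) ?_
        · exact measurable_fst.comp measurable_subtype_coe
        · exact measurable_snd.comp measurable_subtype_coe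
      convert hs.measurable.comp this using 1
      ext p
      exact if_pos p.2
    · convert measurable_const (a := (0 : ℂ)) using 1
      ext p
      exact if_neg p.2
  size t ht x y := by
    simp only [if_pos ht]
    rw [ENNReal.coe_mul, mul_assoc]
    calc ‖s t x y‖ₑ = ENNReal.ofReal ‖s t x y‖ := (ofReal_norm _).symm
      _ ≤ ENNReal.ofReal Cs * ENNReal.ofReal (t ^ α / kernelDenom lam α t x y) := by
          rw [← ENNReal.ofReal_mul' ?_]
          · exact ENNReal.ofReal_le_ofReal (hs.size t ht x y)
          · exact h.div_kernelDenom_nonneg hα ht x y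
      _ ≤ _ := by
          gcongr
          · exact le_rfl
          · exact h.div_kernelDenom_le_tailKernel hα ht x y
  holder t ht x y z hyz := by
    simp only [if_pos ht]
    have hpos : 0 ≤ t ^ α / kernelDenom lam α t x y :=
      h.div_kernelDenom_nonneg hα ht x y
    rw [ENNReal.coe_mul, mul_assoc]
    calc ‖s t x y - s t x z‖ₑ = ENNReal.ofReal ‖s t x y - s t x z‖ := (ofReal_norm _).symm
      _ ≤ ENNReal.ofReal (Cs * ((dist y z / t) ^ α * (t ^ α / kernelDenom lam α t x y))) := by
          refine ENNReal.ofReal_le_ofReal ((hs.holder t ht x y z hyz).trans (le_of_eq ?_))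
          rw [Real.div_rpow dist_nonneg ht.le]
          have := Real.rpow_pos_of_pos ht α
          field_simp
      _ = ENNReal.ofReal Cs * (ENNReal.ofReal ((dist y z / t) ^ α)
            * ENNReal.ofReal (t ^ α / kernelDenom lam α t x y)) := by
          rw [ENNReal.ofReal_mul' (by positivity), ENNReal.ofReal_mul' hpos]
      _ ≤ ENNReal.ofReal Cs * (ENNReal.ofReal ((dist y z / t) ^ α) * ((Clam.toNNReal * 2 ^ α : ℝ≥0)
        * tailKernel μ Clam.toNNReal (((1 / 2 : ℝ≥0) ^ (α / 2)) ^ 2) t x y)) := by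
          gcongr
          exact h.div_kernelDenom_le_tailKernel hα ht x y
      _ = _ := by
          rw [ENNReal.ofReal]; ring

end KernelBounds

/-! ### Pointwise bounds for θ_t: size, integrability, cancellation -/

section TailBound

variable {n : ℕ} {μ : Measure (Fin n → ℝ)} {D q A : ℝ≥0} {α : ℝ}
  {s : ℝ → (Fin n → ℝ) → (Fin n → ℝ) → ℂ}

theorem HasTailBound.measurable_right (hs : HasTailBound μ D q A α s) (t : ℝ) (x : Fin n → ℝ) :
    Measurable (s t x) :=
  hs.measurable.comp (measurable_const.prodMk (measurable_const.prodMk measurable_id))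

/-- The size bound has parameter `q ^ 2` and the result only `q`: the spare half of the decay
becomes the factor κ, which is small when E is far from x. -/
theorem HasTailBound.setLIntegral_enorm_mul_le (hs : HasTailBound μ D q A α s) {t : ℝ} (ht : 0 < t)
    {x : Fin n → ℝ} {E : Set (Fin n → ℝ)} (hE : MeasurableSet E) {ρ : ℝ}
    (hρ : ∀ y ∈ E, ρ ≤ dist y x)
    {κ : ℝ≥0} (hκ : ∀ k : ℕ, ρ < 2 ^ k * t → q ^ k ≤ κ) {g : (Fin n → ℝ) → ℝ≥0∞}
    (hg : Measurable g) :
    ∫⁻ y in E, ‖s t x y‖ₑ * g y ∂μ ≤ A * κ * tailOp μ D q t g x := by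
  rw [← lintegral_tailKernel_mul hg, ← ENNReal.coe_mul,
    ← lintegral_const_mul' _ _ ENNReal.coe_ne_top]
  refine le_trans (setLIntegral_mono' (g := fun y => ((A * κ : ℝ≥0) : ℝ≥0∞) * (tailKernel μ D q t x y * g y)) hE fun y hy => ?_)
    (setLIntegral_le_lintegral _ _)
  rw [ENNReal.coe_mul, ← mul_assoc, mul_assoc (A : ℝ≥0∞)]
  gcongr
  refine (hs.size t ht x y).trans ?_
  gcongr
  exact tailKernel_sq_le (hρ y hy) fun k hk => by exact_mod_cast hκ k hk

theorem HasTailBound.lintegral_enorm_mul_le (hs : HasTailBound μ D q A α s) (hq : q < 1) {t : ℝ}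
    (ht : 0 < t) (x : Fin n → ℝ) {g : (Fin n → ℝ) → ℝ≥0∞} (hg : Measurable g) :
    ∫⁻ y, ‖s t x y‖ₑ * g y ∂μ ≤ A * tailOp μ D q t g x := by
  have := hs.setLIntegral_enorm_mul_le ht (x := x) MeasurableSet.univ (ρ := 0) (κ := 1)
    (fun _ _ => dist_nonneg) (fun k _ => pow_le_one₀ zero_le hq.le) hg
  simpa using this

theorem HasTailBound.enorm_theta_le (hs : HasTailBound μ D q A α s) (hq : q < 1) {t : ℝ}
    (ht : 0 < t) (x : Fin n → ℝ) {f : (Fin n → ℝ) → ℂ} (hf : Measurable f) :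
    ‖theta μ s f t x‖ₑ ≤ A * tailOp μ D q t (fun y => ‖f y‖ₑ) x := by
  refine (enorm_integral_le_lintegral_enorm _).trans ?_
  simp only [enorm_mul]
  exact hs.lintegral_enorm_mul_le hq ht x hf.enorm

theorem HasTailBound.integrable_of_tailOp (hs : HasTailBound μ D q A α s) (hq : q < 1) {t : ℝ}
    (ht : 0 < t) (x : Fin n → ℝ) {f : (Fin n → ℝ) → ℂ} (hf : Measurable f)
    (hfin : tailOp μ D q t (fun y => ‖f y‖ₑ) x ≠ ∞) : Integrable (fun y => s t x y * f y) μ := by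
  refine ⟨((hs.measurable_right t x).mul hf).aestronglyMeasurable, ?_⟩
  rw [hasFiniteIntegral_iff_enorm]
  simp only [enorm_mul]
  exact (hs.lintegral_enorm_mul_le hq ht x hf.enorm).trans_lt
    (ENNReal.mul_lt_top ENNReal.coe_lt_top hfin.lt_top)

theorem tailOp_ne_top_of_memLp (hq : q < 1) (hμ : μ ≠ 0) {t : ℝ} (ht : 0 < t) {f : (Fin n → ℝ) → ℂ}
    (hf : MemLp f 2 μ) (x : Fin n → ℝ) : tailOp μ D q t (fun y => ‖f y‖ₑ) x ≠ ∞ := by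
  refine ne_top_of_le_ne_top ?_ (tailOp_le_of_sq_integrable hq ht hf.1.aemeasurable.enorm x)
  refine ENNReal.mul_ne_top ENNReal.coe_ne_top (ENNReal.add_ne_top.2 ⟨ENNReal.one_ne_top, ?_⟩)
  exact ENNReal.div_ne_top ((memLp_two_iff_lintegral hf.1).1 hf).ne
    (dyadicMajorant_ne_zero hμ x ht)

theorem HasTailBound.integrable_of_memLp (hs : HasTailBound μ D q A α s) (hq : q < 1)
    (hμ : μ ≠ 0) {t : ℝ} (ht : 0 < t) (x : Fin n → ℝ) {f : (Fin n → ℝ) → ℂ} (hfm : Measurable f)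
    (hf : MemLp f 2 μ) : Integrable (fun y => s t x y * f y) μ :=
  hs.integrable_of_tailOp hq ht x hfm (tailOp_ne_top_of_memLp hq hμ ht hf x)

theorem tailOp_le_of_bounded (hq : q < 1) {t : ℝ} {f : (Fin n → ℝ) → ℂ} {B : ℝ≥0}
    (hB : ∀ x, ‖f x‖ₑ ≤ B) (x : Fin n → ℝ) :
    tailOp μ D q t (fun y => ‖f y‖ₑ) x ≤ (B * (1 - q)⁻¹ : ℝ≥0) := by
  calc _ ≤ tailOp μ D q t (fun _ => B * 1) x := tailOp_mono (fun y => by simpa using hB y) x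
    _ = B * tailOp μ D q t (fun _ => 1) x := tailOp_const_mul _ _
    _ ≤ _ := by rw [ENNReal.coe_mul]; gcongr; exact tailOp_one_le hq t x

theorem HasTailBound.integrable_of_bounded (hs : HasTailBound μ D q A α s) (hq : q < 1) {t : ℝ}
    (ht : 0 < t) (x : Fin n → ℝ) {f : (Fin n → ℝ) → ℂ} (hf : Measurable f) {B : ℝ≥0}
    (hB : ∀ x, ‖f x‖ₑ ≤ B) : Integrable (fun y => s t x y * f y) μ :=
  hs.integrable_of_tailOp hq ht x hf
    (ne_top_of_le_ne_top ENNReal.coe_ne_top (tailOp_le_of_bounded hq hB x))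

theorem HasTailBound.enorm_theta_le_of_bounded (hs : HasTailBound μ D q A α s) (hq : q < 1) {t : ℝ}
    (ht : 0 < t) (x : Fin n → ℝ) {f : (Fin n → ℝ) → ℂ} (hf : Measurable f) {B : ℝ≥0}
    (hB : ∀ x, ‖f x‖ₑ ≤ B) : ‖theta μ s f t x‖ₑ ≤ (A * (B * (1 - q)⁻¹) : ℝ≥0) := by
  rw [ENNReal.coe_mul]
  exact (hs.enorm_theta_le hq ht x hf).trans (by gcongr; exact tailOp_le_of_bounded hq hB x)

/-- Cancellation on the fibres of a fine partition makes `θ_t h` small. -/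
theorem HasTailBound.enorm_theta_le_of_mean_zero {ι : Type*} [MeasurableSpace ι] [Countable ι]
    [MeasurableSingletonClass ι] (hs : HasTailBound μ D q A α s) (hq : q < 1) (hα : 0 < α) {t : ℝ}
    (ht : 0 < t) (x : Fin n → ℝ) {h : (Fin n → ℝ) → ℂ} (hh : Measurable h)
    (hint : Integrable (fun y => s t x y * h y) μ) {π : (Fin n → ℝ) → ι} (hπ : Measurable π)
    (hhint : ∀ i, IntegrableOn h (π ⁻¹' {i}) μ) (hmean : ∀ i, ∫ y in π ⁻¹' {i}, h y ∂μ = 0)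
    {δ : ℝ} (hδ : δ < t / 2) (hdist : ∀ y z, π y = π z → dist y z ≤ δ) :
    ‖theta μ s h t x‖ₑ
      ≤ A * (ENNReal.ofReal ((δ / t) ^ α) * tailOp μ D q t (fun y => ‖h y‖ₑ) x) := by
  set G : (Fin n → ℝ) → ℝ≥0∞ := fun y =>
    A * (ENNReal.ofReal ((δ / t) ^ α) * (tailKernel μ D q t x y * ‖h y‖ₑ)) with hG
  have hcell : ∀ i, ‖∫ y in π ⁻¹' {i}, s t x y * h y ∂μ‖ₑ ≤ ∫⁻ y in π ⁻¹' {i}, G y ∂μ := by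
    intro i
    have hm : MeasurableSet (π ⁻¹' {i}) := hπ (measurableSet_singleton i)
    by_cases hj : ∃ z, π z = i
    · obtain ⟨z, rfl⟩ := hj
      -- The mean-zero property allows subtracting s_t(x, z) for any fixed z of the cell, which
      -- brings in the Hölder estimate.
      have e : ∫ y in π ⁻¹' {π z}, s t x y * h y ∂μ
          = ∫ y in π ⁻¹' {π z}, (s t x y - s t x z) * h y ∂μ := by
        simp_rw [sub_mul]
        rw [integral_sub hint.integrableOn ((hhint _).const_mul _), integral_const_mul, hmean]
        simp
      rw [e]
      refine (enorm_integral_le_lintegral_enorm _).trans (setLIntegral_mono' hm fun y hy => ?_)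
      have hyz : dist y z ≤ δ := hdist y z hy
      simp only [hG]
      rw [enorm_mul, ← mul_assoc (ENNReal.ofReal _), ← mul_assoc (A : ℝ≥0∞)]
      gcongr
      refine (hs.holder t ht x y z (hyz.trans_lt hδ)).trans ?_
      gcongr
      simpa using tailKernel_sq_le (μ := μ) (D := D) (q := q) (t := t) (x := x) (y := y)
        dist_nonneg (κ := 1) fun k _ => pow_le_one₀ zero_le (by exact_mod_cast hq.le)
    · have : π ⁻¹' {i} = ∅ := by
        ext y; simp; exact fun hy => hj ⟨y, hy⟩
      simp [this]
  have hU : (univ : Set (Fin n → ℝ)) = ⋃ i, π ⁻¹' {i} := by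
    rw [← preimage_iUnion, iUnion_of_singleton, preimage_univ]
  have hsum : theta μ s h t x = ∑' i, ∫ y in π ⁻¹' {i}, s t x y * h y ∂μ := by
    rw [theta, ← setIntegral_univ, hU]
    refine integral_iUnion (fun i => hπ (measurableSet_singleton i)) (fun i j hij =>
      Disjoint.preimage _ (by simpa using hij)) hint.integrableOn
  rw [hsum]
  calc _ ≤ ∑' i, ‖∫ y in π ⁻¹' {i}, s t x y * h y ∂μ‖ₑ := enorm_tsum_le_tsum_enorm
    _ ≤ ∑' i, ∫⁻ y in π ⁻¹' {i}, G y ∂μ := ENNReal.tsum_le_tsum hcell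
    _ = ∫⁻ y, G y ∂μ := (lintegral_eq_tsum_fiber μ hπ G).symm
    _ = _ := by
        simp only [hG]
        rw [lintegral_const_mul' _ _ ENNReal.coe_ne_top,
          lintegral_const_mul' _ _ ENNReal.ofReal_ne_top, lintegral_tailKernel_mul hh.enorm]

end TailBound

/-! ### Shifted dyadic grids -/

section Grid

variable {n : ℕ}

/-- The index of the cell containing `x` in the grid of sidelength `L / 2 ^ k`, shifted by `τ`
in each coordinate. -/
noncomputable def gridIdx (τ L : ℝ) (k : ℕ) (x : Fin n → ℝ) : Fin n → ℤ :=
  fun i => ⌊(x i - τ) / (L / 2 ^ k)⌋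

theorem measurable_gridIdx (τ L : ℝ) (k : ℕ) : Measurable (gridIdx (n := n) τ L k) :=
  measurable_pi_lambda _ fun i => Int.measurable_floor.comp (by fun_prop)

theorem gridIdx_refine {τ L : ℝ} (k : ℕ) {x y : Fin n → ℝ}
    (h : gridIdx τ L (k + 1) x = gridIdx τ L (k + 1) y) : gridIdx τ L k x = gridIdx τ L k y := by
  funext i
  have hi : ⌊(x i - τ) / (L / 2 ^ (k + 1))⌋ = ⌊(y i - τ) / (L / 2 ^ (k + 1))⌋ := congr_fun h i
  -- The index of the parent cell is the integer half of the index, because all levels share the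
  -- same origin τ.
  have e : ∀ a : ℝ, ⌊a / (L / 2 ^ k)⌋ = ⌊a / (L / 2 ^ (k + 1))⌋ / 2 := fun a => by
    have := Int.floor_div_natCast (a / (L / 2 ^ (k + 1))) 2
    push_cast at this
    rw [← this]
    congr 1
    rw [pow_succ]
    by_cases hL : L = 0
    · simp [hL]
    · field_simp
  simp only [gridIdx, e, hi]

theorem gridIdx_preimage {τ L : ℝ} (hL : 0 < L) (k : ℕ) (i : Fin n → ℤ) :
    gridIdx τ L k ⁻¹' {i} = cube (fun j => τ + i j * (L / 2 ^ k)) (L / 2 ^ k) := by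
  have hl : 0 < L / 2 ^ k := by positivity
  ext x
  simp only [mem_preimage, mem_singleton_iff, cube, mem_ofPred_eq, mem_Ico, funext_iff, gridIdx]
  refine forall_congr' fun j => ?_
  rw [Int.floor_eq_iff, le_div_iff₀ hl, div_lt_iff₀ hl]
  constructor <;> rintro ⟨h1, h2⟩ <;> constructor <;> linarith

theorem dist_le_of_gridIdx_eq {τ L : ℝ} (hL : 0 < L) {k : ℕ} {x y : Fin n → ℝ}
    (h : gridIdx τ L k x = gridIdx τ L k y) : dist x y ≤ L / 2 ^ k := by
  have hl : 0 < L / 2 ^ k := by positivity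
  rw [dist_pi_le_iff hl.le]
  intro i
  have hi : ⌊(x i - τ) / (L / 2 ^ k)⌋ = ⌊(y i - τ) / (L / 2 ^ k)⌋ := congr_fun h i
  have := Int.abs_sub_lt_one_of_floor_eq_floor hi
  rw [← sub_div, abs_div, abs_of_pos hl, div_lt_one hl] at this
  rw [Real.dist_eq]
  have e : x i - τ - (y i - τ) = x i - y i := by ring
  rw [e] at this
  exact this.le

theorem measure_gridIdx_ne_top {μ : Measure (Fin n → ℝ)} [IsLocallyFiniteMeasure μ] {τ L : ℝ}
    (hL : 0 < L) (k : ℕ) (i : Fin n → ℤ) : μ (gridIdx τ L k ⁻¹' {i}) ≠ ∞ := by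
  refine (Bornology.IsBounded.measure_lt_top ?_).ne
  rw [Metric.isBounded_iff]
  exact ⟨L / 2 ^ k, fun x hx y hy => dist_le_of_gridIdx_eq hL (hx.trans hy.symm)⟩

end Grid

/-! ### Good points and averaging over shifts -/

section Good

variable {n : ℕ}

/-- The points whose distance to the grid hyperplanes of all levels `k ≤ j` is not too small. -/
def goodSet (η τ L : ℝ) (j : ℕ) : Set (Fin n → ℝ) :=
  {x | ∀ k ≤ j, ∀ (i : Fin n) (m : ℤ),
    η * (3 / 4) ^ (j - k) * (L / 2 ^ k) ≤ |x i - τ - m * (L / 2 ^ k)|}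

/-- In a coordinate where the indices differ, a hyperplane of the level separates x from y: the
lower face of the cell of x, or that of y, according to the order. -/
theorem le_dist_of_mem_goodSet {η τ L : ℝ} (hL : 0 < L) {j k : ℕ} (hk : k ≤ j) {x y : Fin n → ℝ}
    (hx : x ∈ goodSet η τ L j) (hy : gridIdx τ L k y ≠ gridIdx τ L k x) :
    η * (3 / 4) ^ (j - k) * (L / 2 ^ k) ≤ dist y x := by
  have hl : 0 < L / 2 ^ k := by positivity
  obtain ⟨i, hi⟩ := Function.ne_iff.1 hy
  refine le_trans ?_ (dist_le_pi_dist y x i)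
  simp only [gridIdx] at hi
  set a := (x i - τ) / (L / 2 ^ k) with ha
  set b := (y i - τ) / (L / 2 ^ k) with hb
  have hxa : x i - τ = a * (L / 2 ^ k) := by rw [ha]; field_simp
  have hyb : y i - τ = b * (L / 2 ^ k) := by rw [hb]; field_simp
  have hyx : y i - x i = (b - a) * (L / 2 ^ k) := by linarith
  rw [Real.dist_eq, hyx, abs_mul, abs_of_pos hl]
  rcases lt_or_gt_of_ne hi with h | h
  · refine (hx k hk i ⌊a⌋).trans ?_
    rw [hxa, ← sub_mul, abs_mul, abs_of_pos hl]
    have h1 := Int.floor_le a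
    have h2 : b < ⌊a⌋ := Int.floor_lt.1 h
    rw [abs_of_nonneg (by linarith), abs_of_nonpos (by linarith)]
    gcongr
    linarith
  · refine (hx k hk i ⌊b⌋).trans ?_
    rw [hxa, ← sub_mul, abs_mul, abs_of_pos hl]
    have h1 := Int.floor_le b
    have h2 : a < ⌊b⌋ := Int.floor_lt.1 h
    rw [abs_of_nonneg (by linarith : 0 ≤ b - a), abs_of_nonpos (by linarith)]
    gcongr
    linarith

theorem measurableSet_goodSet_prod (η L : ℝ) (j : ℕ) :
    MeasurableSet {p : ℝ × (Fin n → ℝ) | p.2 ∈ goodSet η p.1 L j} := by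
  have e : {p : ℝ × (Fin n → ℝ) | p.2 ∈ goodSet η p.1 L j}
      = ⋂ k, ⋂ _ : k ≤ j, ⋂ i, ⋂ m : ℤ, {p : ℝ × (Fin n → ℝ) |
        η * (3 / 4) ^ (j - k) * (L / 2 ^ k) ≤ |p.2 i - p.1 - m * (L / 2 ^ k)|} := by
    ext p
    simp [goodSet]
  rw [e]
  refine MeasurableSet.iInter fun k => MeasurableSet.iInter fun _ => MeasurableSet.iInter fun i =>
    MeasurableSet.iInter fun m => measurableSet_le measurable_const ?_
  exact Measurable.abs (by fun_prop)

theorem measurableSet_goodSet (η τ L : ℝ) (j : ℕ) :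
    MeasurableSet (goodSet (n := n) η τ L j) :=
  (measurableSet_goodSet_prod η L j).preimage (measurable_const.prodMk measurable_id)

/-- As τ runs over [0, L), at most 2^k + 2 ≤ 3 · 2^k hyperplanes matter, and each excludes an
interval of length 2ηL/2^k. -/
theorem volume_near_hyperplanes_le {L : ℝ} (hL : 0 < L) (k : ℕ) (z : ℝ) {η : ℝ} (h0 : 0 ≤ η)
    (h1 : η ≤ 1) :
    volume {τ : ℝ | τ ∈ Ico 0 L ∧ ∃ m : ℤ, |z - τ - m * (L / 2 ^ k)| < η * (L / 2 ^ k)}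
      ≤ ENNReal.ofReal (6 * η * L) := by
  set l := L / 2 ^ k with hl
  have hlp : 0 < l := by positivity
  have hLl : L = 2 ^ k * l := by rw [hl]; field_simp
  set S := Finset.Icc (⌊z / l⌋ - 2 ^ k) (⌊z / l⌋ + 1) with hS
  have hsub : {τ : ℝ | τ ∈ Ico 0 L ∧ ∃ m : ℤ, |z - τ - m * l| < η * l}
      ⊆ ⋃ m ∈ S, Metric.ball (z - m * l) (η * l) := by
    rintro τ ⟨⟨hτ0, hτL⟩, m, hm⟩
    have hm' := abs_lt.1 hm
    have hηl : η * l ≤ l := by nlinarith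
    have hz : z / l * l = z := by field_simp
    have hf1 := Int.floor_le (z / l)
    have hf2 := Int.lt_floor_add_one (z / l)
    refine mem_iUnion₂.2 ⟨m, ?_, ?_⟩
    · rw [hS, Finset.mem_Icc]
      constructor
      · have : (⌊z / l⌋ : ℝ) - 2 ^ k - 1 < m := by
          refine lt_of_mul_lt_mul_right ?_ hlp.le
          nlinarith
        have : ⌊z / l⌋ - 2 ^ k - 1 < m := by exact_mod_cast this
        omega
      · have : (m : ℝ) < ⌊z / l⌋ + 2 := by
          refine lt_of_mul_lt_mul_right ?_ hlp.le
          nlinarith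
        have : m < ⌊z / l⌋ + 2 := by exact_mod_cast this
        omega
    · rw [Metric.mem_ball, Real.dist_eq, abs_sub_comm]
      convert hm using 2
      ring
  calc _ ≤ volume (⋃ m ∈ S, Metric.ball (z - m * l) (η * l)) := measure_mono hsub
    _ ≤ ∑ m ∈ S, volume (Metric.ball (z - m * l) (η * l)) := measure_biUnion_finset_le _ _
    _ = ENNReal.ofReal (S.card * (2 * (η * l))) := by
        simp only [Real.volume_ball, Finset.sum_const]
        rw [nsmul_eq_mul, ENNReal.ofReal_mul (p := (S.card : ℝ)) (Nat.cast_nonneg _),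
          ENNReal.ofReal_natCast]
    _ ≤ _ := by
        refine ENNReal.ofReal_le_ofReal ?_
        have hc : (S.card : ℝ) ≤ 3 * 2 ^ k := by
          have h1 : (1 : ℤ) ≤ 2 ^ k := one_le_pow₀ (by norm_num)
          have h2 : (S.card : ℤ) ≤ 3 * 2 ^ k := by
            rw [hS, Int.card_Icc, Int.toNat_of_nonneg (by linarith)]
            linarith
          exact_mod_cast h2
        calc (S.card : ℝ) * (2 * (η * l)) ≤ 3 * 2 ^ k * (2 * (η * l)) := by gcongr
          _ = _ := by rw [hLl]; ring

/-- The rate 3/4 is below 1, so that the bad measure sums over the levels, and above 1/2, so that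
the distance to coarse boundaries still grows relative to the scale. -/
theorem sum_three_quarters_pow_le (j : ℕ) :
    ∑ k ∈ Finset.range (j + 1), (3 / 4 : ℝ) ^ (j - k) ≤ 4 := by
  have h := Finset.sum_range_reflect (fun m => (3 / 4 : ℝ) ^ m) (j + 1)
  simp only [add_tsub_cancel_right] at h
  rw [h, geom_sum_eq (by norm_num)]
  have : (0 : ℝ) < (3 / 4) ^ (j + 1) := by positivity
  rw [div_le_iff_of_neg (by norm_num)]
  linarith

/-- Every point is good for at least half of the shifts. -/
theorem le_volume_goodSet {L η : ℝ} (hL : 0 < L) (h0 : 0 ≤ η) (hη : 48 * n * η ≤ 1)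
    (h1 : η ≤ 1) (j : ℕ) (x : Fin n → ℝ) :
    ENNReal.ofReal (L / 2) ≤ volume (Ico 0 L ∩ {τ : ℝ | x ∈ goodSet η τ L j}) := by
  set G := {τ : ℝ | x ∈ goodSet η τ L j} with hG
  have hGm : MeasurableSet G := (measurableSet_goodSet_prod η L j).preimage
    (measurable_id.prodMk measurable_const)
  -- Union bound over levels and coordinates: the total is at most 6nηL · 4, and this is at most L/2
  -- because 48nη ≤ 1.
  have hbad : volume (Ico 0 L \ G) ≤ ENNReal.ofReal (L / 2) := by
    have hsub : Ico 0 L \ G ⊆ ⋃ k ∈ Finset.range (j + 1), ⋃ i ∈ (Finset.univ : Finset (Fin n)),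
        {τ : ℝ | τ ∈ Ico 0 L ∧ ∃ m : ℤ,
          |x i - τ - m * (L / 2 ^ k)| < (η * (3 / 4) ^ (j - k)) * (L / 2 ^ k)} := by
      rintro τ ⟨hτ, hb⟩
      simp only [hG, goodSet, mem_ofPred_eq, not_forall, not_le] at hb
      obtain ⟨k, hk, i, m, hm⟩ := hb
      simp only [mem_iUnion]
      exact ⟨k, Finset.mem_range.2 (by omega), i, Finset.mem_univ i, hτ, m, hm⟩
    calc _ ≤ _ := measure_mono hsub
      _ ≤ ∑ k ∈ Finset.range (j + 1), ∑ i : Fin n, ENNReal.ofReal (6 * (η * (3 / 4) ^ (j - k)) * L) := by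
          refine (measure_biUnion_finset_le _ _).trans (Finset.sum_le_sum fun k _ =>
            (measure_biUnion_finset_le _ _).trans (Finset.sum_le_sum fun i _ =>
              volume_near_hyperplanes_le hL k (x i) (by positivity) ?_))
          exact mul_le_one₀ h1 (by positivity) (pow_le_one₀ (by norm_num) (by norm_num))
      _ = ENNReal.ofReal (6 * n * η * L * ∑ k ∈ Finset.range (j + 1), (3 / 4 : ℝ) ^ (j - k)) := by
          simp only [Finset.sum_const, Finset.card_univ, Fintype.card_fin, nsmul_eq_mul]
          rw [Finset.mul_sum, ENNReal.ofReal_sum_of_nonneg fun k _ => by positivity]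
          refine Finset.sum_congr rfl fun k _ => ?_
          rw [← ENNReal.ofReal_natCast, ← ENNReal.ofReal_mul (by positivity)]
          congr 1
          ring
      _ ≤ _ := by
          refine ENNReal.ofReal_le_ofReal ?_
          calc _ ≤ 6 * n * η * L * 4 := by gcongr; exact sum_three_quarters_pow_le j
            _ ≤ L / 2 := by nlinarith
  have hsplit := measure_inter_add_sdiff (μ := (volume : Measure ℝ)) (Ico 0 L) hGm
  rw [Real.volume_Ico, sub_zero] at hsplit
  have hhalf : ENNReal.ofReal L = ENNReal.ofReal (L / 2) + ENNReal.ofReal (L / 2) := by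
    rw [← ENNReal.ofReal_add (by positivity) (by positivity)]; congr 1; ring
  rw [hhalf] at hsplit
  refine (ENNReal.add_le_add_iff_right (a := ENNReal.ofReal (L / 2)) ENNReal.ofReal_ne_top).1 ?_
  rw [← hsplit]
  gcongr

/-- Integrals over the good sets of all shifted grids control integrals over the whole space. -/
theorem tsum_lintegral_le_of_goodSet {μ : Measure (Fin n → ℝ)} [SFinite μ] {L η : ℝ} (hL : 0 < L)
    (h0 : 0 ≤ η) (hη : 48 * n * η ≤ 1) (h1 : η ≤ 1) {F : ℝ × (Fin n → ℝ) → ℝ≥0∞}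
    (hF : Measurable F) (I : ℕ → Set ℝ) {M : ℝ≥0∞}
    (hM : ∀ τ, ∑' j, ∫⁻ t in I j, ∫⁻ x in goodSet η τ L j, F (t, x) ∂μ ≤ M) :
    ∑' j, ∫⁻ t in I j, ∫⁻ x, F (t, x) ∂μ ≤ 2 * M := by
  set H : ℕ → ℝ × ℝ × (Fin n → ℝ) → ℝ≥0∞ := fun j p =>
    {p : ℝ × (Fin n → ℝ) | p.2 ∈ goodSet η p.1 L j}.indicator (fun _ => 1) (p.1, p.2.2) * F p.2
    with hH
  have hHm : ∀ j, Measurable (H j) := fun j =>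
    ((measurable_const.indicator (measurableSet_goodSet_prod η L j)).comp
      (measurable_fst.prodMk (measurable_snd.comp measurable_snd))).mul (hF.comp measurable_snd)
  have hHI : ∀ j τ t, ∫⁻ x in goodSet η τ L j, F (t, x) ∂μ = ∫⁻ x, H j (τ, t, x) ∂μ := by
    intro j τ t
    rw [← lintegral_indicator (measurableSet_goodSet η τ L j)]
    refine lintegral_congr fun x => ?_
    by_cases hx : x ∈ goodSet η τ L j
    · simp [hH, hx]
    · simp [hH, hx]
  have hm1 : ∀ j, Measurable fun p : ℝ × ℝ => ∫⁻ x, H j (p.1, p.2, x) ∂μ := fun j =>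
    Measurable.lintegral_prod_right' (f := fun q : (ℝ × ℝ) × (Fin n → ℝ) => H j (q.1.1, q.1.2, q.2))
      ((hHm j).comp (by fun_prop))
  have hm2 : ∀ j, Measurable fun τ => ∫⁻ t in I j, ∫⁻ x, H j (τ, t, x) ∂μ := fun j =>
    (hm1 j).lintegral_prod_right'
  -- Tonelli moves the τ-integral inside, where it measures the shifts for which x is good.
  have hlow : ∀ j, ENNReal.ofReal (L / 2) * ∫⁻ t in I j, ∫⁻ x, F (t, x) ∂μ
      ≤ ∫⁻ τ in Ico 0 L, ∫⁻ t in I j, ∫⁻ x, H j (τ, t, x) ∂μ := by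
    intro j
    rw [lintegral_lintegral_swap (f := fun τ t => ∫⁻ x, H j (τ, t, x) ∂μ) (hm1 j).aemeasurable,
      ← lintegral_const_mul' _ _ ENNReal.ofReal_ne_top]
    refine lintegral_mono fun t => ?_
    rw [lintegral_lintegral_swap (f := fun τ x => H j (τ, t, x))
      ((hHm j).comp (by fun_prop)).aemeasurable, ← lintegral_const_mul' _ _ ENNReal.ofReal_ne_top]
    refine lintegral_mono fun x => ?_
    have hGm : MeasurableSet {τ : ℝ | x ∈ goodSet η τ L j} :=
      (measurableSet_goodSet_prod η L j).preimage (measurable_id.prodMk measurable_const)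
    have e : ∀ τ, H j (τ, t, x)
        = {τ : ℝ | x ∈ goodSet η τ L j}.indicator (fun _ => F (t, x)) τ := fun τ => by
      by_cases hx : x ∈ goodSet η τ L j
      · simp [hH, hx]
      · simp [hH, hx]
    simp_rw [e]
    rw [lintegral_indicator hGm, setLIntegral_const, Measure.restrict_apply hGm, mul_comm,
      inter_comm]
    gcongr
    exact le_volume_goodSet hL h0 hη h1 j x
  have hLp : ENNReal.ofReal (L / 2) ≠ 0 := by simpa using hL
  refine (ENNReal.mul_le_mul_iff_right hLp ENNReal.ofReal_ne_top).1 ?_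
  rw [← ENNReal.tsum_mul_left]
  calc _ ≤ ∑' j, ∫⁻ τ in Ico 0 L, ∫⁻ t in I j, ∫⁻ x, H j (τ, t, x) ∂μ := ENNReal.tsum_le_tsum hlow
    _ = ∫⁻ τ in Ico 0 L, ∑' j, ∫⁻ t in I j, ∫⁻ x, H j (τ, t, x) ∂μ :=
        (lintegral_tsum fun j => (hm2 j).aemeasurable).symm
    _ ≤ ∫⁻ τ in Ico 0 L, M := by
        refine lintegral_mono fun τ => ?_
        simpa only [hHI] using hM τ
    _ = M * ENNReal.ofReal L := by rw [setLIntegral_const, Real.volume_Ico, sub_zero]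
    _ = _ := by
        have : L = L / 2 * 2 := by ring
        conv_lhs => rw [this, ENNReal.ofReal_mul (by positivity)]
        simp
        ring

end Good

/-! ### Decay away from the scale t: fine and coarse pieces -/

section Decomposition

variable {n : ℕ} {μ : Measure (Fin n → ℝ)} {D A : ℝ≥0} {α : ℝ}
  {s : ℝ → (Fin n → ℝ) → (Fin n → ℝ) → ℂ}

/-- The decay rate of the kernel weights between consecutive dyadic scales. -/
noncomputable def kernelRate (α : ℝ) : ℝ≥0 := (1 / 2 : ℝ≥0) ^ (α / 2)

/-- The decay rate of the interaction between consecutive dyadic levels. -/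
noncomputable def levelRate (α : ℝ) : ℝ≥0 := (2 / 3 : ℝ≥0) ^ (α / 2)

theorem kernelRate_lt_one (hα : 0 < α) : kernelRate α < 1 :=
  NNReal.rpow_lt_one (by rw [div_lt_one₀] <;> norm_num) (by positivity)

theorem levelRate_lt_one (hα : 0 < α) : levelRate α < 1 :=
  NNReal.rpow_lt_one (by rw [div_lt_one₀] <;> norm_num) (by positivity)

theorem levelRate_pos (α : ℝ) : 0 < levelRate α := NNReal.rpow_pos (by positivity)

theorem kernelRate_sq (α : ℝ) : kernelRate α ^ 2 = (1 / 2 : ℝ≥0) ^ α := by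
  rw [kernelRate, ← NNReal.rpow_natCast, ← NNReal.rpow_mul]; congr 1; push_cast; ring

theorem kernelRate_sq_le_levelRate (hα : 0 < α) : kernelRate α ^ 2 ≤ levelRate α := by
  rw [kernelRate, levelRate, sq, ← NNReal.mul_rpow]
  refine NNReal.rpow_le_rpow ?_ (by positivity)
  rw [← NNReal.coe_le_coe]; push_cast; norm_num

theorem tailOp_add {q : ℝ≥0} {t : ℝ} {g g' : (Fin n → ℝ) → ℝ≥0∞} (hg : Measurable g)
    (x : Fin n → ℝ) :
    tailOp μ D q t (fun y => g y + g' y) x = tailOp μ D q t g x + tailOp μ D q t g' x := by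
  unfold tailOp ballAverage
  rw [← ENNReal.tsum_add]
  refine tsum_congr fun k => ?_
  rw [lintegral_add_left hg, ENNReal.add_div, mul_add]

/-- A function with mean zero on the cells of level `k ≥ j` is almost annihilated by `θ_t` for `t`
of size comparable to the cells of level `j`. -/
theorem HasTailBound.enorm_theta_le_of_level (hs : HasTailBound μ D (kernelRate α) A α s)
    (hα : 0 < α) [IsLocallyFiniteMeasure μ] (hμ : μ ≠ 0) {τ L : ℝ} (hL : 0 < L) {j k : ℕ}
    (hjk : j ≤ k) {t : ℝ} (ht : t ∈ Ioc (L / 2 ^ (j + 1)) (L / 2 ^ j)) (x : Fin n → ℝ)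
    {h : (Fin n → ℝ) → ℂ} (hh : Measurable h) (hh2 : MemLp h 2 μ)
    (hmean : ∀ i, ∫ y in gridIdx τ L k ⁻¹' {i}, h y ∂μ = 0) :
    ‖theta μ s h t x‖ₑ ≤ (A * (2 ^ α * levelRate α ^ (k - j)) : ℝ≥0)
      * tailOp μ D (kernelRate α) t (fun y => ‖h y‖ₑ) x := by
  have ht0 : 0 < t := lt_of_le_of_lt (by positivity) ht.1
  have hq := kernelRate_lt_one hα
  rw [ENNReal.coe_mul, mul_assoc]
  obtain ⟨m, rfl⟩ := Nat.exists_eq_add_of_le hjk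
  rw [add_tsub_cancel_left]
  have hle : ((1 / 2 : ℝ≥0) ^ α) ^ m ≤ levelRate α ^ m := by
    rw [← kernelRate_sq]; gcongr; exact kernelRate_sq_le_levelRate hα
  -- The Hölder estimate needs cells of diameter below t/2, and t exceeds L/2^(j+1), so m ≥ 2 is
  -- required. For m < 2 the size bound suffices, the factor 2^α making the constant at least 1.
  rcases lt_or_ge m 2 with hm | hm
  · have h1 : (1 : ℝ≥0) ≤ 2 ^ α * levelRate α ^ m := by
      refine le_trans ?_ (mul_le_mul_right hle _)
      have e : (2 : ℝ≥0) ^ α * (1 / 2 : ℝ≥0) ^ α = 1 := by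
        rw [← NNReal.mul_rpow]; simp
      have h2 : (1 : ℝ≥0) ≤ 2 ^ α := NNReal.one_le_rpow one_le_two hα.le
      interval_cases m
      · simpa using h2
      · rw [pow_one, e]
    calc _ ≤ A * (1 * tailOp μ D (kernelRate α) t (fun y => ‖h y‖ₑ) x) := by
          rw [one_mul]; exact hs.enorm_theta_le hq ht0 x hh
      _ ≤ _ := by gcongr; exact_mod_cast h1
  · have hlt : L / 2 ^ (j + m) < t / 2 := by
      refine lt_of_le_of_lt ?_ (div_lt_div_of_pos_right ht.1 (by norm_num))
      rw [div_div, ← pow_succ]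
      exact div_le_div_of_nonneg_left hL.le (by positivity)
        (pow_le_pow_right₀ (by norm_num) (by omega))
    refine (hs.enorm_theta_le_of_mean_zero hq hα ht0 x hh
      (hs.integrable_of_memLp hq hμ ht0 x hh hh2) (measurable_gridIdx τ L (j + m))
      (fun i => hh2.integrableOn_two (measure_gridIdx_ne_top hL _ _)) hmean hlt
      (fun y z hyz => dist_le_of_gridIdx_eq hL hyz)).trans ?_
    gcongr
    have h1 : L / 2 ^ (j + m) / t ≤ 2 * (1 / 2) ^ m := by
      rw [div_le_iff₀ ht0]
      have := ht.1.le
      calc L / 2 ^ (j + m) = 2 * (1 / 2) ^ m * (L / 2 ^ (j + 1)) := by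
            rw [pow_add, pow_succ, one_div, inv_pow]; field_simp
        _ ≤ _ := by gcongr
    calc ENNReal.ofReal ((L / 2 ^ (j + m) / t) ^ α)
        ≤ ENNReal.ofReal ((2 * (1 / 2) ^ m) ^ α) := by gcongr
      _ = ((2 ^ α * ((1 / 2 : ℝ≥0) ^ α) ^ m : ℝ≥0) : ℝ≥0∞) := by
          rw [ENNReal.ofReal]
          congr 1
          rw [← NNReal.coe_inj, Real.coe_toNNReal _ (by positivity)]
          push_cast
          rw [Real.mul_rpow (by norm_num) (by positivity), ← Real.rpow_natCast, ← Real.rpow_mul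
            (by norm_num), mul_comm (m : ℝ), Real.rpow_mul (by norm_num), Real.rpow_natCast]
      _ ≤ _ := by gcongr

/-- At good points the part of `f` that is piecewise constant on a coarse level contributes
little, apart from its local value. -/
theorem HasTailBound.lintegral_coarse_le (hs : HasTailBound μ D (kernelRate α) A α s)
    (hα : 0 < α) {τ L η : ℝ} (hL : 0 < L) (hη : 0 < η) {j k : ℕ}
    (hkj : k ≤ j) {t : ℝ} (ht : t ∈ Ioc (L / 2 ^ (j + 1)) (L / 2 ^ j)) {x : Fin n → ℝ}
    (hx : x ∈ goodSet η τ L j)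
    {d : (Fin n → ℝ) → ℂ} (hd : Measurable d)
    (hconst : ∀ y, gridIdx τ L k y = gridIdx τ L k x → d y = d x) :
    ∫⁻ y, ‖s t x y‖ₑ * ‖d y - d x‖ₑ ∂μ
      ≤ (A * (η⁻¹.toNNReal ^ (α / 2) * levelRate α ^ (j - k)) : ℝ≥0)
        * (tailOp μ D (kernelRate α) t (fun y => ‖d y‖ₑ) x
          + ((1 - kernelRate α)⁻¹ : ℝ≥0) * ‖d x‖ₑ) := by
  have ht0 : 0 < t := lt_of_le_of_lt (by positivity) ht.1
  have hq := kernelRate_lt_one hα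
  set E : Set (Fin n → ℝ) := (gridIdx τ L k ⁻¹' {gridIdx τ L k x})ᶜ with hE
  have hEm : MeasurableSet E := (measurable_gridIdx τ L k (measurableSet_singleton _)).compl
  set κ : ℝ≥0 := η⁻¹.toNNReal ^ (α / 2) * levelRate α ^ (j - k) with hκdef
  -- The distance is η(3/2)^(j-k) L/2^j and t ≤ L/2^j. A ball of radius 2^m t reaching that far has
  -- 2^(-m) below η⁻¹(2/3)^(j-k); raise this to the power α/2.
  have hκ : ∀ m : ℕ, η * (3 / 4) ^ (j - k) * (L / 2 ^ k) < 2 ^ m * t → kernelRate α ^ m ≤ κ := by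
    intro m hm
    obtain ⟨i, rfl⟩ := Nat.exists_eq_add_of_le hkj
    rw [add_tsub_cancel_left] at hm hκdef
    have e1 : kernelRate α ^ m = ((1 / 2 : ℝ≥0) ^ m) ^ (α / 2) := by
      rw [kernelRate, ← NNReal.rpow_natCast, ← NNReal.rpow_mul, mul_comm, NNReal.rpow_mul,
        NNReal.rpow_natCast]
    have e2 : κ = (η⁻¹.toNNReal * (2 / 3 : ℝ≥0) ^ i) ^ (α / 2) := by
      rw [hκdef, levelRate, NNReal.mul_rpow, ← NNReal.rpow_natCast, ← NNReal.rpow_mul,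
        mul_comm (α / 2), NNReal.rpow_mul, NNReal.rpow_natCast]
    rw [e1, e2]
    refine NNReal.rpow_le_rpow ?_ (by positivity)
    rw [← NNReal.coe_le_coe]
    push_cast
    rw [Real.coe_toNNReal _ (by positivity)]
    have h1 : η * (3 / 4) ^ i * (L / 2 ^ k) < 2 ^ m * (L / 2 ^ (k + i)) :=
      hm.trans_le (by gcongr; exact ht.2)
    have h2 : η * (3 / 4) ^ i * 2 ^ i < 2 ^ m := by
      have e : 2 ^ m * (L / 2 ^ (k + i)) = 2 ^ m / 2 ^ i * (L / 2 ^ k) := by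
        rw [pow_add]; field_simp
      rw [e] at h1
      have h3 := lt_of_mul_lt_mul_right h1 (by positivity)
      rwa [lt_div_iff₀ (by positivity)] at h3
    have h4 : (3 / 4 : ℝ) ^ i * 2 ^ i = ((2 / 3) ^ i)⁻¹ := by
      rw [← mul_pow, ← inv_pow]; norm_num
    rw [mul_assoc, h4, ← div_eq_mul_inv, div_lt_iff₀ (by positivity)] at h2
    rw [one_div, inv_pow, inv_mul_eq_div, inv_eq_one_div, div_le_div_iff₀ (by positivity) hη]
    linarith
  calc ∫⁻ y, ‖s t x y‖ₑ * ‖d y - d x‖ₑ ∂μ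
      = ∫⁻ y in E, ‖s t x y‖ₑ * ‖d y - d x‖ₑ ∂μ := by
        rw [← lintegral_indicator hEm]
        refine lintegral_congr fun y => ?_
        by_cases hy : y ∈ E
        · rw [indicator_of_mem hy]
        · rw [indicator_of_notMem hy, hconst y (by simpa [hE] using hy), sub_self]
          simp
    _ ≤ ∫⁻ y in E, ‖s t x y‖ₑ * (‖d y‖ₑ + ‖d x‖ₑ * 1) ∂μ := by
        rw [mul_one]
        gcongr with y
        exact enorm_sub_le
    _ ≤ A * κ * tailOp μ D (kernelRate α) t (fun y => ‖d y‖ₑ + ‖d x‖ₑ * 1) x :=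
        hs.setLIntegral_enorm_mul_le ht0 hEm
          (fun y hy => le_dist_of_mem_goodSet hL hkj hx hy) hκ (hd.enorm.add_const _)
    _ ≤ _ := by
        rw [ENNReal.coe_mul A κ, tailOp_add hd.enorm]
        gcongr
        rw [show ‖d x‖ₑ = (‖d x‖₊ : ℝ≥0∞) from rfl, tailOp_const_mul, mul_comm]
        gcongr
        exact tailOp_one_le hq t x

end Decomposition

/-! ### Comparison of θ_t f with the local coefficient times θ_t b -/

section Pointwise

variable {n : ℕ} {μ : Measure (Fin n → ℝ)} {D A : ℝ≥0} {α : ℝ}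
  {s : ℝ → (Fin n → ℝ) → (Fin n → ℝ) → ℂ}

/-- The decomposition of `θ_t f - a_j(x) θ_t b` into a remainder, fine levels and a coarse part. -/
theorem theta_sub_eq_sum {t : ℝ} {x : Fin n → ℝ} {b f : (Fin n → ℝ) → ℂ}
    {a : ℕ → (Fin n → ℝ) → ℂ} (hf : Integrable (fun y => s t x y * f y) μ)
    (hb : Integrable (fun y => s t x y * b y) μ)
    (ha : ∀ k, Integrable (fun y => s t x y * (b y * a k y)) μ) (j N : ℕ) :
    theta μ s f t x - a j x * theta μ s b t x
      = theta μ s (fun y => f y - b y * a (j + N) y) t x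
        + ∑ m ∈ Finset.range N, theta μ s (fun y => b y * (a (j + m + 1) y - a (j + m) y)) t x
        + ∫ y, s t x y * (b y * (a j y - a j x)) ∂μ := by
  have e1 : theta μ s (fun y => f y - b y * a (j + N) y) t x
      = theta μ s f t x - ∫ y, s t x y * (b y * a (j + N) y) ∂μ := by
    simp only [theta, mul_sub]
    exact integral_sub hf (ha _)
  set I : ℕ → ℂ := fun i => ∫ y, s t x y * (b y * a (j + i) y) ∂μ with hI
  have e2 : ∀ m, theta μ s (fun y => b y * (a (j + m + 1) y - a (j + m) y)) t x
      = I (m + 1) - I m := fun m => by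
    simp only [theta, mul_sub, hI]
    exact integral_sub (ha _) (ha _)
  have e3 : ∫ y, s t x y * (b y * (a j y - a j x)) ∂μ
      = ∫ y, s t x y * (b y * a j y) ∂μ - a j x * theta μ s b t x := by
    simp only [mul_sub, theta]
    rw [integral_sub (ha j) (by simpa only [← mul_assoc] using hb.mul_const (a j x)),
      ← integral_const_mul]
    congr 2
    ext y
    ring
  rw [e1, e3, Finset.sum_congr rfl fun m _ => e2 m, Finset.sum_range_sub]
  simp only [hI, add_zero]
  ring

variable {τ L η : ℝ} {b f : (Fin n → ℝ) → ℂ} {B c : ℝ≥0}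

/-- The contribution of level `k` to the estimate at scale `j`. -/
noncomputable def levelTerm (μ : Measure (Fin n → ℝ)) (D : ℝ≥0) (α t : ℝ)
    (d : ℕ → (Fin n → ℝ) → ℂ) (x : Fin n → ℝ) (k : ℕ) : ℝ≥0∞ :=
  tailOp μ D (kernelRate α) t (fun y => ‖d k y‖ₑ) x + ‖d k x‖ₑ

/-- The coefficient a_j is the sum of the differences of levels k ≤ j, each constant on the level-k
cell of x; `lintegral_coarse_le` applies to each. -/
theorem HasTailBound.enorm_coarse_le (hs : HasTailBound μ D (kernelRate α) A α s)
    (hα : 0 < α) (hL : 0 < L) (hη : 0 < η) (hB : ∀ x, ‖b x‖ₑ ≤ B) {j : ℕ}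
    {t : ℝ} (ht : t ∈ Ioc (L / 2 ^ (j + 1)) (L / 2 ^ j)) {x : Fin n → ℝ}
    (hx : x ∈ goodSet η τ L j) :
    ‖∫ y, s t x y * (b y * (adaptedCoeff μ (gridIdx τ L j) b f y
        - adaptedCoeff μ (gridIdx τ L j) b f x)) ∂μ‖ₑ
      ≤ (A * B * (η⁻¹.toNNReal ^ (α / 2) * (1 - kernelRate α)⁻¹) : ℝ≥0)
        * ∑ k ∈ Finset.range (j + 1), (levelRate α : ℝ≥0∞) ^ ((j - k) + (k - j))
          * levelTerm μ D α t (adaptedDiff μ (gridIdx τ L) b f) x k := by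
  set d := adaptedDiff μ (gridIdx τ L) b f with hd
  have hdm : ∀ k, Measurable (d k) := measurable_adaptedDiff (measurable_gridIdx τ L) b f
  have hconst : ∀ k y, gridIdx τ L k y = gridIdx τ L k x → d k y = d k x := by
    intro k y hy
    cases k with
    | zero => exact adaptedCoeff_congr_fiber b f hy
    | succ k =>
      simp only [hd, adaptedDiff]
      rw [adaptedCoeff_congr_fiber b f hy, adaptedCoeff_congr_fiber b f (gridIdx_refine k hy)]
  have hq1 : (1 : ℝ≥0) ≤ (1 - kernelRate α)⁻¹ :=
    (one_le_inv₀ (tsub_pos_of_lt (kernelRate_lt_one hα))).2 tsub_le_self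
  have hsm := hs.measurable_right t x
  calc _ ≤ ∫⁻ y, ∑ k ∈ Finset.range (j + 1), B * (‖s t x y‖ₑ * ‖d k y - d k x‖ₑ) ∂μ := by
        refine (enorm_integral_le_lintegral_enorm _).trans (lintegral_mono fun y => ?_)
        rw [← sum_adaptedDiff, ← sum_adaptedDiff, ← Finset.sum_sub_distrib, enorm_mul, enorm_mul,
          ← Finset.mul_sum, ← Finset.mul_sum, mul_left_comm]
        gcongr
        · exact hB y
        · exact enorm_sum_le _ _
    _ = ∑ k ∈ Finset.range (j + 1), B * ∫⁻ y, ‖s t x y‖ₑ * ‖d k y - d k x‖ₑ ∂μ := by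
        rw [lintegral_finsetSum _ fun k _ =>
          (show Measurable fun y => ‖s t x y‖ₑ * ‖d k y - d k x‖ₑ from
            hsm.enorm.mul ((hdm k).sub_const _).enorm).const_mul _]
        exact Finset.sum_congr rfl fun k _ => lintegral_const_mul' _ _ ENNReal.coe_ne_top
    _ ≤ ∑ k ∈ Finset.range (j + 1), B * ((A * (η⁻¹.toNNReal ^ (α / 2) * levelRate α ^ (j - k))
          : ℝ≥0) * (((1 - kernelRate α)⁻¹ : ℝ≥0) * levelTerm μ D α t d x k)) := by
        refine Finset.sum_le_sum fun k hk => ?_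
        gcongr
        refine (hs.lintegral_coarse_le hα hL hη (by simpa [Nat.lt_succ_iff] using hk) ht hx
          (hdm k) (hconst k)).trans ?_
        gcongr
        rw [levelTerm, mul_add]
        gcongr
        exact le_mul_of_one_le_left' (by exact_mod_cast hq1)
    _ = _ := by
        rw [Finset.mul_sum]
        refine Finset.sum_congr rfl fun k hk => ?_
        have : k - j = 0 := by simp at hk; omega
        rw [this, add_zero]
        push_cast
        ring

/-- The difference of index k + 1 cancels only on cells of level k. The decay is thus one power
short of the one displayed, whence the inverse of `levelRate` in the constant. -/
theorem HasTailBound.enorm_fine_le (hs : HasTailBound μ D (kernelRate α) A α s)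
    (hα : 0 < α) [IsLocallyFiniteMeasure μ] (hμ : μ ≠ 0) (hL : 0 < L) (hb : Measurable b)
    (hB : ∀ x, ‖b x‖ₑ ≤ B) (hacc : ∀ k, IsAccretiveOn μ (gridIdx τ L k) b c) (hc : 0 < c)
    (hf2 : MemLp f 2 μ) {j : ℕ}
    {t : ℝ} (ht : t ∈ Ioc (L / 2 ^ (j + 1)) (L / 2 ^ j)) (x : Fin n → ℝ) (m : ℕ) :
    ‖theta μ s (fun y => b y * (adaptedCoeff μ (gridIdx τ L (j + m + 1)) b f y
        - adaptedCoeff μ (gridIdx τ L (j + m)) b f y)) t x‖ₑ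
      ≤ (A * B * (2 ^ α * (levelRate α)⁻¹) : ℝ≥0)
        * ((levelRate α : ℝ≥0∞) ^ ((j - (m + (j + 1))) + ((m + (j + 1)) - j))
          * levelTerm μ D α t (adaptedDiff μ (gridIdx τ L) b f) x (m + (j + 1))) := by
  have hπ := measurable_gridIdx (n := n) τ L
  have hfin : ∀ k i, μ (gridIdx τ L k ⁻¹' {i}) ≠ ∞ := fun k i => measure_gridIdx_ne_top hL k i
  set a : ℕ → (Fin n → ℝ) → ℂ := fun k => adaptedCoeff μ (gridIdx τ L k) b f with ha
  have ham : ∀ k, Measurable (a k) := fun k => measurable_adaptedCoeff (hπ k) b f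
  have hba : ∀ k, MemLp (fun y => b y * a k y) 2 μ := fun k =>
    (memLp_mul_adaptedCoeff (hπ k) (hfin k) hb hB (hacc k) hc hf2).1
  have hrw : (fun y => b y * (a (j + m + 1) y - a (j + m) y))
      = fun y => b y * a (j + m + 1) y - b y * a (j + m) y := by ext y; ring
  have hmean : ∀ i, ∫ y in gridIdx τ L (j + m) ⁻¹' {i},
      b y * (a (j + m + 1) y - a (j + m) y) ∂μ = 0 := fun i => by
    simp only [hrw]
    rw [integral_sub ((hba _).integrableOn_two (hfin _ _)) ((hba _).integrableOn_two (hfin _ _)),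
      setIntegral_mul_adaptedCoeff (hπ _) (hπ _) (hfin _) (hfin _)
        (fun x y h => gridIdx_refine _ h) hb hB (hacc _) hc hf2,
      setIntegral_mul_adaptedCoeff (hπ _) (hπ _) (hfin _) (hfin _)
        (fun x y h => h) hb hB (hacc _) hc hf2, sub_self]
  have hmem : MemLp (fun y => b y * (a (j + m + 1) y - a (j + m) y)) 2 μ := by
    rw [hrw]
    exact (hba (j + m + 1)).sub (hba (j + m))
  have h := hs.enorm_theta_le_of_level hα hμ hL (Nat.le_add_right j m) ht x
    (hb.mul ((ham (j + m + 1)).sub (ham (j + m)))) hmem hmean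
  refine h.trans ?_
  have hd : ∀ y, a (j + m + 1) y - a (j + m) y
      = adaptedDiff μ (gridIdx τ L) b f (m + (j + 1)) y := fun y => by
    have : m + (j + 1) = (j + m) + 1 := by ring
    rw [this]
    rfl
  have hexp : (j - (m + (j + 1))) + ((m + (j + 1)) - j) = m + 1 := by omega
  rw [add_tsub_cancel_left, hexp]
  have hr := (levelRate_pos α).ne'
  calc _ ≤ ((A * (2 ^ α * levelRate α ^ m) : ℝ≥0) : ℝ≥0∞)
        * (B * levelTerm μ D α t (adaptedDiff μ (gridIdx τ L) b f) x (m + (j + 1))) := by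
        gcongr
        refine le_trans ?_ (mul_le_mul_right le_self_add _)
        rw [← tailOp_const_mul]
        refine tailOp_mono (fun y => ?_) x
        simp only [Pi.mul_apply, Pi.sub_apply, hd, enorm_mul]
        gcongr
        exact hB y
    _ = _ := by
        have : A * (2 ^ α * levelRate α ^ m) * B
            = A * B * (2 ^ α * (levelRate α)⁻¹) * levelRate α ^ (m + 1) := by
          field_simp
          ring
        rw [← mul_assoc, ← ENNReal.coe_mul, this, ENNReal.coe_mul, ENNReal.coe_pow, mul_assoc]

/-- The remainder has mean zero on cells of level j + N and L² norm bounded independently of N. So M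
may depend on x and t but not on N, which is enough to let N → ∞ at a fixed point. -/
theorem HasTailBound.enorm_remainder_le (hs : HasTailBound μ D (kernelRate α) A α s)
    (hα : 0 < α) [IsLocallyFiniteMeasure μ] (hμ : μ ≠ 0) (hL : 0 < L) (hb : Measurable b)
    (hB : ∀ x, ‖b x‖ₑ ≤ B) (hacc : ∀ k, IsAccretiveOn μ (gridIdx τ L k) b c) (hc : 0 < c)
    (hf : Measurable f) (hf2 : MemLp f 2 μ) {j : ℕ}
    {t : ℝ} (ht : t ∈ Ioc (L / 2 ^ (j + 1)) (L / 2 ^ j)) (x : Fin n → ℝ) :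
    ∃ M : ℝ≥0∞, M ≠ ∞ ∧ ∀ N,
      ‖theta μ s (fun y => f y - b y * adaptedCoeff μ (gridIdx τ L (j + N)) b f y) t x‖ₑ
        ≤ (levelRate α : ℝ≥0∞) ^ N * M := by
  have ht0 : 0 < t := lt_of_le_of_lt (by positivity) ht.1
  have hπ := measurable_gridIdx (n := n) τ L
  have hfin : ∀ k i, μ (gridIdx τ L k ⁻¹' {i}) ≠ ∞ := fun k i => measure_gridIdx_ne_top hL k i
  set a : ℕ → (Fin n → ℝ) → ℂ := fun k => adaptedCoeff μ (gridIdx τ L k) b f with ha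
  have ham : ∀ k, Measurable (a k) := fun k => measurable_adaptedCoeff (hπ k) b f
  have hba : ∀ k, MemLp (fun y => b y * a k y) 2 μ ∧ _ := fun k =>
    memLp_mul_adaptedCoeff (hπ k) (hfin k) hb hB (hacc k) hc hf2
  set S := ∫⁻ y, ‖f y‖ₑ ^ 2 ∂μ with hS
  have hSt : S ≠ ∞ := ((memLp_two_iff_lintegral hf2.1).1 hf2).ne
  set T : ℝ≥0∞ := 2 * S + 2 * ((B ^ 2 * c⁻¹ ^ 2 : ℝ≥0) * S) with hT
  have hTt : T ≠ ∞ := by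
    rw [hT]
    exact ENNReal.add_ne_top.2 ⟨ENNReal.mul_ne_top (by simp) hSt,
      ENNReal.mul_ne_top (by simp) (ENNReal.mul_ne_top ENNReal.coe_ne_top hSt)⟩
  refine ⟨(A * 2 ^ α : ℝ≥0) * (((1 - kernelRate α)⁻¹ : ℝ≥0) * (1 + T / dyadicMajorant μ D x t)),
    ENNReal.mul_ne_top ENNReal.coe_ne_top (ENNReal.mul_ne_top ENNReal.coe_ne_top
      (ENNReal.add_ne_top.2 ⟨by simp, ENNReal.div_ne_top hTt (dyadicMajorant_ne_zero hμ x ht0)⟩)),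
    fun N => ?_⟩
  have hm : Measurable fun y => f y - b y * a (j + N) y := hf.sub (hb.mul (ham _))
  have hmem : MemLp (fun y => f y - b y * a (j + N) y) 2 μ := hf2.sub (hba _).1
  have hmean : ∀ i, ∫ y in gridIdx τ L (j + N) ⁻¹' {i}, f y - b y * a (j + N) y ∂μ = 0 :=
    fun i => by
      rw [integral_sub (hf2.integrableOn_two (hfin _ _)) ((hba _).1.integrableOn_two (hfin _ _)),
        setIntegral_mul_adaptedCoeff (hπ _) (hπ _) (hfin _) (hfin _)
          (fun x y h => h) hb hB (hacc _) hc hf2, sub_self]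
  have h := hs.enorm_theta_le_of_level hα hμ hL (Nat.le_add_right j N) ht x hm hmem hmean
  rw [add_tsub_cancel_left] at h
  have hsq : ∫⁻ y, ‖f y - b y * a (j + N) y‖ₑ ^ 2 ∂μ ≤ T := by
    calc _ ≤ ∫⁻ y, (2 * ‖f y‖ₑ ^ 2 + 2 * ‖b y * a (j + N) y‖ₑ ^ 2) ∂μ :=
          lintegral_mono fun y => (pow_le_pow_left' enorm_sub_le 2).trans (ENNReal.add_sq_le _ _)
      _ = 2 * S + 2 * ∫⁻ y, ‖b y * a (j + N) y‖ₑ ^ 2 ∂μ := by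
          rw [lintegral_add_left ((hf.enorm.pow_const 2).const_mul 2),
            lintegral_const_mul' _ _ (by simp), lintegral_const_mul' _ _ (by simp)]
      _ ≤ T := by rw [hT]; gcongr; exact (hba (j + N)).2
  calc _ ≤ _ := h
    _ ≤ (A * (2 ^ α * levelRate α ^ N) : ℝ≥0)
        * (((1 - kernelRate α)⁻¹ : ℝ≥0) * (1 + T / dyadicMajorant μ D x t)) := by
        gcongr
        refine (tailOp_le_of_sq_integrable (kernelRate_lt_one hα) ht0 hm.enorm.aemeasurable
          x).trans ?_
        gcongr
    _ = _ := by push_cast; ring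

/-- At good points, `θ_t f` is the local coefficient of `f` times `θ_t b`, up to a sum over all
levels with geometric decay away from the scale `t`. -/
theorem HasTailBound.enorm_theta_sub_le (hs : HasTailBound μ D (kernelRate α) A α s)
    (hα : 0 < α) [IsLocallyFiniteMeasure μ] (hμ : μ ≠ 0) (hL : 0 < L) (hη : 0 < η)
    (hb : Measurable b)
    (hB : ∀ x, ‖b x‖ₑ ≤ B) (hacc : ∀ k, IsAccretiveOn μ (gridIdx τ L k) b c) (hc : 0 < c)
    (hf : Measurable f) (hf2 : MemLp f 2 μ) {j : ℕ}
    {t : ℝ} (ht : t ∈ Ioc (L / 2 ^ (j + 1)) (L / 2 ^ j)) {x : Fin n → ℝ}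
    (hx : x ∈ goodSet η τ L j) :
    ‖theta μ s f t x - adaptedCoeff μ (gridIdx τ L j) b f x * theta μ s b t x‖ₑ
      ≤ (A * B * (2 ^ α * (levelRate α)⁻¹ + η⁻¹.toNNReal ^ (α / 2) * (1 - kernelRate α)⁻¹) : ℝ≥0)
        * ∑' k, (levelRate α : ℝ≥0∞) ^ ((j - k) + (k - j))
          * levelTerm μ D α t (adaptedDiff μ (gridIdx τ L) b f) x k := by
  have ht0 : 0 < t := lt_of_le_of_lt (by positivity) ht.1
  have hq := kernelRate_lt_one hα
  have hπ := measurable_gridIdx (n := n) τ L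
  obtain ⟨M, hM, hrem⟩ := hs.enorm_remainder_le hα hμ hL hb hB hacc hc hf hf2 ht x
  set g : ℕ → ℝ≥0∞ := fun k => (levelRate α : ℝ≥0∞) ^ ((j - k) + (k - j))
          * levelTerm μ D α t (adaptedDiff μ (gridIdx τ L) b f) x k with hg
  have hsplit : ∑ k ∈ Finset.range (j + 1), g k + ∑' m, g (m + (j + 1)) = ∑' k, g k :=
    ENNReal.summable.sum_add_tsum_nat_add' 
  set K₁ : ℝ≥0 := A * B * (2 ^ α * (levelRate α)⁻¹) with hK1
  set K₂ : ℝ≥0 := A * B * (η⁻¹.toNNReal ^ (α / 2) * (1 - kernelRate α)⁻¹) with hK2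
  have hK : A * B * (2 ^ α * (levelRate α)⁻¹ + η⁻¹.toNNReal ^ (α / 2) * (1 - kernelRate α)⁻¹)
      = K₁ + K₂ := by rw [hK1, hK2]; ring
  rw [hK, ENNReal.coe_add]
  have hN : ∀ N, ‖theta μ s f t x - adaptedCoeff μ (gridIdx τ L j) b f x * theta μ s b t x‖ₑ
      ≤ (levelRate α : ℝ≥0∞) ^ N * M + (K₁ + K₂) * ∑' k, g k := by
    intro N
    rw [theta_sub_eq_sum (a := fun k => adaptedCoeff μ (gridIdx τ L k) b f)
      (hs.integrable_of_memLp hq hμ ht0 x hf hf2)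
      (hs.integrable_of_bounded hq ht0 x hb hB)
      (fun k => hs.integrable_of_memLp hq hμ ht0 x (hb.mul (measurable_adaptedCoeff (hπ k) b f))
        (memLp_mul_adaptedCoeff (hπ k) (fun i => measure_gridIdx_ne_top hL k i) hb hB (hacc k)
          hc hf2).1) j N]
    refine (enorm_add_le _ _).trans ((add_le_add_left (enorm_add_le _ _) _).trans ?_)
    rw [add_assoc]
    refine add_le_add (hrem N) ?_
    calc _ ≤ K₁ * ∑' m, g (m + (j + 1)) + K₂ * ∑ k ∈ Finset.range (j + 1), g k := by
          refine add_le_add ?_ (hs.enorm_coarse_le hα hL hη hB ht hx)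
          refine (enorm_sum_le _ _).trans ?_
          rw [← ENNReal.tsum_mul_left]
          refine (Finset.sum_le_sum fun m _ => ?_).trans (ENNReal.sum_le_tsum (Finset.range N))
          exact hs.enorm_fine_le hα hμ hL hb hB hacc hc hf2 ht x m
      _ ≤ K₁ * ∑' k, g k + K₂ * ∑' k, g k := by
          rw [← hsplit]
          gcongr
          · exact le_add_self
          · exact le_self_add
      _ = _ := by ring
  have hlim : Filter.Tendsto
      (fun N : ℕ => (levelRate α : ℝ≥0∞) ^ N * M + (K₁ + K₂) * ∑' k, g k) Filter.atTop
      (nhds (0 * M + (K₁ + K₂) * ∑' k, g k)) := by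
    refine Filter.Tendsto.add ?_ tendsto_const_nhds
    exact ENNReal.Tendsto.mul_const (ENNReal.tendsto_pow_atTop_nhds_zero_of_lt_one
      (by exact_mod_cast levelRate_lt_one hα)) (Or.inr hM)
  rw [zero_mul, zero_add] at hlim
  exact ge_of_tendsto' hlim hN

end Pointwise

/-! ### Whitney decomposition: from μ(3Q) to μ(Q) -/

section Whitney

variable {n : ℕ}

theorem measurableSet_cube (a : Fin n → ℝ) (l : ℝ) : MeasurableSet (cube a l) := by
  have : cube a l = Set.pi univ fun i => Ico (a i) (a i + l) := by
    ext x; simp [cube, mem_pi]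
  rw [this]
  exact MeasurableSet.univ_pi fun i => measurableSet_Ico

theorem infDist_compl_cube_le (hn : 1 ≤ n) {a : Fin n → ℝ} {l : ℝ} {x : Fin n → ℝ}
    (hx : x ∈ cube a l) : Metric.infDist x (cube a l)ᶜ ≤ l := by
  set i₀ : Fin n := ⟨0, hn⟩
  have hl := hx i₀
  have hy : Function.update x i₀ (a i₀ + l) ∈ (cube a l)ᶜ := by
    intro h
    have := (h i₀).2
    simp at this
  refine (Metric.infDist_le_dist_of_mem hy).trans ?_
  have hl0 : 0 ≤ l := by linarith [hl.1, hl.2]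
  rw [dist_pi_le_iff hl0]
  intro i
  by_cases hi : i = i₀
  · subst hi
    rw [Function.update_self, Real.dist_eq, abs_le]
    constructor <;> linarith [hl.1, hl.2]
  · rw [Function.update_of_ne hi, dist_self]
    exact hl0

theorem compl_cube_nonempty (hn : 1 ≤ n) (a : Fin n → ℝ) (l : ℝ) : (cube a l)ᶜ.Nonempty := by
  refine ⟨fun i => a i + l, fun h => ?_⟩
  have := (h ⟨0, hn⟩).2
  simp at this

/-- In each coordinate only three consecutive indices give triples containing a given point, so the
overlap is at most 3^n. -/
theorem tsum_measure_triple_inter_le {μ : Measure (Fin n → ℝ)} {τ p : ℝ} (hp : 0 < p)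
    {S : Set (Fin n → ℝ)} :
    ∑' m : Fin n → ℤ, μ (cube (fun j => τ + m j * p - p) (3 * p) ∩ S) ≤ 3 ^ n * μ S := by
  have hm : ∀ m : Fin n → ℤ, MeasurableSet (cube (fun j => τ + m j * p - p) (3 * p)) :=
    fun m => measurableSet_cube _ _
  have h1 : ∀ m : Fin n → ℤ, μ (cube (fun j => τ + m j * p - p) (3 * p) ∩ S)
      = ∫⁻ y in S, (cube (fun j => τ + m j * p - p) (3 * p)).indicator (fun _ => 1) y ∂μ :=
    fun m => by
      rw [lintegral_indicator (hm m), lintegral_one, Measure.restrict_apply_univ,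
        Measure.restrict_apply (hm m)]
  simp_rw [h1]
  rw [← lintegral_tsum fun m => (measurable_const.indicator (hm m)).aemeasurable]
  calc _ ≤ ∫⁻ _ in S, 3 ^ n ∂μ := by
        refine lintegral_mono fun y => ?_
        set T : Finset (Fin n → ℤ) := Fintype.piFinset fun j =>
          Finset.Icc (⌊(y j - τ) / p⌋ - 1) (⌊(y j - τ) / p⌋ + 1) with hT
        rw [tsum_eq_sum (s := T)]
        · refine (Finset.sum_le_card_nsmul T _ 1 fun m _ => ?_).trans ?_
          · exact indicator_le_self' (fun _ _ => zero_le) y |>.trans le_rfl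
          · rw [hT, Fintype.card_piFinset]
            simp only [Int.card_Icc]
            have : ∀ a : ℤ, (a + 1 + 1 - (a - 1)).toNat = 3 := fun a => by
              have : a + 1 + 1 - (a - 1) = 3 := by ring
              rw [this]; rfl
            simp [this]
        · intro m hmT
          refine indicator_of_notMem (fun hy => hmT ?_) _
          rw [hT, Fintype.mem_piFinset]
          intro j
          obtain ⟨h1, h2⟩ := hy j
          rw [Finset.mem_Icc]
          have hz : (y j - τ) / p * p = y j - τ := by field_simp
          have hf1 := Int.floor_le ((y j - τ) / p)
          have hf2 := Int.lt_floor_add_one ((y j - τ) / p)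
          constructor
          · have : (⌊(y j - τ) / p⌋ : ℝ) < m j + 2 := by
              refine lt_of_mul_lt_mul_right ?_ hp.le
              nlinarith
            have : ⌊(y j - τ) / p⌋ < m j + 2 := by exact_mod_cast this
            omega
          · have : (m j : ℝ) - 1 < ⌊(y j - τ) / p⌋ + 1 := by
              refine lt_of_mul_lt_mul_right ?_ hp.le
              nlinarith
            have : m j - 1 < ⌊(y j - τ) / p⌋ + 1 := by exact_mod_cast this
            omega
    _ = _ := by rw [setLIntegral_const]

theorem dist_le_of_mem_triple {a : Fin n → ℝ} {p : ℝ} (hp : 0 < p) {x y : Fin n → ℝ}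
    (hx : x ∈ cube a p) (hy : y ∈ cube (fun i => a i - p) (3 * p)) : dist x y ≤ 2 * p := by
  rw [dist_pi_le_iff (by positivity)]
  intro i
  obtain ⟨h1, h2⟩ := hx i
  obtain ⟨h3, h4⟩ := hy i
  rw [Real.dist_eq, abs_le]
  constructor <;> linarith

/-- The points whose distance to the complement of `Q` is about `l / 2 ^ i`. -/
def shell (Q : Set (Fin n → ℝ)) (l : ℝ) (i : ℕ) : Set (Fin n → ℝ) :=
  {y | l / 2 ^ (i + 2) < Metric.infDist y Qᶜ ∧ Metric.infDist y Qᶜ ≤ 2 * (l / 2 ^ i)}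

theorem measurableSet_shell (Q : Set (Fin n → ℝ)) (l : ℝ) (i : ℕ) :
    MeasurableSet (shell Q l i) :=
  (measurableSet_lt measurable_const (Metric.continuous_infDist_pt _).measurable).inter
    (measurableSet_le (Metric.continuous_infDist_pt _).measurable measurable_const)

/-- A shell is a half-open window of ratio 8 in the distance to the complement, so a point lies in
at most three shells. A positive distance also forces the point into Q. -/
theorem tsum_measure_shell_le {μ : Measure (Fin n → ℝ)} {Q : Set (Fin n → ℝ)}
    (hQ : MeasurableSet Q) {l : ℝ}
    (hl : 0 < l) : ∑' i, μ (shell Q l i) ≤ 3 * μ Q := by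
  have hm := measurableSet_shell Q l
  have h1 : ∀ i, μ (shell Q l i) = ∫⁻ y, (shell Q l i).indicator (fun _ => 1) y ∂μ := fun i => by
    rw [lintegral_indicator (hm i), lintegral_one, Measure.restrict_apply_univ]
  simp_rw [h1]
  rw [← lintegral_tsum fun m => (measurable_const.indicator (hm m)).aemeasurable,
    ← setLIntegral_const, ← lintegral_indicator hQ]
  refine lintegral_mono fun y => ?_
  by_cases hex : ∃ i, y ∈ shell Q l i
  · classical
    set i₀ := Nat.find hex
    have h0 : y ∈ shell Q l i₀ := Nat.find_spec hex
    have hyQ : y ∈ Q := by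
      by_contra h
      have : Metric.infDist y Qᶜ = 0 := Metric.infDist_zero_of_mem h
      have h2 := h0.1
      rw [this] at h2
      have : 0 < l / 2 ^ (i₀ + 2) := by positivity
      linarith
    rw [indicator_of_mem hyQ, tsum_eq_sum (s := Finset.Ico i₀ (i₀ + 3))]
    · refine (Finset.sum_le_card_nsmul _ _ 1 fun m _ => ?_).trans ?_
      · exact indicator_le_self' (fun _ _ => zero_le) y |>.trans le_rfl
      · simp
    · intro i hi
      refine indicator_of_notMem (fun hy => hi ?_) _
      rw [Finset.mem_Ico]
      refine ⟨Nat.find_min' hex hy, ?_⟩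
      by_contra hge
      rw [not_lt] at hge
      have h2 : l / 2 ^ (i₀ + 2) < 2 * (l / 2 ^ i) := h0.1.trans_le hy.2
      have h3 : l / 2 ^ i ≤ l / 2 ^ (i₀ + 3) :=
        div_le_div_of_nonneg_left hl.le (by positivity) (pow_le_pow_right₀ (by norm_num) hge)
      have h4 : 2 * (l / 2 ^ (i₀ + 3)) = l / 2 ^ (i₀ + 2) := by
        rw [pow_succ _ (i₀ + 2)]; field_simp
      linarith
  · rw [ENNReal.tsum_eq_zero.2 fun i => indicator_of_notMem (fun h => hex ⟨i, h⟩) _]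
    exact zero_le

/-- A Carleson condition with `μ (3Q)` on the right improves to `μ Q` away from the boundary. -/
theorem setLIntegral_whitney_le (hn : 1 ≤ n) {μ : Measure (Fin n → ℝ)} [SFinite μ]
    {G : ℝ × (Fin n → ℝ) → ℝ≥0∞} (hG : Measurable G) {C : ℝ≥0}
    (hcar : ∀ (a : Fin n → ℝ) (l : ℝ), 0 < l →
      ∫⁻ t in Ioo 0 l, ∫⁻ x in cube a l, G (t, x) ∂μ
        ≤ C * μ (cube (fun i => a i - l) (3 * l)))
    (a : Fin n → ℝ) {l : ℝ} (hl : 0 < l) :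
    ∫⁻ x in cube a l, (∫⁻ t in Ioo 0 (Metric.infDist x (cube a l)ᶜ / 8), G (t, x)) ∂μ
      ≤ (3 * 3 ^ n * C : ℝ≥0) * μ (cube a l) := by
  set Q := cube a l with hQ
  set d : (Fin n → ℝ) → ℝ := fun x => Metric.infDist x Qᶜ with hd
  -- The layers are disjoint, while the shells are slightly wider. On layer i only t < p_i =
  -- l/2^(i+3) occurs, so the hypothesis can be applied to cubes P of sidelength p_i.
  set S : ℕ → Set (Fin n → ℝ) := fun i => {x | l / 2 ^ (i + 1) < d x ∧ d x ≤ l / 2 ^ i} with hS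
  have hSm : ∀ i, MeasurableSet (S i) := fun i =>
    (measurableSet_lt measurable_const (Metric.continuous_infDist_pt _).measurable).inter
      (measurableSet_le (Metric.continuous_infDist_pt _).measurable measurable_const)
  set p : ℕ → ℝ := fun i => l / 2 ^ (i + 3) with hp
  have hpp : ∀ i, 0 < p i := fun i => by positivity
  set H : ℕ → (Fin n → ℝ) → ℝ≥0∞ := fun i x => ∫⁻ t in Ioo 0 (p i), G (t, x) with hH
  have hHm : ∀ i, Measurable (H i) := fun i => hG.lintegral_prod_left'
  have hV : ∀ x ∈ Q, ∫⁻ t in Ioo 0 (d x / 8), G (t, x) ≤ ∑' i, (S i).indicator (H i) x := by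
    intro x hx
    by_cases h0 : d x = 0
    · simp [h0]
    have hpos : 0 < d x := lt_of_le_of_ne Metric.infDist_nonneg (Ne.symm h0)
    have hle : d x ≤ l := infDist_compl_cube_le hn hx
    obtain ⟨i, hi1, hi2⟩ := exists_nat_pow_near_of_lt_one (x := d x / l) (y := 1 / 2)
      (by positivity) ((div_le_one hl).2 hle) (by norm_num) (by norm_num)
    rw [lt_div_iff₀ hl, one_div, inv_pow, inv_mul_eq_div] at hi1
    rw [div_le_iff₀ hl, one_div, inv_pow, inv_mul_eq_div] at hi2
    refine le_trans ?_ (ENNReal.le_tsum i)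
    rw [indicator_of_mem (show x ∈ S i from ⟨hi1, hi2⟩)]
    refine lintegral_mono_set (Ioo_subset_Ioo_right ?_)
    calc d x / 8 ≤ l / 2 ^ i / 8 := by gcongr
      _ = p i := by simp only [hp, pow_add]; field_simp; norm_num
  have hi : ∀ i, ∫⁻ x, (S i).indicator (H i) x ∂μ ≤ (3 ^ n * C : ℝ≥0) * μ (shell Q l i) := by
    intro i
    set π := gridIdx (n := n) 0 (p i) 0 with hπ
    have hpre : ∀ m, π ⁻¹' {m} = cube (fun j => 0 + m j * p i) (p i) := fun m => by
      have := gridIdx_preimage (τ := 0) (hpp i) 0 m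
      simpa using this
    rw [lintegral_eq_tsum_fiber μ (measurable_gridIdx 0 (p i) 0)]
    calc _ ≤ ∑' m : Fin n → ℤ,
          C * μ (cube (fun j => 0 + m j * p i - p i) (3 * p i) ∩ shell Q l i) := by
          refine ENNReal.tsum_le_tsum fun m => ?_
          rw [← hπ, hpre]
          by_cases hne : ∃ x ∈ cube (fun j => 0 + m j * p i) (p i), x ∈ S i
          · obtain ⟨x, hxP, hxS⟩ := hne
            -- Points of P ∩ S_i have distance in (4p_i, 8p_i] from the complement. Moving within 3P
            -- changes it by at most 2p_i, which stays within the shell (2p_i, 16p_i].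
            have hsub : cube (fun j => 0 + m j * p i - p i) (3 * p i) ⊆ shell Q l i := by
              intro y hy
              have hxy := dist_le_of_mem_triple (hpp i) hxP hy
              have h1 : d x ≤ d y + dist x y := Metric.infDist_le_infDist_add_dist
              have h2 : d y ≤ d x + dist y x := Metric.infDist_le_infDist_add_dist
              rw [dist_comm] at h2
              have e1 : l / 2 ^ (i + 1) = 4 * p i := by
                simp only [hp, pow_add]; field_simp; norm_num
              have e2 : l / 2 ^ (i + 2) = 2 * p i := by
                simp only [hp, pow_add]; field_simp
              have e3 : l / 2 ^ i = 8 * p i := by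
                simp only [hp, pow_add]; field_simp; norm_num
              have hS1 := hxS.1
              have hS2 := hxS.2
              have := hpp i
              exact ⟨by rw [e2]; linarith, by rw [e3]; linarith⟩
            rw [inter_eq_left.2 hsub]
            calc _ ≤ ∫⁻ x in cube (fun j => 0 + m j * p i) (p i), H i x ∂μ :=
                  lintegral_mono fun x => indicator_le_self _ _ x
              _ = ∫⁻ t in Ioo 0 (p i), ∫⁻ x in cube (fun j => 0 + m j * p i) (p i), G (t, x) ∂μ :=
                  lintegral_lintegral_swap (f := fun x t => G (t, x))
                    (hG.comp measurable_swap).aemeasurable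
              _ ≤ _ := hcar _ _ (hpp i)
          · refine le_of_eq_of_le ?_ zero_le
            rw [setLIntegral_congr_fun (g := fun _ => 0) (measurableSet_cube _ _) fun x hx =>
              indicator_of_notMem (fun h => hne ⟨x, hx, h⟩) _]
            simp
      _ ≤ C * (3 ^ n * μ (shell Q l i)) := by
          rw [ENNReal.tsum_mul_left]
          gcongr
          exact tsum_measure_triple_inter_le (hpp i)
      _ = _ := by push_cast; ring
  calc _ ≤ ∫⁻ x in Q, ∑' i, (S i).indicator (H i) x ∂μ :=
        setLIntegral_mono' (measurableSet_cube _ _) hV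
    _ ≤ ∫⁻ x, ∑' i, (S i).indicator (H i) x ∂μ := setLIntegral_le_lintegral _ _
    _ = ∑' i, ∫⁻ x, (S i).indicator (H i) x ∂μ :=
        lintegral_tsum fun i => ((hHm i).indicator (hSm i)).aemeasurable
    _ ≤ ∑' i, (3 ^ n * C : ℝ≥0) * μ (shell Q l i) := ENNReal.tsum_le_tsum hi
    _ ≤ (3 ^ n * C : ℝ≥0) * (3 * μ Q) := by
        rw [ENNReal.tsum_mul_left]
        gcongr
        exact tsum_measure_shell_le (measurableSet_cube _ _) hl
    _ = (3 * 3 ^ n * C : ℝ≥0) * μ Q := by push_cast; ring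

end Whitney

/-! ### Summation over scales and the dyadic Carleson condition -/

section Summation

/-- With truncated subtraction the exponent is |j - k|, so this is two geometric series. -/
theorem tsum_pow_level_le {r : ℝ≥0} (hr : r < 1) (j : ℕ) :
    ∑' k, (r : ℝ≥0∞) ^ ((j - k) + (k - j)) ≤ (2 * (1 - r)⁻¹ : ℝ≥0) := by
  rw [← ENNReal.summable.sum_add_tsum_nat_add' (k := j), two_mul, ENNReal.coe_add,
    ← tsum_pow_coe_eq r hr]
  refine add_le_add ?_ (ENNReal.tsum_le_tsum fun k => le_of_eq ?_)
  · rw [← Finset.sum_range_reflect]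
    refine (Finset.sum_le_sum fun k hk => ?_).trans (ENNReal.sum_le_tsum (Finset.range j))
    have hk' := Finset.mem_range.1 hk
    have : (j - (j - 1 - k)) + ((j - 1 - k) - j) = k + 1 := by omega
    rw [this]
    exact pow_le_pow_of_le_one zero_le (by exact_mod_cast hr.le) (Nat.le_succ k)
  · congr 1
    omega

theorem tsum_pow_level_le' {r : ℝ≥0} (hr : r < 1) (k : ℕ) :
    ∑' j : ℕ, (r : ℝ≥0∞) ^ ((j - k) + (k - j)) ≤ (2 * (1 - r)⁻¹ : ℝ≥0) := by
  refine le_trans (le_of_eq (tsum_congr fun j => ?_)) (tsum_pow_level_le hr k)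
  rw [add_comm]

theorem lintegral_inv_dyadic_le {L : ℝ} (hL : 0 < L) (j : ℕ) :
    ∫⁻ t in Ioc (L / 2 ^ (j + 1)) (L / 2 ^ j), (ENNReal.ofReal t)⁻¹ ≤ 1 := by
  set p := L / 2 ^ (j + 1) with hp
  have hpp : 0 < p := by positivity
  have hp2 : L / 2 ^ j = 2 * p := by rw [hp, pow_succ]; field_simp
  rw [hp2]
  calc _ ≤ ∫⁻ _ in Ioc p (2 * p), (ENNReal.ofReal p)⁻¹ := by
        refine setLIntegral_mono' measurableSet_Ioc fun t ht => ?_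
        gcongr
        exact ht.1.le
    _ = (ENNReal.ofReal p)⁻¹ * ENNReal.ofReal p := by
        rw [setLIntegral_const, Real.volume_Ioc]; congr 2; ring
    _ ≤ 1 := ENNReal.inv_mul_le_one _

theorem pairwise_disjoint_dyadic {L : ℝ} (hL : 0 < L) :
    Pairwise (Function.onFun Disjoint fun j : ℕ => Ioc (L / 2 ^ (j + 1)) (L / 2 ^ j)) := by
  have h : Antitone fun j : ℕ => L / 2 ^ j := fun i j hij =>
    div_le_div_of_nonneg_left hL.le (by positivity) (pow_le_pow_right₀ (by norm_num) hij)
  exact h.pairwise_disjoint_on_Ioc_succ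

theorem exists_mem_dyadic {L t : ℝ} (ht : t ∈ Ioc 0 L) :
    ∃ j : ℕ, t ∈ Ioc (L / 2 ^ (j + 1)) (L / 2 ^ j) := by
  have hL : 0 < L := ht.1.trans_le ht.2
  obtain ⟨i, hi1, hi2⟩ := exists_nat_pow_near_of_lt_one (x := t / L) (y := 1 / 2)
    (div_pos ht.1 hL) ((div_le_one hL).2 ht.2) (by norm_num) (by norm_num)
  rw [lt_div_iff₀ hL, one_div, inv_pow, inv_mul_eq_div] at hi1
  rw [div_le_iff₀ hL, one_div, inv_pow, inv_mul_eq_div] at hi2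
  exact ⟨i, hi1, hi2⟩

variable {n : ℕ} {μ : Measure (Fin n → ℝ)} {τ L η : ℝ}

/-- The part of a density on the upper half space over the good points at scale `j`. -/
noncomputable def goodDensity (η τ L : ℝ) (G : ℝ × (Fin n → ℝ) → ℝ≥0∞) (j : ℕ) :
    (Fin n → ℝ) → ℝ≥0∞ :=
  (goodSet η τ L j).indicator fun x => ∫⁻ t in Ioc (L / 2 ^ (j + 1)) (L / 2 ^ j), G (t, x)

theorem measurable_goodDensity {G : ℝ × (Fin n → ℝ) → ℝ≥0∞} (hG : Measurable G) (j : ℕ) :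
    Measurable (goodDensity η τ L G j) :=
  Measurable.indicator hG.lintegral_prod_left' (measurableSet_goodSet η τ L j)

/-- The good part of a bounded Carleson density satisfies the dyadic Carleson condition. -/
theorem tsum_setLIntegral_goodDensity_le (hn : 1 ≤ n) [SFinite μ] (hL : 0 < L) (hη : 0 < η)
    {G : ℝ × (Fin n → ℝ) → ℝ≥0∞} (hG : Measurable G) {C M : ℝ≥0}
    (hcar : ∀ (a : Fin n → ℝ) (l : ℝ), 0 < l →
      ∫⁻ t in Ioo 0 l, ∫⁻ x in cube a l, G (t, x) ∂μ
        ≤ C * μ (cube (fun i => a i - l) (3 * l)))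
    (hM : ∀ t, 0 < t → ∀ x, G (t, x) ≤ M * (ENNReal.ofReal t)⁻¹) {l₀ : ℕ}
    (hl₀ : ∀ l ≥ l₀, (2 / 3 : ℝ) ^ l ≤ η / 16) (k : ℕ) (i : Fin n → ℤ) :
    ∑' l, ∫⁻ x in gridIdx τ L k ⁻¹' {i}, goodDensity η τ L G (k + l) x ∂μ
      ≤ (l₀ * M + 3 * 3 ^ n * C : ℝ≥0) * μ (gridIdx τ L k ⁻¹' {i}) := by
  rw [gridIdx_preimage hL]
  set a : Fin n → ℝ := fun j => τ + i j * (L / 2 ^ k) with ha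
  set p := L / 2 ^ k with hp
  have hpp : 0 < p := by positivity
  set Q := cube a p with hQ
  have hQm : MeasurableSet Q := measurableSet_cube _ _
  have hQi : gridIdx τ L k ⁻¹' {i} = Q := gridIdx_preimage hL k i
  have hw : ∀ j x, goodDensity η τ L G j x ≤ M := fun j x => by
    refine indicator_apply_le' (fun _ => ?_) (fun _ => zero_le)
    calc _ ≤ ∫⁻ t in Ioc (L / 2 ^ (j + 1)) (L / 2 ^ j), M * (ENNReal.ofReal t)⁻¹ :=
          setLIntegral_mono' measurableSet_Ioc fun t ht =>
            hM t (lt_of_le_of_lt (by positivity) ht.1) x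
      _ ≤ M * 1 := by
          rw [lintegral_const_mul' _ _ ENNReal.coe_ne_top]
          gcongr
          exact lintegral_inv_dyadic_le hL j
      _ = M := mul_one _
  -- For the first l₀ scales the pointwise bound M is used; on later ones goodness places t in the
  -- Whitney region.
  rw [← ENNReal.summable.sum_add_tsum_nat_add' (k := l₀), ENNReal.coe_add, add_mul]
  refine add_le_add ?_ ?_
  · calc _ ≤ ∑ l ∈ Finset.range l₀, (M : ℝ≥0∞) * μ Q := by
          refine Finset.sum_le_sum fun l _ => ?_
          rw [← setLIntegral_const]
          exact lintegral_mono fun x => hw _ x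
      _ = _ := by
          rw [Finset.sum_const, Finset.card_range, nsmul_eq_mul]; push_cast; ring
  · refine le_trans ?_ (setLIntegral_whitney_le hn hG hcar a hpp)
    rw [← lintegral_tsum fun l => (measurable_goodDensity hG _).aemeasurable]
    refine setLIntegral_mono' hQm fun x hx => ?_
    set J : ℕ → Set ℝ := fun l => Ioc (L / 2 ^ (k + (l + l₀) + 1)) (L / 2 ^ (k + (l + l₀))) with hJ
    set T := Ioo 0 (Metric.infDist x Qᶜ / 8) with hT
    have hJd : Pairwise (Function.onFun Disjoint J) := fun l m hlm =>
      pairwise_disjoint_dyadic hL (by omega : k + (l + l₀) ≠ k + (m + l₀))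
    -- Here t ≤ 2^(-l) p = (2/3)^l (3/4)^l p, at most one sixteenth of the distance η(3/4)^l p
    -- guaranteed by goodness, with l + l₀ in the role of l.
    have hle : ∀ l, goodDensity η τ L G (k + (l + l₀)) x
        ≤ ∫⁻ t in J l, T.indicator (fun t => G (t, x)) t := by
      intro l
      refine indicator_apply_le' (fun hgood => ?_) (fun _ => zero_le)
      refine setLIntegral_mono' measurableSet_Ioc fun t ht => ?_
      rw [indicator_of_mem]
      refine ⟨lt_of_le_of_lt (by positivity) ht.1, ?_⟩
      have hd : η * (3 / 4) ^ (l + l₀) * p ≤ Metric.infDist x Qᶜ := by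
        refine (Metric.le_infDist (compl_cube_nonempty hn a p)).2 fun y hy => ?_
        have hne : gridIdx τ L k y ≠ gridIdx τ L k x := by
          intro h
          have hx' : x ∈ gridIdx τ L k ⁻¹' {i} := by rw [hQi]; exact hx
          have hy' : y ∈ gridIdx τ L k ⁻¹' {i} := h.trans hx'
          rw [hQi] at hy'
          exact hy hy'
        have := le_dist_of_mem_goodSet hL (Nat.le_add_right k (l + l₀)) hgood hne
        rwa [add_tsub_cancel_left, dist_comm] at this
      have h1 := hl₀ (l + l₀) (Nat.le_add_left _ _)
      have h2 : (2 / 3 : ℝ) ^ (l + l₀) * (3 / 4) ^ (l + l₀) = (1 / 2) ^ (l + l₀) := by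
        rw [← mul_pow]; norm_num
      have h3 : t ≤ (1 / 2) ^ (l + l₀) * p := by
        refine ht.2.trans (le_of_eq ?_)
        rw [hp, pow_add _ k, one_div, inv_pow]
        field_simp
      have h4 : (0 : ℝ) < (3 / 4) ^ (l + l₀) := by positivity
      have h5 : (1 / 2 : ℝ) ^ (l + l₀) * p ≤ η / 16 * (3 / 4) ^ (l + l₀) * p := by
        rw [← h2]; gcongr
      have h6 : 0 < η * (3 / 4) ^ (l + l₀) * p := by positivity
      linarith
    calc _ ≤ ∑' l, ∫⁻ t in J l, T.indicator (fun t => G (t, x)) t := ENNReal.tsum_le_tsum hle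
      _ = ∫⁻ t in ⋃ l, J l, T.indicator (fun t => G (t, x)) t :=
          (lintegral_iUnion (fun l => measurableSet_Ioc) hJd _).symm
      _ ≤ ∫⁻ t, T.indicator (fun t => G (t, x)) t := setLIntegral_le_lintegral _ _
      _ = _ := lintegral_indicator measurableSet_Ioo _

end Summation

/-! ### The square function over the good points of one grid -/

section SquareFunction

variable {n : ℕ} {μ : Measure (Fin n → ℝ)} {D A : ℝ≥0} {α : ℝ}
  {s : ℝ → (Fin n → ℝ) → (Fin n → ℝ) → ℂ} {τ L η : ℝ} {b f : (Fin n → ℝ) → ℂ} {B c : ℝ≥0}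

theorem HasTailBound.measurable_theta [SFinite μ] {q : ℝ≥0} (hs : HasTailBound μ D q A α s)
    (hf : Measurable f) : Measurable fun p : ℝ × (Fin n → ℝ) => theta μ s f p.1 p.2 := by
  have : StronglyMeasurable fun z : (ℝ × (Fin n → ℝ)) × (Fin n → ℝ) =>
      s z.1.1 z.1.2 z.2 * f z.2 :=
    ((hs.measurable.comp (by fun_prop : Measurable
      fun z : (ℝ × (Fin n → ℝ)) × (Fin n → ℝ) => (z.1.1, z.1.2, z.2))).mul
      (hf.comp measurable_snd)).stronglyMeasurable
  exact this.integral_prod_right'.measurable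

/-- The density of the square function of `θ`. -/
noncomputable def squareDensity (μ : Measure (Fin n → ℝ))
    (s : ℝ → (Fin n → ℝ) → (Fin n → ℝ) → ℂ) (f : (Fin n → ℝ) → ℂ) (p : ℝ × (Fin n → ℝ)) : ℝ≥0∞ :=
  ‖theta μ s f p.1 p.2‖ₑ ^ 2 * (ENNReal.ofReal p.1)⁻¹

theorem HasTailBound.measurable_squareDensity [SFinite μ] {q : ℝ≥0}
    (hs : HasTailBound μ D q A α s) (hf : Measurable f) : Measurable (squareDensity μ s f) :=
  ((hs.measurable_theta hf).enorm.pow_const 2).mul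
    (ENNReal.measurable_ofReal.comp measurable_fst).inv

theorem lintegral_levelTerm_sq_le [SFinite μ] (hα : 0 < α) (hD : D ≠ 0) {t : ℝ} (ht : 0 < t)
    {d : ℕ → (Fin n → ℝ) → ℂ} (hd : ∀ k, Measurable (d k)) (k : ℕ) :
    ∫⁻ x, levelTerm μ D α t d x k ^ 2 ∂μ
      ≤ (2 * ((1 - kernelRate α)⁻¹ ^ 2 * D) + 2 : ℝ≥0) * ∫⁻ x, ‖d k x‖ₑ ^ 2 ∂μ := by
  have hm : Measurable (tailOp μ D (kernelRate α) t (fun y => ‖d k y‖ₑ)) :=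
    measurable_tailOp (hd k).enorm t
  calc _ ≤ ∫⁻ x, (2 * tailOp μ D (kernelRate α) t (fun y => ‖d k y‖ₑ) x ^ 2
        + 2 * ‖d k x‖ₑ ^ 2) ∂μ := lintegral_mono fun x => ENNReal.add_sq_le _ _
    _ = 2 * ∫⁻ x, tailOp μ D (kernelRate α) t (fun y => ‖d k y‖ₑ) x ^ 2 ∂μ
        + 2 * ∫⁻ x, ‖d k x‖ₑ ^ 2 ∂μ := by
        rw [lintegral_add_left ((hm.pow_const 2).const_mul 2), lintegral_const_mul' _ _ (by simp),
          lintegral_const_mul' _ _ (by simp)]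
    _ ≤ 2 * (((1 - kernelRate α)⁻¹ ^ 2 * D : ℝ≥0) * ∫⁻ x, ‖d k x‖ₑ ^ 2 ∂μ)
        + 2 * ∫⁻ x, ‖d k x‖ₑ ^ 2 ∂μ := by
        gcongr
        exact lintegral_sq_tailOp_le hD (kernelRate_lt_one hα) ht (hd k).enorm
    _ = _ := by push_cast; ring

/-- Cauchy–Schwarz against the summable weights r^|j-k| puts the square inside the sum, where each
level uses the L² bound of `tailOp`. -/
theorem lintegral_sq_tsum_levelTerm_le [SFinite μ] (hα : 0 < α) (hD : D ≠ 0) {t : ℝ} (ht : 0 < t)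
    {d : ℕ → (Fin n → ℝ) → ℂ} (hd : ∀ k, Measurable (d k)) (j : ℕ) :
    ∫⁻ x, (∑' k, (levelRate α : ℝ≥0∞) ^ ((j - k) + (k - j)) * levelTerm μ D α t d x k) ^ 2 ∂μ
      ≤ (2 * (1 - levelRate α)⁻¹ * (2 * ((1 - kernelRate α)⁻¹ ^ 2 * D) + 2) : ℝ≥0)
        * ∑' k, (levelRate α : ℝ≥0∞) ^ ((j - k) + (k - j)) * ∫⁻ x, ‖d k x‖ₑ ^ 2 ∂μ := by
  have hm : ∀ k, Measurable fun x => levelTerm μ D α t d x k := fun k =>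
    (measurable_tailOp (hd k).enorm t).add (hd k).enorm
  set S : ℝ≥0 := 2 * (1 - levelRate α)⁻¹ with hS
  set T : ℝ≥0 := 2 * ((1 - kernelRate α)⁻¹ ^ 2 * D) + 2 with hT
  calc _ ≤ ∫⁻ x, S * ∑' k, (levelRate α : ℝ≥0∞) ^ ((j - k) + (k - j))
        * levelTerm μ D α t d x k ^ 2 ∂μ := by
        refine lintegral_mono fun x => (sq_tsum_mul_le _ _).trans ?_
        gcongr
        exact tsum_pow_level_le (levelRate_lt_one hα) j
    _ = S * ∑' k, (levelRate α : ℝ≥0∞) ^ ((j - k) + (k - j))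
        * ∫⁻ x, levelTerm μ D α t d x k ^ 2 ∂μ := by
        rw [lintegral_const_mul' _ _ ENNReal.coe_ne_top, lintegral_tsum fun k =>
          (((hm k).pow_const 2).const_mul _).aemeasurable]
        congr 2
        ext k
        rw [lintegral_const_mul _ ((hm k).pow_const 2)]
    _ ≤ S * ∑' k, (levelRate α : ℝ≥0∞) ^ ((j - k) + (k - j))
        * (T * ∫⁻ x, ‖d k x‖ₑ ^ 2 ∂μ) := by
        gcongr with k
        exact lintegral_levelTerm_sq_le hα hD ht hd k
    _ = _ := by
        simp_rw [mul_left_comm _ (T : ℝ≥0∞)]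
        rw [ENNReal.tsum_mul_left, ENNReal.coe_mul S T, mul_assoc]

/-- The constant in the estimate of the off-diagonal part. -/
noncomputable def offDiagonalConst (α η : ℝ) (D A B c : ℝ≥0) : ℝ≥0 :=
  2 * (A * B * (2 ^ α * (levelRate α)⁻¹ + η⁻¹.toNNReal ^ (α / 2) * (1 - kernelRate α)⁻¹)) ^ 2
    * (2 * (1 - levelRate α)⁻¹ * (2 * ((1 - kernelRate α)⁻¹ ^ 2 * D) + 2))
    * (2 * (1 - levelRate α)⁻¹) * (3 * c⁻¹ ^ 2 + 8 * c⁻¹ ^ 4 * B ^ 2)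

/-- The square function estimate over the good points of a fixed grid. -/
theorem HasTailBound.tsum_lintegral_good_le (hn : 1 ≤ n) (hs : HasTailBound μ D (kernelRate α) A α s)
    (hα : 0 < α) (hD : D ≠ 0) [IsLocallyFiniteMeasure μ] (hμ : μ ≠ 0) (hL : 0 < L) (hη : 0 < η)
    (hb : Measurable b) (hB0 : 0 < B)
    (hB : ∀ x, ‖b x‖ₑ ≤ B) (hacc : ∀ k, IsAccretiveOn μ (gridIdx τ L k) b c) (hc : 0 < c)
    {C : ℝ≥0}
    (hcar : ∀ (a : Fin n → ℝ) (l : ℝ), 0 < l →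
      ∫⁻ t in Ioo 0 l, ∫⁻ x in cube a l, squareDensity μ s b (t, x) ∂μ
        ≤ C * μ (cube (fun i => a i - l) (3 * l)))
    {l₀ : ℕ} (hl₀ : ∀ l ≥ l₀, (2 / 3 : ℝ) ^ l ≤ η / 16)
    (hf : Measurable f) (hf2 : MemLp f 2 μ) :
    ∑' j : ℕ, ∫⁻ t in Ioc (L / 2 ^ (j + 1)) (L / 2 ^ j),
        ∫⁻ x in goodSet η τ L j, squareDensity μ s f (t, x) ∂μ
      ≤ (offDiagonalConst α η D A B c + 8 * c⁻¹ ^ 2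
          * (l₀ * (A * (B * (1 - kernelRate α)⁻¹)) ^ 2 + 3 * 3 ^ n * C + 1) : ℝ≥0)
        * ∫⁻ x, ‖f x‖ₑ ^ 2 ∂μ := by
  have hq := kernelRate_lt_one hα
  have hπ := measurable_gridIdx (n := n) τ L
  have hfin : ∀ k i, μ (gridIdx τ L k ⁻¹' {i}) ≠ ∞ := fun k i => measure_gridIdx_ne_top hL k i
  have href : ∀ k (x y : Fin n → ℝ), gridIdx τ L (k + 1) x = gridIdx τ L (k + 1) y →
      gridIdx τ L k x = gridIdx τ L k y := fun k x y h => gridIdx_refine k h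
  set a : ℕ → (Fin n → ℝ) → ℂ := fun k => adaptedCoeff μ (gridIdx τ L k) b f with ha
  set d := adaptedDiff μ (gridIdx τ L) b f with hd
  have ham : ∀ k, Measurable (a k) := fun k => measurable_adaptedCoeff (hπ k) b f
  have hdm : ∀ k, Measurable (d k) := measurable_adaptedDiff hπ b f
  set G := squareDensity μ s b with hG
  have hGm : Measurable G := hs.measurable_squareDensity hb
  set K : ℝ≥0 := A * B * (2 ^ α * (levelRate α)⁻¹ + η⁻¹.toNNReal ^ (α / 2)
    * (1 - kernelRate α)⁻¹) with hK
  set S : ℝ≥0 := 2 * (1 - levelRate α)⁻¹ with hS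
  set T : ℝ≥0 := 2 * ((1 - kernelRate α)⁻¹ ^ 2 * D) + 2 with hT
  set N : ℕ → ℝ≥0∞ := fun k => ∫⁻ x, ‖d k x‖ₑ ^ 2 ∂μ with hN
  set R : ℕ → ℝ≥0∞ := fun j => (2 * K ^ 2 * (S * T) : ℝ≥0)
    * ∑' k, (levelRate α : ℝ≥0∞) ^ ((j - k) + (k - j)) * N k with hR
  have hpt : ∀ j, ∀ t ∈ Ioc (L / 2 ^ (j + 1)) (L / 2 ^ j),
      ∫⁻ x in goodSet η τ L j, squareDensity μ s f (t, x) ∂μ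
        ≤ R j * (ENNReal.ofReal t)⁻¹
          + 2 * ∫⁻ x in goodSet η τ L j, ‖a j x‖ₑ ^ 2 * G (t, x) ∂μ := by
    intro j t ht
    have ht0 : 0 < t := lt_of_le_of_lt (by positivity) ht.1
    have htinv : (ENNReal.ofReal t)⁻¹ ≠ ∞ := by simpa using ht0
    set Y : (Fin n → ℝ) → ℝ≥0∞ := fun x =>
      ∑' k, (levelRate α : ℝ≥0∞) ^ ((j - k) + (k - j)) * levelTerm μ D α t d x k with hS0
    have h1 : ∀ x ∈ goodSet η τ L j, squareDensity μ s f (t, x)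
        ≤ (2 * K ^ 2 : ℝ≥0) * (ENNReal.ofReal t)⁻¹ * Y x ^ 2
          + 2 * (‖a j x‖ₑ ^ 2 * G (t, x)) := by
      intro x hx
      have hle := hs.enorm_theta_sub_le hα hμ hL hη hb hB hacc hc hf hf2 ht hx
      have h2 : ‖theta μ s f t x‖ₑ ≤ K * Y x + ‖a j x‖ₑ * ‖theta μ s b t x‖ₑ := by
        calc ‖theta μ s f t x‖ₑ
            = ‖(theta μ s f t x - a j x * theta μ s b t x) + a j x * theta μ s b t x‖ₑ := by
              rw [sub_add_cancel]
          _ ≤ _ := enorm_add_le _ _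
          _ ≤ _ := by
              rw [enorm_mul]
              gcongr
      calc squareDensity μ s f (t, x)
          ≤ (2 * (K * Y x) ^ 2 + 2 * (‖a j x‖ₑ * ‖theta μ s b t x‖ₑ) ^ 2)
            * (ENNReal.ofReal t)⁻¹ := by
            refine mul_le_mul_left ?_ _
            exact (pow_le_pow_left' h2 2).trans (ENNReal.add_sq_le _ _)
        _ = _ := by
            simp only [hG, squareDensity]
            push_cast
            ring
    calc _ ≤ ∫⁻ x in goodSet η τ L j, ((2 * K ^ 2 : ℝ≥0) * (ENNReal.ofReal t)⁻¹ * Y x ^ 2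
          + 2 * (‖a j x‖ₑ ^ 2 * G (t, x))) ∂μ :=
          setLIntegral_mono' (measurableSet_goodSet η τ L j) h1
      _ = (2 * K ^ 2 : ℝ≥0) * (ENNReal.ofReal t)⁻¹ * ∫⁻ x in goodSet η τ L j, Y x ^ 2 ∂μ
          + 2 * ∫⁻ x in goodSet η τ L j, ‖a j x‖ₑ ^ 2 * G (t, x) ∂μ := by
          rw [lintegral_add_right _ ((show Measurable fun x => ‖a j x‖ₑ ^ 2 * G (t, x) from
            ((ham j).enorm.pow_const 2).mul (hGm.comp measurable_prodMk_left)).const_mul 2),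
            lintegral_const_mul' _ _ (ENNReal.mul_ne_top ENNReal.coe_ne_top htinv),
            lintegral_const_mul' _ _ (by simp)]
      _ ≤ (2 * K ^ 2 : ℝ≥0) * (ENNReal.ofReal t)⁻¹ * ((S * T : ℝ≥0)
            * ∑' k, (levelRate α : ℝ≥0∞) ^ ((j - k) + (k - j)) * N k)
          + 2 * ∫⁻ x in goodSet η τ L j, ‖a j x‖ₑ ^ 2 * G (t, x) ∂μ := by
          gcongr
          exact (setLIntegral_le_lintegral _ _).trans
            (lintegral_sq_tsum_levelTerm_le hα hD ht0 hdm j)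
      _ = _ := by
          simp only [hR]
          push_cast
          ring
  have hj : ∀ j, ∫⁻ t in Ioc (L / 2 ^ (j + 1)) (L / 2 ^ j),
        ∫⁻ x in goodSet η τ L j, squareDensity μ s f (t, x) ∂μ
      ≤ R j + 2 * ∫⁻ x, ‖a j x‖ₑ ^ 2 * goodDensity η τ L G j x ∂μ := by
    intro j
    calc _ ≤ ∫⁻ t in Ioc (L / 2 ^ (j + 1)) (L / 2 ^ j), (R j * (ENNReal.ofReal t)⁻¹
          + 2 * ∫⁻ x in goodSet η τ L j, ‖a j x‖ₑ ^ 2 * G (t, x) ∂μ) :=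
          setLIntegral_mono' measurableSet_Ioc (hpt j)
      _ = R j * (∫⁻ t in Ioc (L / 2 ^ (j + 1)) (L / 2 ^ j), (ENNReal.ofReal t)⁻¹)
          + 2 * ∫⁻ t in Ioc (L / 2 ^ (j + 1)) (L / 2 ^ j),
            ∫⁻ x in goodSet η τ L j, ‖a j x‖ₑ ^ 2 * G (t, x) ∂μ := by
          have hm : Measurable fun t : ℝ => (ENNReal.ofReal t)⁻¹ :=
            ENNReal.measurable_ofReal.inv
          rw [lintegral_add_left (hm.const_mul _), lintegral_const_mul _ hm,
            lintegral_const_mul' _ _ (by simp)]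
      _ ≤ R j * 1 + 2 * ∫⁻ x, ‖a j x‖ₑ ^ 2 * goodDensity η τ L G j x ∂μ := by
          gcongr
          · exact lintegral_inv_dyadic_le hL j
          · rw [lintegral_lintegral_swap (f := fun t x => ‖a j x‖ₑ ^ 2 * G (t, x))
              (show Measurable fun p : ℝ × (Fin n → ℝ) => ‖a j p.2‖ₑ ^ 2 * G (p.1, p.2) from
                (((ham j).enorm.pow_const 2).comp measurable_snd).mul hGm).aemeasurable,
              ← lintegral_indicator (measurableSet_goodSet η τ L j)]
            refine lintegral_mono fun x => ?_
            refine indicator_apply_le' (fun hx => ?_) (fun _ => zero_le)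
            rw [goodDensity, indicator_of_mem hx,
              ← lintegral_const_mul _ (show Measurable fun t => G (t, x) from
                hGm.comp measurable_prodMk_right)]
      _ = _ := by rw [mul_one]
  -- Summing over j first uses the decay in |j - k| a second time and leaves the square function of
  -- the adapted differences.
  have hRsum : ∑' j, R j ≤ offDiagonalConst α η D A B c * ∫⁻ x, ‖f x‖ₑ ^ 2 ∂μ := by
    simp only [hR]
    rw [ENNReal.tsum_mul_left, ENNReal.tsum_comm]
    simp_rw [ENNReal.tsum_mul_right]
    calc _ ≤ (2 * K ^ 2 * (S * T) : ℝ≥0) * ∑' k, (S : ℝ≥0∞) * N k := by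
          gcongr with k
          exact tsum_pow_level_le' (levelRate_lt_one hα) k
      _ ≤ (2 * K ^ 2 * (S * T) : ℝ≥0) * (S * ((3 * c⁻¹ ^ 2 + 8 * c⁻¹ ^ 4 * B ^ 2 : ℝ≥0)
            * ∫⁻ x, ‖f x‖ₑ ^ 2 ∂μ)) := by
          rw [ENNReal.tsum_mul_left]
          gcongr
          exact tsum_lintegral_adaptedDiff_sq_le hπ hfin href hb hB0 hB hacc hc hf2
      _ = _ := by
          rw [offDiagonalConst, ← hK, ← hS, ← hT]
          push_cast
          ring
  -- The summand 1 keeps W nonzero, since `carleson_embedding` divides by its constant.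
  set W : ℝ≥0 := l₀ * (A * (B * (1 - kernelRate α)⁻¹)) ^ 2 + 3 * 3 ^ n * C + 1 with hW
  have hcarl : ∑' j, ∫⁻ x, ‖a j x‖ₑ ^ 2 * goodDensity η τ L G j x ∂μ
      ≤ (4 * c⁻¹ ^ 2 * W : ℝ≥0) * ∫⁻ x, ‖f x‖ₑ ^ 2 ∂μ := by
    have hcond : ∀ k i, ∑' l, ∫⁻ x in gridIdx τ L k ⁻¹' {i}, goodDensity η τ L G (k + l) x ∂μ
        ≤ W * μ (gridIdx τ L k ⁻¹' {i}) := by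
      intro k i
      refine (tsum_setLIntegral_goodDensity_le hn hL hη hGm hcar
        (M := (A * (B * (1 - kernelRate α)⁻¹)) ^ 2) (fun t ht x => ?_) hl₀ k i).trans ?_
      · simp only [hG, squareDensity]
        rw [ENNReal.coe_pow]
        gcongr
        exact hs.enorm_theta_le_of_bounded hq ht x hb hB
      · gcongr
        exact le_self_add
    have hemb := carleson_embedding hπ hfin href (w := goodDensity η τ L G)
      (fun k => measurable_goodDensity hGm k) (C := W) (by simp [hW]) ENNReal.coe_ne_top hcond
      hf.enorm.aemeasurable
    calc _ ≤ ∑' j, (c⁻¹ ^ 2 : ℝ≥0) * ∫⁻ x, fiberLAverage μ (gridIdx τ L j) (fun y => ‖f y‖ₑ) x ^ 2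
          * goodDensity η τ L G j x ∂μ := by
          refine ENNReal.tsum_le_tsum fun j => ?_
          rw [← lintegral_const_mul' _ _ ENNReal.coe_ne_top]
          refine lintegral_mono fun x => ?_
          rw [← mul_assoc, ENNReal.coe_pow, ← mul_pow]
          gcongr
          exact ((hacc j).enorm_adaptedCoeff_le hc (hfin j) f x).trans
            (mul_le_mul_right (enorm_fiberAverage_le f x) _)
      _ ≤ (c⁻¹ ^ 2 : ℝ≥0) * (4 * W * ∫⁻ x, ‖f x‖ₑ ^ 2 ∂μ) := by
          rw [ENNReal.tsum_mul_left]
          gcongr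
      _ = _ := by push_cast; ring
  calc _ ≤ ∑' j, (R j + 2 * ∫⁻ x, ‖a j x‖ₑ ^ 2 * goodDensity η τ L G j x ∂μ) :=
        ENNReal.tsum_le_tsum hj
    _ ≤ offDiagonalConst α η D A B c * ∫⁻ x, ‖f x‖ₑ ^ 2 ∂μ
        + 2 * ((4 * c⁻¹ ^ 2 * W : ℝ≥0) * ∫⁻ x, ‖f x‖ₑ ^ 2 ∂μ) := by
        rw [ENNReal.tsum_add]
        refine add_le_add hRsum ?_
        rw [ENNReal.tsum_mul_left]
        exact mul_le_mul_right hcarl _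
    _ = _ := by push_cast; ring

end SquareFunction

/-! ### Averaging over grids, all scales, and the main theorem -/

section Main

variable {n : ℕ} {μ : Measure (Fin n → ℝ)} {D A : ℝ≥0} {α : ℝ}
  {s : ℝ → (Fin n → ℝ) → (Fin n → ℝ) → ℂ} {η : ℝ} {b f : (Fin n → ℝ) → ℂ} {B c : ℝ≥0}

theorem theta_congr_ae {s' : ℝ → (Fin n → ℝ) → (Fin n → ℝ) → ℂ} {f' : (Fin n → ℝ) → ℂ} {t : ℝ}
    (hs : s t = s' t) (hf : f =ᵐ[μ] f') (x : Fin n → ℝ) : theta μ s f t x = theta μ s' f' t x := by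
  refine integral_congr_ae ?_
  filter_upwards [hf] with y hy
  rw [hs, hy]

theorem lintegral_div_eq_squareDensity {t : ℝ} (ht : 0 < t) (ν : Measure (Fin n → ℝ)) :
    (∫⁻ x, ‖theta μ s f t x‖ₑ ^ 2 ∂ν) / ENNReal.ofReal t
      = ∫⁻ x, squareDensity μ s f (t, x) ∂ν := by
  have htinv : (ENNReal.ofReal t)⁻¹ ≠ ∞ := by simpa using ht
  simp only [squareDensity]
  rw [lintegral_mul_const' _ _ htinv, ENNReal.div_eq_inv_mul, mul_comm]

theorem setLIntegral_Ioc_le_tsum_dyadic (F : ℝ → ℝ≥0∞) (L : ℝ) :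
    ∫⁻ t in Ioc 0 L, F t ≤ ∑' j : ℕ, ∫⁻ t in Ioc (L / 2 ^ (j + 1)) (L / 2 ^ j), F t :=
  (lintegral_mono_set fun _ ht => mem_iUnion.2 (exists_mem_dyadic ht)).trans
    (lintegral_iUnion_le _ _)

theorem setLIntegral_Ioi_le_of_forall_Ioc {F : ℝ → ℝ≥0∞} {M : ℝ≥0∞}
    (h : ∀ L : ℝ, 0 < L → ∫⁻ t in Ioc 0 L, F t ≤ M) : ∫⁻ t in Ioi 0, F t ≤ M := by
  have hU : Ioi (0 : ℝ) = ⋃ N : ℕ, Ioc 0 (N + 1 : ℝ) := by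
    ext t
    simp only [mem_Ioi, mem_iUnion, mem_Ioc]
    refine ⟨fun ht => ?_, fun ⟨_, ht⟩ => ht.1⟩
    obtain ⟨N, hN⟩ := exists_nat_ge t
    exact ⟨N, ht, hN.trans (by simp)⟩
  have hmono : Monotone fun N : ℕ => Ioc 0 (N + 1 : ℝ) := fun i j hij =>
    Ioc_subset_Ioc_right (by gcongr)
  rw [hU, setLIntegral_iUnion_of_directed _ hmono.directed_le]
  exact iSup_le fun N => h _ (by positivity)

/-- The square function estimate for a bounded accretive function satisfying the Carleson
condition, with measurable data. -/
theorem HasTailBound.lintegral_squareDensity_le (hn : 1 ≤ n)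
    (hs : HasTailBound μ D (kernelRate α) A α s) (hα : 0 < α) (hD : D ≠ 0)
    [IsLocallyFiniteMeasure μ] (hμ : μ ≠ 0) (hη : 0 < η) (hη' : 48 * n * η ≤ 1) (hη1 : η ≤ 1)
    (hb : Measurable b) (hB0 : 0 < B) (hB : ∀ x, ‖b x‖ₑ ≤ B)
    (hacc : ∀ (a : Fin n → ℝ) (l : ℝ), 0 < l → c * μ (cube a l) ≤ ‖∫ x in cube a l, b x ∂μ‖ₑ)
    (hc : 0 < c) {C : ℝ≥0}
    (hcar : ∀ (a : Fin n → ℝ) (l : ℝ), 0 < l →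
      ∫⁻ t in Ioo 0 l, ∫⁻ x in cube a l, squareDensity μ s b (t, x) ∂μ
        ≤ C * μ (cube (fun i => a i - l) (3 * l)))
    {l₀ : ℕ} (hl₀ : ∀ l ≥ l₀, (2 / 3 : ℝ) ^ l ≤ η / 16)
    (hf : Measurable f) (hf2 : MemLp f 2 μ) :
    ∫⁻ t in Ioi 0, ∫⁻ x, squareDensity μ s f (t, x) ∂μ
      ≤ (2 * (offDiagonalConst α η D A B c + 8 * c⁻¹ ^ 2
          * (l₀ * (A * (B * (1 - kernelRate α)⁻¹)) ^ 2 + 3 * 3 ^ n * C + 1)) : ℝ≥0)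
        * ∫⁻ x, ‖f x‖ₑ ^ 2 ∂μ := by
  refine setLIntegral_Ioi_le_of_forall_Ioc fun L hL => ?_
  refine (setLIntegral_Ioc_le_tsum_dyadic _ L).trans ?_
  rw [ENNReal.coe_mul, mul_assoc]
  refine tsum_lintegral_le_of_goodSet hL hη.le hη' hη1 (hs.measurable_squareDensity hf) _
    fun τ => ?_
  refine hs.tsum_lintegral_good_le hn hα hD hμ hL hη hb hB0 hB (fun k i => ?_) hc hcar hl₀ hf hf2
  rw [gridIdx_preimage hL]
  exact hacc _ _ (by positivity)

end Main

/-- Setting a measurable version to zero where it is too large turns the essential bound into one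
valid everywhere. -/
theorem exists_measurable_ae_eq_enorm_le {X : Type*} [MeasurableSpace X] {μ : Measure X}
    {b : X → ℂ} (hb : AEStronglyMeasurable b μ) {B : ℝ≥0} (hB : eLpNorm b ∞ μ ≤ B) :
    ∃ g : X → ℂ, Measurable g ∧ g =ᵐ[μ] b ∧ ∀ x, ‖g x‖ₑ ≤ B := by
  have hm : Measurable (hb.mk b) := hb.stronglyMeasurable_mk.measurable
  refine ⟨{x | ‖hb.mk b x‖ₑ ≤ B}.indicator (hb.mk b),
    hm.indicator (measurableSet_le hm.enorm measurable_const), ?_, fun x => ?_⟩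
  · filter_upwards [hb.ae_eq_mk, enorm_ae_le_eLpNormEssSup b μ] with x hx hx2
    rw [indicator_of_mem, hx]
    rw [mem_ofPred_eq, ← hx]
    exact hx2.trans (by simpa using hB)
  · by_cases hx : ‖hb.mk b x‖ₑ ≤ B
    · rwa [indicator_of_mem (by exact hx)]
    · rw [indicator_of_notMem (by exact hx)]
      simp

theorem theorem1p1 (n : ℕ) (hn : 1 ≤ n) (α Clam Cs B c Ccar : ℝ) (hα : 0 < α) (hc : 0 < c) :
    ∃ C : ℝ, ∀ (μ : Measure (Fin n → ℝ)) (lam : (Fin n → ℝ) → ℝ → ℝ)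
      (s : ℝ → (Fin n → ℝ) → (Fin n → ℝ) → ℂ) (b : (Fin n → ℝ) → ℂ),
      IsUpperDoubling μ lam Clam →
      IsSquareKernel lam α Cs s →
      MemLp b ∞ μ → eLpNorm b ∞ μ ≤ ENNReal.ofReal B →
      (∀ (a : Fin n → ℝ) (l : ℝ), 0 < l →
        ENNReal.ofReal c * μ (cube a l) ≤ ‖∫ x in cube a l, b x ∂μ‖ₑ) →
      (∀ (a : Fin n → ℝ) (l : ℝ), 0 < l →
        ∫⁻ t in Ioo 0 l, (∫⁻ x in cube a l, ‖theta μ s b t x‖ₑ ^ 2 ∂μ) / ENNReal.ofReal t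
          ≤ ENNReal.ofReal Ccar * μ (cube (fun i => a i - l) (3 * l))) →
      ∀ f : (Fin n → ℝ) → ℂ, MemLp f 2 μ →
        (∀ t : ℝ, 0 < t → ∀ x, Integrable (fun y => s t x y * f y) μ) ∧
        ∫⁻ t in Ioi (0 : ℝ), (∫⁻ x, ‖theta μ s f t x‖ₑ ^ 2 ∂μ) / ENNReal.ofReal t
          ≤ ENNReal.ofReal C * eLpNorm f 2 μ ^ 2 := by
  have hn' : (0 : ℝ) < n := by exact_mod_cast hn
  have hn1 : (1 : ℝ) ≤ n := by exact_mod_cast hn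
  set η : ℝ := 1 / (48 * n) with hη
  have hη0 : 0 < η := by positivity
  have hη48 : 48 * n * η ≤ 1 := by rw [hη, mul_one_div_cancel (by positivity)]
  have hη1 : η ≤ 1 := by
    rw [hη, div_le_one (by positivity)]
    linarith
  obtain ⟨l₀, hl₀⟩ := exists_pow_lt_of_lt_one (show 0 < η / 16 by positivity)
    (show (2 / 3 : ℝ) < 1 by norm_num)
  have hl₀' : ∀ l ≥ l₀, (2 / 3 : ℝ) ^ l ≤ η / 16 := fun l hl =>
    (pow_le_pow_of_le_one (by norm_num) (by norm_num) hl).trans hl₀.le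
  set D : ℝ≥0 := Clam.toNNReal
  set A : ℝ≥0 := Cs.toNNReal * (Clam.toNNReal * 2 ^ α)
  -- Enlarged to be positive, so that B'² can serve as a nonzero Carleson constant.
  set B' : ℝ≥0 := max B.toNNReal 1
  have hB0 : 0 < B' := lt_max_of_lt_right one_pos
  refine ⟨(2 * (offDiagonalConst α η D A B' c.toNNReal + 8 * c.toNNReal⁻¹ ^ 2
    * (l₀ * (A * (B' * (1 - kernelRate α)⁻¹)) ^ 2 + 3 * 3 ^ n * Ccar.toNNReal + 1)) : ℝ≥0),
    fun μ lam s b hlam hker hb hbB hacc hcar f hf => ?_⟩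
  -- For μ = 0 the majorant vanishes and cannot be divided by; the statement is then trivial.
  rcases eq_or_ne μ 0 with rfl | hμ
  · simp [integrable_zero_measure]
  have := hlam.isLocallyFiniteMeasure
  have hs := hker.hasTailBound hlam hα
  set s' : ℝ → (Fin n → ℝ) → (Fin n → ℝ) → ℂ := fun t x y => if 0 < t then s t x y else 0 with hs'
  have hss : ∀ t, 0 < t → s t = s' t := fun t ht => by simp [hs', ht]
  have hD : D ≠ 0 := (Real.toNNReal_pos.2 (one_pos.trans_le hlam.one_le)).ne'
  obtain ⟨g, hgm, hgb, hgB⟩ := exists_measurable_ae_eq_enorm_le hb.1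
    (hbB.trans (ENNReal.coe_le_coe.2 (le_max_left B.toNNReal 1)))
  have hfm : Measurable (hf.1.mk f) := hf.1.stronglyMeasurable_mk.measurable
  have hff := hf.1.ae_eq_mk
  have hf2 : MemLp (hf.1.mk f) 2 μ := (memLp_congr_ae hff).1 hf
  refine ⟨fun t ht x => ?_, ?_⟩
  · refine (hs.integrable_of_memLp (kernelRate_lt_one hα) hμ ht x hfm hf2).congr ?_
    filter_upwards [hff] with y hy
    rw [← hy, hss t ht]
  rw [eLpNorm_congr_ae hff, eLpNorm_two_sq, ENNReal.ofReal_coe_nnreal]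
  calc _ = ∫⁻ t in Ioi 0, ∫⁻ x, squareDensity μ s' (hf.1.mk f) (t, x) ∂μ := by
        refine setLIntegral_congr_fun measurableSet_Ioi fun t ht => ?_
        rw [← lintegral_div_eq_squareDensity ht]
        simp_rw [theta_congr_ae (hss t ht) hff]
    _ ≤ _ := by
        refine hs.lintegral_squareDensity_le hn hα hD hμ hη0 hη48 hη1 hgm hB0 hgB
          (fun a l hl => ?_) (Real.toNNReal_pos.2 hc) (fun a l hl => ?_) hl₀' hfm hf2
        · rw [setIntegral_congr_ae₀ (g := b) (measurableSet_cube a l).nullMeasurableSet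
            (hgb.mono fun x hx _ => hx)]
          exact hacc a l hl
        · refine le_of_eq_of_le ?_ (hcar a l hl)
          refine setLIntegral_congr_fun measurableSet_Ioo fun t ht => ?_
          rw [← lintegral_div_eq_squareDensity ht.1]
          simp_rw [theta_congr_ae (hss t ht.1) hgb.symm]
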